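/- Let $G$ be a group with unit $e$ and $A$ a unital, not necessarily commutative ring. A $G$-$A$-coring $\underline{\mathcal C}=(\mathcal C_\alpha)_{\alpha\in G}$ is a family of $A$-bimodules with $A$-bimodule maps $\Delta_{\alpha,\beta}:\mathcal C_{\alpha\beta}\to\mathcal C_\alpha\otimes_A\mathcal C_\beta$, $\Delta_{\alpha,\beta}(c)=c_{(1,\alpha)}\otimes c_{(2,\beta)}$, and $\varepsilon:\mathcal C_e\to A$ such that $(\Delta_{\alpha,\beta}\otimes\mathcal C_\gamma)\Delta_{\alpha\beta,\gamma}=(\mathcal C_\alpha\otimes\Delta_{\beta,\gamma})\Delta_{\alpha,\beta\gamma}$ and $(\mathcal C_\alpha\otimes\varepsilon)\Delta_{\alpha,e}=\mathcal C_\alpha=(\varepsilon\otimes\mathcal C_\alpha)\Delta_{e,\alpha}$; morphisms are families of bimodule maps compatible with all $\Delta_{\alpha,\beta}$ and $\varepsilon$. A grouplike family is $\underline x=(x_\alpha)_{\alpha\in G}$ with $x_\alpha\in\mathcal C_\alpha$, $\Delta_{\alpha,\beta}(x_{\alpha\beta})=x_\alpha\otimes x_\beta$ and $\varepsilon(x_e)=1$.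 Let $(\underline{\mathcal C},\underline x)$ be a $G$-$A$-coring with a fixed grouplike family such that every $\mathcal C_\alpha$ is a left $A$-progenerator. Let $T=A^{{\rm co}\underline{\mathcal C}}=\{a\in A: a x_\alpha=x_\alpha a\ \text{for all }\alpha\in G\}$, and let $B\subset T$ be a subring. We use the following notation. (i) $(A\otimes_BA)\langle G\rangle$ is the $G$-$A$-coring with all components $A\otimes_BA$, $\Delta_{\alpha,\beta}(a\otimes b)=(a\otimes1)\otimes_A(1\otimes b)$ and $\varepsilon(a\otimes b)=ab$. The morphism of group corings $\underline{\rm can}':(A\otimes_BA)\langle G\rangle\to\underline{\mathcal C}$ is given by ${\rm can}'_\alpha(a\otimes b)=ax_\alpha b$. (ii) The left dual graded ring of $\underline{\mathcal C}$ is $R=\bigoplus_{\alpha}R_\alpha$, $R_\alpha={}_A{\rm Hom}(\mathcal C_{\alpha^{-1}},A)$, with product $(f\# g)(c)=g\bigl(c_{(1,\beta^{-1})}f(c_{(2,\alpha^{-1})})\bigr)$ for $f\in R_\alpha$, $g\in R_\beta$, $c\in\mathcal C_{(\alpha\beta)^{-1}}$, and unit $\varepsilon\in R_e$. The homomorphism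 of graded rings ${}^*\underline{\rm can}'$ from $R$ to the left dual graded ring of $(A\otimes_BA)\langle G\rangle$ sends $g\in R_\alpha$ to $g\circ{\rm can}'_{\alpha^{-1}}$. (iii) $S=\{(b_\alpha)\in\prod_{\alpha\in G}A: b_{\alpha\beta}x_{\beta^{-1}}=x_{\beta^{-1}}b_\alpha\ \text{for all }\alpha,\beta\}$, a subring of $\prod_{\alpha}A$ with right $G$-action $(b^\sigma)_\alpha=b_{\sigma\alpha}$; $i:T\to S$ sends $t$ to the constant family $(t)_\alpha$. $G*S=\bigoplus_\alpha u_\alpha S$ is the ring with product $(u_\alpha b)(u_\beta c)=u_{\alpha\beta}b^\beta c$. (iv) $A\{G\}=\bigoplus_\alpha\mu_\alpha(A)$ is the $(G*S,R)$-bimodule with $u_\sigma b\cdot\mu_\alpha(a)=\mu_{\sigma\alpha}(b_\alpha a)$ and $\mu_\alpha(a)\cdot f=\mu_{\alpha\beta}(f(x_{\beta^{-1}}a))$ for $f\in R_\beta$. (v) $Q$ is the set of $(q_\alpha)\in\prod_\alpha R_\alpha$ with $c_{(1,\beta^{-1})}q_\alpha(c_{(2,\alpha^{-1})})=q_{\alpha\beta}(c)x_{\beta^{-1}}$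 for all $\alpha,\beta$ and $c\in\mathcal C_{(\alpha\beta)^{-1}}$. $QG=\bigoplus_\alpha\omega_\alpha(Q)$ is the $(R,G*S)$-bimodule with $f\cdot\omega_\alpha(q)=\omega_{\beta\alpha}\bigl((f\# q_{\beta^{-1}\gamma})_\gamma\bigr)$ for $f\in R_\beta$ and $\omega_\alpha(q)\cdot u_\tau b=\omega_{\alpha\tau}\bigl(q\cdot b^{(\alpha\tau)^{-1}}\bigr)$, where $(q\cdot b)_\gamma(c)=q_\gamma(c)b_\gamma$. (vi) $\mathbb{GM}=(G*S,R,A\{G\},QG,\omega,\nu)$ is the Morita context with connecting maps $\omega:A\{G\}\otimes_RQG\to G*S$, $\omega(\mu_\alpha(a)\otimes\omega_\sigma(q))=u_{\alpha\sigma}\bigl(q_{\sigma\beta}(x_{(\sigma\beta)^{-1}}a)\bigr)_{\beta}$, and $\nu:QG\otimes_{G*S}A\{G\}\to R$, $\nu(\omega_\sigma(q)\otimes\mu_\alpha(a))=q_{\sigma\alpha}\cdot a$, where $(f\cdot a)(c)=f(c)a$. It is strict if $\omega$ and $\nu$ are both bijective. (vii) A right $G$-$\underline{\mathcal C}$-comodule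 is a family of right $A$-modules $(M_\alpha)_{\alpha\in G}$ with right $A$-linear maps $\rho_{\alpha,\beta}:M_{\alpha\beta}\to M_\alpha\otimes_A\mathcal C_\beta$ satisfying $(\rho_{\alpha,\beta}\otimes\mathcal C_\gamma)\rho_{\alpha\beta,\gamma}=(M_\alpha\otimes\Delta_{\beta,\gamma})\rho_{\alpha,\beta\gamma}$ and $(M_\alpha\otimes\varepsilon)\rho_{\alpha,e}=M_\alpha$; morphisms are families of right $A$-linear maps commuting with the $\rho_{\alpha,\beta}$. The functor $F_7$ from right $B$-modules to right $G$-$\underline{\mathcal C}$-comodules sends $N$ to the constant family $(N\otimes_BA)_{\alpha\in G}$ with $\rho_{\alpha,\beta}(n\otimes a)=(n\otimes1)\otimes x_\beta a$. Its right adjoint $G_7$ sends $M$ to $\{(m_\alpha)\in\prod_\alpha M_\alpha:\rho_{\alpha,\beta}(m_{\alpha\beta})=m_\alpha\otimes x_\beta\ \text{for all }\alpha,\beta\}$. Then the following statements are equivalent: 1. $\underline{\rm can}'$ is an isomorphism of group corings, and $A$ is faithfully flat as a left $B$-module; 2. ${}^*\underline{\rm can}'$ is an isomorphism of graded rings, and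 $A$ is a left $B$-progenerator; 3. $B=T$, the map $i:T\to S$ is an isomorphism, and the graded Morita context $\mathbb{GM}$ is strict; 4. $B=T$, and $(F_7,G_7)$ is an equivalence of categories, i.e. the unit and counit of the adjunction are natural isomorphisms. -/

import Mathlib

open scoped TensorProduct DirectSum
open MulOpposite

universe u

/-! ### Tensor products over a noncommutative ring -/

section BalTensor

/-- The subgroup of `M ⊗[ℤ] N` generated by the elements `m a ⊗ n - m ⊗ a n`. -/
def balRelators (A M N : Type*) [Ring A] [AddCommGroup M] [Module Aᵐᵒᵖ M]
    [AddCommGroup N] [Module A N] : AddSubgroup (M ⊗[ℤ] N) :=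
  AddSubgroup.closure {t | ∃ (m : M) (a : A) (n : N),
    t = (op a • m) ⊗ₜ[ℤ] n - m ⊗ₜ[ℤ] (a • n)}

/-- The tensor product `M ⊗_A N` of a right module and a left module over an arbitrary ring `A`. -/
def BalTensor (A M N : Type*) [Ring A] [AddCommGroup M] [Module Aᵐᵒᵖ M]
    [AddCommGroup N] [Module A N] : Type _ :=
  (M ⊗[ℤ] N) ⧸ balRelators A M N

namespace BalTensor

variable {A M M' N N' P : Type*} [Ring A] [AddCommGroup M] [Module Aᵐᵒᵖ M]
  [AddCommGroup M'] [Module Aᵐᵒᵖ M'] [AddCommGroup N] [Module A N]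
  [AddCommGroup N'] [Module A N'] [AddCommGroup P]

noncomputable instance : AddCommGroup (BalTensor A M N) :=
  inferInstanceAs (AddCommGroup ((M ⊗[ℤ] N) ⧸ balRelators A M N))

/-- The projection `M ⊗[ℤ] N → M ⊗_A N`. -/
noncomputable def proj (A M N : Type*) [Ring A] [AddCommGroup M] [Module Aᵐᵒᵖ M]
    [AddCommGroup N] [Module A N] : M ⊗[ℤ] N →+ BalTensor A M N :=
  QuotientAddGroup.mk' (balRelators A M N)

/-- The pure tensor `m ⊗ n`. -/
noncomputable def tmul (A : Type*) {M N : Type*} [Ring A] [AddCommGroup M] [Module Aᵐᵒᵖ M]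
    [AddCommGroup N] [Module A N] (m : M) (n : N) : BalTensor A M N :=
  proj A M N (m ⊗ₜ[ℤ] n)

theorem add_tmul (m m' : M) (n : N) : tmul A (m + m') n = tmul A m n + tmul A m' n := by
  simp only [tmul, TensorProduct.add_tmul, map_add]

theorem tmul_add (m : M) (n n' : N) : tmul A m (n + n') = tmul A m n + tmul A m n' := by
  simp only [tmul, TensorProduct.tmul_add, map_add]

theorem smul_tmul (m : M) (a : A) (n : N) : tmul A (op a • m) n = tmul A m (a • n) := by
  rw [← sub_eq_zero]
  rw [tmul, tmul, ← map_sub]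
  exact (QuotientAddGroup.eq_zero_iff _).2 (AddSubgroup.subset_closure ⟨m, a, n, rfl⟩)

theorem induction_on {p : BalTensor A M N → Prop} (t : BalTensor A M N) (zero : p 0)
    (tmul : ∀ m n, p (tmul A m n)) (add : ∀ s t, p s → p t → p (s + t)) : p t := by
  obtain ⟨t, rfl⟩ := QuotientAddGroup.mk'_surjective _ t
  induction t using TensorProduct.induction_on with
  | zero => rw [map_zero]; exact zero
  | tmul m n => exact tmul m n
  | add s t hs ht => rw [map_add]; exact add _ _ hs ht

theorem hom_ext {f g : BalTensor A M N →+ P} (h : ∀ m n, f (tmul A m n) = g (tmul A m n)) :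
    f = g := by
  ext t
  induction t using induction_on with
  | zero => simp
  | tmul m n => exact h m n
  | add s t hs ht => simp only [map_add, hs, ht]

/-- The universal property of the tensor product: balanced biadditive maps factor through it. -/
noncomputable def lift (f : M →+ N →+ P) (hf : ∀ m (a : A) n, f (op a • m) n = f m (a • n)) :
    BalTensor A M N →+ P :=
  QuotientAddGroup.lift (balRelators A M N)
    (TensorProduct.liftAddHom f (fun r m n => by simp)) (by
      rw [balRelators, AddSubgroup.closure_le]
      rintro _ ⟨m, a, n, rfl⟩
      simp [hf])

@[simp] theorem lift_tmul (f : M →+ N →+ P) (hf) (m : M) (n : N) :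
    lift (A := A) f hf (tmul A m n) = f m n := rfl

/-- The biadditive map `(m, n) ↦ m ⊗ n`. -/
noncomputable def mk (A M N : Type*) [Ring A] [AddCommGroup M] [Module Aᵐᵒᵖ M]
    [AddCommGroup N] [Module A N] : M →+ N →+ BalTensor A M N :=
  AddMonoidHom.mk' (fun m => AddMonoidHom.mk' (fun n => tmul A m n) (tmul_add m))
    (fun m m' => by ext n; exact add_tmul m m' n)

@[simp] theorem mk_apply (m : M) (n : N) : mk A M N m n = tmul A m n := rfl

/-- `f ⊗_A g` for a right linear map `f` and a left linear map `g`. -/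
noncomputable def map (f : M →ₗ[Aᵐᵒᵖ] M') (g : N →ₗ[A] N') :
    BalTensor A M N →+ BalTensor A M' N' :=
  lift (((mk A M' N').comp f.toAddMonoidHom).compl₂ g.toAddMonoidHom) (fun m a n => by
    simp [smul_tmul])

@[simp] theorem map_tmul (f : M →ₗ[Aᵐᵒᵖ] M') (g : N →ₗ[A] N') (m : M) (n : N) :
    map f g (tmul A m n) = tmul A (f m) (g n) := rfl

section RightModule

variable {S : Type*} [Ring S] [Module Sᵐᵒᵖ N] [SMulCommClass A Sᵐᵒᵖ N]

/-- If `N` is an `A`-`S`-bimodule then `M ⊗_A N` is a right `S`-module. -/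
noncomputable instance rightModule : Module Sᵐᵒᵖ (BalTensor A M N) where
  smul s t := map LinearMap.id
    ({ toFun := fun n => s • n
       map_add' := smul_add s
       map_smul' := fun a n => (smul_comm a s n).symm } : N →ₗ[A] N) t
  one_smul t := by
    induction t using induction_on with
    | zero => exact map_zero _
    | tmul m n => exact congrArg (tmul A m) (one_smul _ n)
    | add s t hs ht => exact (map_add _ _ _).trans (congrArg₂ _ hs ht)
  mul_smul r r' t := by
    induction t using induction_on with
    | zero => exact (map_zero _).trans ((congrArg _ (map_zero _)).trans (map_zero _)).symm
    | tmul m n => exact congrArg (tmul A m) (mul_smul r r' n)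
    | add s t hs ht =>
      exact ((map_add _ _ _).trans (congrArg₂ _ hs ht)).trans
        ((congrArg _ (map_add _ _ _)).trans (map_add _ _ _)).symm
  smul_zero r := map_zero _
  smul_add r s t := map_add _ _ _
  add_smul r r' t := by
    induction t using induction_on with
    | zero =>
      exact (map_zero _).trans ((congrArg₂ _ (map_zero _) (map_zero _)).trans (add_zero _)).symm
    | tmul m n =>
      exact (congrArg (tmul A m) (add_smul r r' n)).trans (tmul_add _ _ _)
    | add s t hs ht =>
      refine ((map_add _ _ _).trans (congrArg₂ _ hs ht)).trans ?_
      refine Eq.trans ?_ (congrArg₂ _ (map_add _ _ _) (map_add _ _ _)).symm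
      exact add_add_add_comm _ _ _ _
  zero_smul t := by
    induction t using induction_on with
    | zero => exact map_zero _
    | tmul m n =>
      exact (congrArg (tmul A m) (zero_smul _ n)).trans (map_zero (mk A M N m))
    | add s t hs ht => exact (map_add _ _ _).trans ((congrArg₂ _ hs ht).trans (add_zero _))

@[simp] theorem op_smul_tmul (s : Sᵐᵒᵖ) (m : M) (n : N) :
    s • tmul A m n = tmul A m (s • n) := rfl

end RightModule

section LeftModule

variable {S : Type*} [Ring S] [Module S M] [SMulCommClass S Aᵐᵒᵖ M]

/-- If `M` is an `S`-`A`-bimodule then `M ⊗_A N` is a left `S`-module. -/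
noncomputable instance (priority := low) leftModule : Module S (BalTensor A M N) where
  smul s t := map
    ({ toFun := fun n => s • n
       map_add' := smul_add s
       map_smul' := fun a n => smul_comm s a n } : M →ₗ[Aᵐᵒᵖ] M) LinearMap.id t
  one_smul t := by
    induction t using induction_on with
    | zero => exact map_zero _
    | tmul m n => exact congrArg (tmul A · n) (one_smul _ m)
    | add s t hs ht => exact (map_add _ _ _).trans (congrArg₂ _ hs ht)
  mul_smul r r' t := by
    induction t using induction_on with
    | zero => exact (map_zero _).trans ((congrArg _ (map_zero _)).trans (map_zero _)).symm
    | tmul m n => exact congrArg (tmul A · n) (mul_smul r r' m)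
    | add s t hs ht =>
      exact ((map_add _ _ _).trans (congrArg₂ _ hs ht)).trans
        ((congrArg _ (map_add _ _ _)).trans (map_add _ _ _)).symm
  smul_zero r := map_zero _
  smul_add r s t := map_add _ _ _
  add_smul r r' t := by
    induction t using induction_on with
    | zero =>
      exact (map_zero _).trans ((congrArg₂ _ (map_zero _) (map_zero _)).trans (add_zero _)).symm
    | tmul m n =>
      exact (congrArg (tmul A · n) (add_smul r r' m)).trans (add_tmul _ _ _)
    | add s t hs ht =>
      refine ((map_add _ _ _).trans (congrArg₂ _ hs ht)).trans ?_
      refine Eq.trans ?_ (congrArg₂ _ (map_add _ _ _) (map_add _ _ _)).symm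
      exact add_add_add_comm _ _ _ _
  zero_smul t := by
    induction t using induction_on with
    | zero => exact map_zero _
    | tmul m n =>
      exact (congrArg (tmul A · n) (zero_smul _ m)).trans
        (DFunLike.congr_fun (map_zero (mk A M N)) n)
    | add s t hs ht => exact (map_add _ _ _).trans ((congrArg₂ _ hs ht).trans (add_zero _))

@[simp] theorem left_smul_tmul (s : S) (m : M) (n : N) :
    s • tmul A m n = tmul A (s • m) n := rfl

variable {S' : Type*} [Ring S'] [Module S'ᵐᵒᵖ N] [SMulCommClass A S'ᵐᵒᵖ N]

instance : SMulCommClass S S'ᵐᵒᵖ (BalTensor A M N) where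
  smul_comm s s' t := by
    induction t using induction_on with
    | zero => simp
    | tmul m n => rfl
    | add x y hx hy => simp only [smul_add, hx, hy]

end LeftModule

/-- The map `m ⊗ n ↦ (p ↦ m ⊗ (n ⊗ p))`. -/
noncomputable def assocAux (A M N P : Type*) [Ring A] [AddCommGroup M] [Module Aᵐᵒᵖ M]
    [AddCommGroup N] [Module A N] [Module Aᵐᵒᵖ N] [SMulCommClass A Aᵐᵒᵖ N]
    [AddCommGroup P] [Module A P] :
    BalTensor A M N →+ P →+ BalTensor A M (BalTensor A N P) :=
  lift
    (AddMonoidHom.mk' (fun m => AddMonoidHom.mk'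
        (fun n => (mk A M (BalTensor A N P) m).comp (mk A N P n))
        (fun n n' => by
          ext p
          exact (congrArg (tmul A m) (add_tmul n n' p)).trans (tmul_add m _ _)))
      (fun m m' => by ext n p; exact add_tmul m m' _))
    (fun m a n => by ext p; exact smul_tmul m a (tmul A n p))

theorem assocAux_tmul {N : Type*} [AddCommGroup N] [Module A N] [Module Aᵐᵒᵖ N]
    [SMulCommClass A Aᵐᵒᵖ N] [Module A P] (m : M) (n : N) (p : P) :
    assocAux A M N P (tmul A m n) p = tmul A m (tmul A n p) := rfl

/-- The canonical map `(M ⊗_A N) ⊗_A P → M ⊗_A (N ⊗_A P)`, `(m ⊗ n) ⊗ p ↦ m ⊗ (n ⊗ p)`, for a right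
module `M`, a bimodule `N` and a left module `P`. -/
noncomputable def assoc (A M N P : Type*) [Ring A] [AddCommGroup M] [Module Aᵐᵒᵖ M]
    [AddCommGroup N] [Module A N] [Module Aᵐᵒᵖ N] [SMulCommClass A Aᵐᵒᵖ N]
    [AddCommGroup P] [Module A P] :
    BalTensor A (BalTensor A M N) P →+ BalTensor A M (BalTensor A N P) :=
  lift (assocAux A M N P) (fun t a p => by
    induction t using induction_on with
    | zero => rw [smul_zero, map_zero, AddMonoidHom.zero_apply, AddMonoidHom.zero_apply]
    | tmul m n =>
      rw [op_smul_tmul, assocAux_tmul, assocAux_tmul, smul_tmul]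
    | add s t hs ht => rw [smul_add, map_add, map_add, AddMonoidHom.add_apply,
        AddMonoidHom.add_apply, hs, ht])

@[simp] theorem assoc_tmul {N : Type*} [AddCommGroup N] [Module A N] [Module Aᵐᵒᵖ N]
    [SMulCommClass A Aᵐᵒᵖ N] [Module A P] (m : M) (n : N) (p : P) :
    assoc A M N P (tmul A (tmul A m n) p) = tmul A m (tmul A n p) := rfl

/-- For a left linear form `f` on `N`, the map `M ⊗_A N → M ⊗_A A ≅ M`, `m ⊗ n ↦ m f(n)`. -/
noncomputable def contractRight (M : Type*) {N : Type*} [AddCommGroup M] [Module Aᵐᵒᵖ M]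
    [AddCommGroup N] [Module A N] (f : N →ₗ[A] A) : BalTensor A M N →+ M :=
  lift (AddMonoidHom.mk' (fun m => AddMonoidHom.mk' (fun n => op (f n) • m)
      (fun n n' => by simp [add_smul]))
    (fun m m' => by ext n; simp))
    (fun m a n => by simp [mul_smul])

@[simp] theorem contractRight_tmul (f : N →ₗ[A] A) (m : M) (n : N) :
    contractRight M f (tmul A m n) = op (f n) • m := rfl

theorem contractRight_smul {S : Type*} [Ring S] [Module S M] [SMulCommClass S Aᵐᵒᵖ M]
    (f : N →ₗ[A] A) (s : S) (t : BalTensor A M N) :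
    contractRight M f (s • t) = s • contractRight M f t := by
  induction t using induction_on with
  | zero => simp
  | tmul m n =>
    rw [left_smul_tmul, contractRight_tmul, contractRight_tmul]
    exact (smul_comm s _ m).symm
  | add s t hs ht => rw [smul_add, map_add, hs, ht, map_add, smul_add]

theorem contractRight_add (f f' : N →ₗ[A] A) (t : BalTensor A M N) :
    contractRight M (f + f') t = contractRight M f t + contractRight M f' t := by
  induction t using induction_on with
  | zero => simp
  | tmul m n => simp [add_smul]
  | add s t hs ht => rw [map_add, hs, ht, map_add, map_add, add_add_add_comm]

/-- For a right linear form `f` on `M`, the map `M ⊗_A N → A ⊗_A N ≅ N`, `m ⊗ n ↦ f(m) n`. -/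
noncomputable def contractLeft {M : Type*} (N : Type*) [AddCommGroup M] [Module Aᵐᵒᵖ M]
    [AddCommGroup N] [Module A N] (f : M →ₗ[Aᵐᵒᵖ] A) : BalTensor A M N →+ N :=
  lift (AddMonoidHom.mk' (fun m => AddMonoidHom.mk' (fun n => f m • n)
      (fun n n' => by simp))
    (fun m m' => by ext n; simp [add_smul]))
    (fun m a n => by simp [mul_smul])

@[simp] theorem contractLeft_tmul (f : M →ₗ[Aᵐᵒᵖ] A) (m : M) (n : N) :
    contractLeft N f (tmul A m n) = f m • n := rfl

end BalTensor

end BalTensor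

/-! ### Bimodule maps, faithful flatness, progenerators -/

/-- Maps of `A`-bimodules. -/
structure BimodHom (A M N : Type*) [Ring A] [AddCommGroup M] [Module A M] [Module Aᵐᵒᵖ M]
    [AddCommGroup N] [Module A N] [Module Aᵐᵒᵖ N] extends M →ₗ[A] N where
  map_op_smul' : ∀ (a : A) (m : M), toFun (op a • m) = op a • toFun m

namespace BimodHom

variable {A M N : Type*} [Ring A] [AddCommGroup M] [Module A M] [Module Aᵐᵒᵖ M]
    [AddCommGroup N] [Module A N] [Module Aᵐᵒᵖ N]

/-- The underlying map of left modules. -/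
def left (f : BimodHom A M N) : M →ₗ[A] N := f.toLinearMap

/-- The underlying map of right modules. -/
def right (f : BimodHom A M N) : M →ₗ[Aᵐᵒᵖ] N where
  toFun := f.left
  map_add' := f.left.map_add
  map_smul' a m := f.map_op_smul' a.unop m

@[simp] theorem right_apply (f : BimodHom A M N) (m : M) : f.right m = f.left m := rfl

theorem map_op_smul (f : BimodHom A M N) (a : A) (m : M) :
    f.left (op a • m) = op a • f.left m := f.map_op_smul' a m

end BimodHom

/-- A left module `P` over a ring `R` is faithfully flat if `- ⊗_R P` preserves injections of right
`R`-modules and kills no nonzero right `R`-module. -/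
def LeftFaithfullyFlat (R P : Type u) [Ring R] [AddCommGroup P] [Module R P] : Prop :=
  (∀ (N N' : Type u) [AddCommGroup N] [AddCommGroup N'] [Module Rᵐᵒᵖ N] [Module Rᵐᵒᵖ N']
    (f : N →ₗ[Rᵐᵒᵖ] N'), Function.Injective f →
      Function.Injective (BalTensor.map f (LinearMap.id : P →ₗ[R] P))) ∧
  (∀ (N : Type u) [AddCommGroup N] [Module Rᵐᵒᵖ N],
    Subsingleton (BalTensor R N P) → Subsingleton N)

/-- A left `R`-module is a progenerator if it is finitely generated, projective and a generator;
the last condition says that `R` is a quotient of a finite direct sum of copies of `P`. -/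
def LeftProgenerator (R P : Type*) [Ring R] [AddCommGroup P] [Module R P] : Prop :=
  Module.Finite R P ∧ Module.Projective R P ∧
    ∃ (n : ℕ) (f : (Fin n → P) →ₗ[R] R), Function.Surjective f

/-! ### Morita contexts -/

/-- A Morita context connecting the rings `S` and `R`. -/
structure MoritaContext (S R P Q : Type*) [Ring S] [Ring R]
    [AddCommGroup P] [Module S P] [Module Rᵐᵒᵖ P] [SMulCommClass S Rᵐᵒᵖ P]
    [AddCommGroup Q] [Module R Q] [Module Sᵐᵒᵖ Q] [SMulCommClass R Sᵐᵒᵖ Q] where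
  /-- the connecting map `P ⊗_R Q → S` -/
  φ : BimodHom S (BalTensor R P Q) S
  /-- the connecting map `Q ⊗_S P → R` -/
  ψ : BimodHom R (BalTensor S Q P) R
  φ_smul : ∀ (p : P) (q : Q) (p' : P),
    φ.left (BalTensor.tmul R p q) • p' = op (ψ.left (BalTensor.tmul S q p')) • p
  ψ_smul : ∀ (q : Q) (p : P) (q' : Q),
    ψ.left (BalTensor.tmul S q p) • q' = op (φ.left (BalTensor.tmul R p q')) • q

/-- A Morita context is strict if both connecting maps are isomorphisms. -/
def MoritaContext.IsStrict {S R P Q : Type*} [Ring S] [Ring R]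
    [AddCommGroup P] [Module S P] [Module Rᵐᵒᵖ P] [SMulCommClass S Rᵐᵒᵖ P]
    [AddCommGroup Q] [Module R Q] [Module Sᵐᵒᵖ Q] [SMulCommClass R Sᵐᵒᵖ Q]
    (𝕄 : MoritaContext S R P Q) : Prop :=
  Function.Bijective 𝕄.φ.left ∧ Function.Bijective 𝕄.ψ.left

/-! ### Products of families graded by a group -/

section GradedProduct

open scoped Classical

variable {G : Type*} [Group G] {X Y Z U V W : G → Type*}
  [∀ α, AddCommGroup (X α)] [∀ α, AddCommGroup (Y α)] [∀ α, AddCommGroup (Z α)]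
  [∀ α, AddCommGroup (U α)] [∀ α, AddCommGroup (V α)] [∀ α, AddCommGroup (W α)]

/-- A family of biadditive maps `X α × Y β → Z (α β)`. The degree of the target is a variable `γ`
with a proof of `α * β = γ`, so that no transport along equalities in `G` is needed. -/
abbrev GradedPairing (X Y Z : G → Type*) [∀ α, AddCommGroup (X α)] [∀ α, AddCommGroup (Y α)]
    [∀ α, AddCommGroup (Z α)] :=
  ∀ (α β γ : G), α * β = γ → X α →+ Y β →+ Z γ

/-- The biadditive map on direct sums defined by a graded pairing. -/
noncomputable def gradedMul (m : GradedPairing X Y Z) :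
    (⨁ α, X α) →+ (⨁ α, Y α) →+ ⨁ α, Z α :=
  DirectSum.toAddMonoid fun α => AddMonoidHom.flip <| DirectSum.toAddMonoid fun β =>
    AddMonoidHom.flip <| (AddMonoidHom.compHom (DirectSum.of Z (α * β))).comp (m α β _ rfl)

theorem gradedMul_of (m : GradedPairing X Y Z) {α β γ : G} (h : α * β = γ) (x : X α) (y : Y β) :
    gradedMul m (DirectSum.of X α x) (DirectSum.of Y β y) = DirectSum.of Z γ (m α β γ h x y) := by
  subst h
  simp [gradedMul]

theorem gradedMul_assoc (m₁ : GradedPairing X Y U) (m₂ : GradedPairing U Z W)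
    (m₃ : GradedPairing Y Z V) (m₄ : GradedPairing X V W)
    (H : ∀ (α β γ αβ βγ δ : G) (h₁ : α * β = αβ) (h₂ : αβ * γ = δ) (h₃ : β * γ = βγ)
      (h₄ : α * βγ = δ) (x : X α) (y : Y β) (z : Z γ),
      m₂ αβ γ δ h₂ (m₁ α β αβ h₁ x y) z = m₄ α βγ δ h₄ x (m₃ β γ βγ h₃ y z))
    (x : ⨁ α, X α) (y : ⨁ α, Y α) (z : ⨁ α, Z α) :
    gradedMul m₂ (gradedMul m₁ x y) z = gradedMul m₄ x (gradedMul m₃ y z) := by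
  induction x using DirectSum.induction_on with
  | zero => simp
  | add x x' hx hx' => simp only [map_add, AddMonoidHom.add_apply, hx, hx']
  | of α x =>
    induction y using DirectSum.induction_on with
    | zero => simp
    | add y y' hy hy' => simp only [map_add, AddMonoidHom.add_apply, hy, hy']
    | of β y =>
      induction z using DirectSum.induction_on with
      | zero => simp
      | add z z' hz hz' => simp only [map_add, hz, hz']
      | of γ z =>
        rw [gradedMul_of m₁ rfl, gradedMul_of m₂ rfl, gradedMul_of m₃ rfl,
          gradedMul_of m₄ (mul_assoc α β γ).symm, H _ _ _ _ _ _ rfl rfl rfl]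

theorem gradedMul_one_left (m : GradedPairing X Y Y) (e : X 1)
    (H : ∀ (α : G) (h : 1 * α = α) (y : Y α), m 1 α α h e y = y) (y : ⨁ α, Y α) :
    gradedMul m (DirectSum.of X 1 e) y = y := by
  induction y using DirectSum.induction_on with
  | zero => simp
  | add y y' hy hy' => rw [map_add, hy, hy']
  | of β y => rw [gradedMul_of m (one_mul β), H]

theorem gradedMul_one_right (m : GradedPairing Y X Y) (e : X 1)
    (H : ∀ (α : G) (h : α * 1 = α) (y : Y α), m α 1 α h y e = y) (y : ⨁ α, Y α) :
    gradedMul m y (DirectSum.of X 1 e) = y := by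
  induction y using DirectSum.induction_on with
  | zero => simp
  | add y y' hy hy' => rw [map_add, AddMonoidHom.add_apply, hy, hy']
  | of β y => rw [gradedMul_of m (mul_one β), H]

theorem map_gradedMul {X' Y' Z' : G → Type*}
    [∀ α, AddCommGroup (X' α)] [∀ α, AddCommGroup (Y' α)] [∀ α, AddCommGroup (Z' α)]
    (m : GradedPairing X Y Z) (m' : GradedPairing X' Y' Z')
    (f : ∀ α, X α →+ X' α) (g : ∀ α, Y α →+ Y' α) (k : ∀ α, Z α →+ Z' α)
    (H : ∀ (α β γ : G) (h : α * β = γ) (x : X α) (y : Y β),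
      k γ (m α β γ h x y) = m' α β γ h (f α x) (g β y)) (x : ⨁ α, X α) (y : ⨁ α, Y α) :
    DirectSum.map k (gradedMul m x y) =
      gradedMul m' (DirectSum.map f x) (DirectSum.map g y) := by
  induction x using DirectSum.induction_on with
  | zero => simp
  | add x x' hx hx' => simp only [map_add, AddMonoidHom.add_apply, hx, hx']
  | of α x =>
    induction y using DirectSum.induction_on with
    | zero => simp
    | add y y' hy hy' => simp only [map_add, hy, hy']
    | of β y =>
      rw [gradedMul_of m rfl, DirectSum.map_of, DirectSum.map_of, DirectSum.map_of,
        gradedMul_of m' rfl, H]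

end GradedProduct

/-! ### Group corings -/

/-- A `G`-`A`-coring. The comultiplication `Δ_{α,β}` is defined on `C γ` for every `γ` with
`α * β = γ`, and the counit on `C γ` for every `γ` with `γ = 1`, so that no transport along
equalities in `G` is needed. -/
structure GroupCoring (G A : Type u) [Group G] [Ring A] where
  C : G → Type u
  [addCommGroup : ∀ α, AddCommGroup (C α)]
  [leftModule : ∀ α, Module A (C α)]
  [rightModule : ∀ α, Module Aᵐᵒᵖ (C α)]
  [smulCommClass : ∀ α, SMulCommClass A Aᵐᵒᵖ (C α)]
  /-- comultiplication -/
  Δ : ∀ (α β γ : G), α * β = γ → BimodHom A (C γ) (BalTensor A (C α) (C β))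
  /-- counit -/
  ε : ∀ (γ : G), γ = 1 → BimodHom A (C γ) A
  coassoc : ∀ (α β γ αβ βγ δ : G) (h₁ : α * β = αβ) (h₂ : αβ * γ = δ) (h₃ : β * γ = βγ)
    (h₄ : α * βγ = δ) (c : C δ),
    BalTensor.assoc A (C α) (C β) (C γ)
      (BalTensor.map (Δ α β αβ h₁).right LinearMap.id ((Δ αβ γ δ h₂).left c)) =
    BalTensor.map LinearMap.id (Δ β γ βγ h₃).left ((Δ α βγ δ h₄).left c)
  counit_right : ∀ (α e : G) (he : e = 1) (h : α * e = α) (c : C α),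
    BalTensor.contractRight (C α) (ε e he).left ((Δ α e α h).left c) = c
  counit_left : ∀ (α e : G) (he : e = 1) (h : e * α = α) (c : C α),
    BalTensor.contractLeft (C α) (ε e he).right ((Δ e α α h).left c) = c

attribute [instance] GroupCoring.addCommGroup GroupCoring.leftModule GroupCoring.rightModule
  GroupCoring.smulCommClass

namespace GroupCoring

variable {G A : Type u} [Group G] [Ring A]

/-- Morphisms of `G`-`A`-corings. -/
structure Hom (𝒞 𝒟 : GroupCoring G A) where
  f : ∀ α, BimodHom A (𝒞.C α) (𝒟.C α)
  comm_Δ : ∀ (α β γ : G) (h : α * β = γ) (c : 𝒞.C γ),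
    BalTensor.map (f α).right (f β).left ((𝒞.Δ α β γ h).left c) =
      (𝒟.Δ α β γ h).left ((f γ).left c)
  comm_ε : ∀ (e : G) (he : e = 1) (c : 𝒞.C e), (𝒟.ε e he).left ((f e).left c) = (𝒞.ε e he).left c

/-- A morphism of group corings is an isomorphism if it has a two-sided inverse which is a morphism
of group corings. -/
def Hom.IsIso {𝒞 𝒟 : GroupCoring G A} (f : Hom 𝒞 𝒟) : Prop :=
  ∃ g : Hom 𝒟 𝒞, (∀ α c, (g.f α).left ((f.f α).left c) = c) ∧
    ∀ α d, (f.f α).left ((g.f α).left d) = d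

/-- A left homogeneous progenerator group coring. -/
def IsLeftHomogeneousProgenerator (𝒞 : GroupCoring G A) : Prop :=
  ∀ α, LeftProgenerator A (𝒞.C α)

/-! ### The left dual graded ring -/

/-- The component `R_α = {}_A Hom(C_{α⁻¹}, A)` of the left dual graded ring. -/
abbrev Dual (𝒞 : GroupCoring G A) (α : G) : Type u := 𝒞.C α⁻¹ →ₗ[A] A

/-- The product `(f # g)(c) = g (c_{(1,β⁻¹)} f (c_{(2,α⁻¹)}))` of `f ∈ R_α` and `g ∈ R_β`. -/
noncomputable def hash (𝒞 : GroupCoring G A) : GradedPairing 𝒞.Dual 𝒞.Dual 𝒞.Dual :=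
  fun α β γ h =>
    AddMonoidHom.mk' (fun f => AddMonoidHom.mk' (fun g =>
      { toFun := fun c => g (BalTensor.contractRight (𝒞.C β⁻¹) f
          ((𝒞.Δ β⁻¹ α⁻¹ γ⁻¹ (by rw [← h, mul_inv_rev])).left c))
        map_add' := fun c d => by simp only [map_add]
        map_smul' := fun a c => by
          rw [map_smul, BalTensor.contractRight_smul, map_smul, RingHom.id_apply] })
      (fun g g' => by ext c; rfl))
    (fun f f' => by
      ext g c
      exact (congrArg g (BalTensor.contractRight_add f f' _)).trans (map_add g _ _))

variable (𝒞 : GroupCoring G A)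

theorem hash_apply {α β γ : G} (h : α * β = γ) (f : 𝒞.Dual α) (g : 𝒞.Dual β) (c : 𝒞.C γ⁻¹) :
    𝒞.hash α β γ h f g c = g (BalTensor.contractRight (𝒞.C β⁻¹) f
      ((𝒞.Δ β⁻¹ α⁻¹ γ⁻¹ (by rw [← h, mul_inv_rev])).left c)) := rfl

theorem hash_assoc (α β γ αβ βγ δ : G) (h₁ : α * β = αβ) (h₂ : αβ * γ = δ) (h₃ : β * γ = βγ)
    (h₄ : α * βγ = δ) (f : 𝒞.Dual α) (g : 𝒞.Dual β) (k : 𝒞.Dual γ) :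
    𝒞.hash αβ γ δ h₂ (𝒞.hash α β αβ h₁ f g) k = 𝒞.hash α βγ δ h₄ f (𝒞.hash β γ βγ h₃ g k) := by
  have e₁ : β⁻¹ * α⁻¹ = αβ⁻¹ := by rw [← h₁, mul_inv_rev]
  have e₂ : γ⁻¹ * αβ⁻¹ = δ⁻¹ := by rw [← h₂, mul_inv_rev]
  have e₃ : γ⁻¹ * β⁻¹ = βγ⁻¹ := by rw [← h₃, mul_inv_rev]
  have e₄ : βγ⁻¹ * α⁻¹ = δ⁻¹ := by rw [← h₄, mul_inv_rev]
  ext c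
  rw [hash_apply, hash_apply, hash_apply]
  congr 1
  have H := 𝒞.coassoc γ⁻¹ β⁻¹ α⁻¹ βγ⁻¹ αβ⁻¹ δ⁻¹ e₃ e₄ e₁ e₂ c
  have key := congrArg (BalTensor.contractRight (𝒞.C γ⁻¹) g)
    (congrArg (BalTensor.map (LinearMap.id : 𝒞.C γ⁻¹ →ₗ[Aᵐᵒᵖ] 𝒞.C γ⁻¹)
      (N := BalTensor A (𝒞.C β⁻¹) (𝒞.C α⁻¹)) (N' := 𝒞.C β⁻¹)
      { toFun := BalTensor.contractRight (𝒞.C β⁻¹) f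
        map_add' := map_add _
        map_smul' := BalTensor.contractRight_smul f }) H)
  generalize (𝒞.Δ γ⁻¹ αβ⁻¹ δ⁻¹ e₂).left c = s at key ⊢
  generalize (𝒞.Δ βγ⁻¹ α⁻¹ δ⁻¹ e₄).left c = t at key ⊢
  refine Eq.trans (Eq.trans ?_ key.symm) ?_
  · clear key H
    induction s using BalTensor.induction_on with
    | zero => simp
    | tmul m n => rfl
    | add s t hs ht => simp only [map_add, hs, ht]
  · clear key H
    induction t using BalTensor.induction_on with
    | zero => simp
    | tmul m n =>
      rw [BalTensor.map_tmul, BalTensor.contractRight_tmul, BimodHom.map_op_smul,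
        BimodHom.right_apply]
      generalize (𝒞.Δ γ⁻¹ β⁻¹ βγ⁻¹ e₃).left m = u
      induction u using BalTensor.induction_on with
      | zero => simp [BalTensor.tmul, TensorProduct.zero_tmul]
      | tmul m' n' => rfl
      | add x y hx hy =>
        rw [BalTensor.add_tmul, map_add, map_add, map_add, hx, hy, smul_add, map_add]
    | add s t hs ht => simp only [map_add, hs, ht]

theorem one_hash (α : G) (h : 1 * α = α) (f : 𝒞.Dual α) :
    𝒞.hash 1 α α h (𝒞.ε 1⁻¹ inv_one).left f = f := by
  ext c
  rw [hash_apply, 𝒞.counit_right]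

theorem hash_one (α : G) (h : α * 1 = α) (f : 𝒞.Dual α) :
    𝒞.hash α 1 α h f (𝒞.ε 1⁻¹ inv_one).left = f := by
  ext c
  rw [hash_apply]
  conv_rhs => rw [← 𝒞.counit_left α⁻¹ 1⁻¹ inv_one (by simp) c]
  generalize (𝒞.Δ 1⁻¹ α⁻¹ α⁻¹ _).left c = t
  induction t using BalTensor.induction_on with
  | zero => simp
  | tmul m n =>
    rw [BalTensor.contractRight_tmul, BalTensor.contractLeft_tmul, BimodHom.map_op_smul,
      BimodHom.right_apply, map_smul]
    simp
  | add s t hs ht => simp only [map_add, hs, ht]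

open scoped Classical

/-- The left dual graded ring `R = {}^*𝒞 = ⨁ R_α`. -/
def LeftDual : Type u := ⨁ α : G, 𝒞.Dual α

namespace LeftDual

noncomputable instance : AddCommGroup 𝒞.LeftDual := inferInstanceAs (AddCommGroup (⨁ α, 𝒞.Dual α))

/-- The inclusion `R_α → R`. -/
noncomputable def of (α : G) : 𝒞.Dual α →+ 𝒞.LeftDual := DirectSum.of 𝒞.Dual α

noncomputable instance : Ring 𝒞.LeftDual where
  __ := (inferInstance : AddCommGroup 𝒞.LeftDual)
  mul f g := gradedMul 𝒞.hash f g
  one := of 𝒞 1 (𝒞.ε 1⁻¹ inv_one).left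
  mul_assoc := gradedMul_assoc _ _ _ _ 𝒞.hash_assoc
  one_mul := gradedMul_one_left _ _ 𝒞.one_hash
  mul_one := gradedMul_one_right _ _ 𝒞.hash_one
  left_distrib f := (gradedMul 𝒞.hash f).map_add
  right_distrib f g h := DFunLike.congr_fun (map_add (gradedMul 𝒞.hash) f g) h
  zero_mul f := DFunLike.congr_fun (map_zero (gradedMul 𝒞.hash)) f
  mul_zero f := map_zero (gradedMul 𝒞.hash f)

theorem mul_def (f g : 𝒞.LeftDual) : f * g = gradedMul 𝒞.hash f g := rfl

theorem one_def : (1 : 𝒞.LeftDual) = of 𝒞 1 (𝒞.ε 1⁻¹ inv_one).left := rfl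

end LeftDual

variable {𝒞} {𝒟 : GroupCoring G A}

/-- The component `g ↦ g ∘ f_{α⁻¹}` of the dual of a morphism of group corings. -/
def Hom.dualComponent (f : Hom 𝒞 𝒟) (α : G) : 𝒟.Dual α →+ 𝒞.Dual α :=
  AddMonoidHom.mk' (fun g => g.comp (f.f α⁻¹).left) (fun _ _ => rfl)

/-- The dual `{}^*f : {}^*𝒟 → {}^*𝒞`, `∑ g_α ↦ ∑ g_α ∘ f_{α⁻¹}`, of a morphism of group corings. -/
noncomputable def Hom.leftDual (f : Hom 𝒞 𝒟) : 𝒟.LeftDual →+* 𝒞.LeftDual where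
  toFun := DirectSum.map f.dualComponent
  map_zero' := map_zero (DirectSum.map f.dualComponent)
  map_add' := map_add (DirectSum.map f.dualComponent)
  map_one' := (DirectSum.map_of _ _ _).trans <| congrArg (LeftDual.of 𝒞 1) <| by
    ext c
    exact f.comm_ε _ _ c
  map_mul' := map_gradedMul 𝒟.hash 𝒞.hash _ _ _ fun α β γ h x y => by
    ext c
    have H := f.comm_Δ β⁻¹ α⁻¹ γ⁻¹ (by rw [← h, mul_inv_rev]) c
    refine congrArg y ((congrArg (BalTensor.contractRight (𝒟.C β⁻¹) x) H.symm).trans ?_)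
    generalize (𝒞.Δ β⁻¹ α⁻¹ γ⁻¹ _).left c = t
    clear H
    induction t using BalTensor.induction_on with
    | zero => simp
    | tmul m n =>
      rw [BalTensor.map_tmul, BalTensor.contractRight_tmul, BalTensor.contractRight_tmul,
        BimodHom.map_op_smul]
      rfl
    | add s t hs ht => simp only [map_add, hs, ht]

end GroupCoring

namespace GroupCoring

/-! ### Grouplike families and the associated graded Morita context -/

/-- A grouplike family of a group coring. -/
structure Grouplike {G A : Type u} [Group G] [Ring A] (𝒞 : GroupCoring G A) where
  x : ∀ α, 𝒞.C α
  comul_x : ∀ (α β γ : G) (h : α * β = γ), (𝒞.Δ α β γ h).left (x γ) = BalTensor.tmul A (x α) (x β)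
  counit_x : ∀ (e : G) (he : e = 1), (𝒞.ε e he).left (x e) = 1

namespace Grouplike

variable {G A : Type u} [Group G] [Ring A] {𝒞 : GroupCoring G A} (x : Grouplike 𝒞)

/-- The subring `T = A^{co 𝒞}` of `A`. -/
def T : Subring A where
  carrier := {a | ∀ α, a • x.x α = op a • x.x α}
  zero_mem' α := by simp
  one_mem' α := by simp
  add_mem' ha hb α := by rw [add_smul, ha α, hb α, MulOpposite.op_add, add_smul]
  neg_mem' ha α := by rw [neg_smul, ha α, MulOpposite.op_neg, neg_smul]
  mul_mem' {a b} ha hb α := by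
    rw [mul_smul, hb α, smul_comm, ha α, MulOpposite.op_mul, mul_smul]

/-- The ring `S` of families `b` with `b_{αβ} x_{β⁻¹} = x_{β⁻¹} b_α`. -/
def S : Subring (G → A) where
  carrier := {b | ∀ α β γ : G, α * β = γ → b γ • x.x β⁻¹ = op (b α) • x.x β⁻¹}
  zero_mem' α β γ h := by simp
  one_mem' α β γ h := by simp
  add_mem' ha hb α β γ h := by
    rw [Pi.add_apply, Pi.add_apply, add_smul, ha α β γ h, hb α β γ h, MulOpposite.op_add, add_smul]
  neg_mem' ha α β γ h := by
    rw [Pi.neg_apply, Pi.neg_apply, neg_smul, ha α β γ h, MulOpposite.op_neg, neg_smul]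
  mul_mem' {a b} ha hb α β γ h := by
    rw [Pi.mul_apply, Pi.mul_apply, mul_smul, hb α β γ h, smul_comm, ha α β γ h,
      MulOpposite.op_mul, mul_smul]

/-- The ring homomorphism `i : T → S`, sending `b` to the constant family. -/
def i : x.T →+* x.S where
  toFun b := ⟨fun _ => b, fun _ β _ _ => b.2 β⁻¹⟩
  map_one' := rfl
  map_mul' _ _ := rfl
  map_zero' := rfl
  map_add' _ _ := rfl

/-- The right action of `G` on `S`, `(b^σ)_α = b_{σα}`. -/
def shift (σ : G) : x.S →+* x.S where
  toFun b := ⟨fun α => b.1 (σ * α), fun α β γ h => b.2 _ β _ (by rw [← h, mul_assoc])⟩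
  map_one' := rfl
  map_mul' _ _ := rfl
  map_zero' := rfl
  map_add' _ _ := rfl

/-- The group `Q` of families `q ∈ ∏ R_α` with
`c_{(1,β⁻¹)} q_α (c_{(2,α⁻¹)}) = q_{αβ}(c) x_{β⁻¹}` for all `c ∈ C_{(αβ)⁻¹}`. -/
def Q : AddSubgroup (∀ α, 𝒞.Dual α) where
  carrier := {q | ∀ (α β γ : G) (h : α * β = γ) (c : 𝒞.C γ⁻¹),
    BalTensor.contractRight (𝒞.C β⁻¹) (q α)
      ((𝒞.Δ β⁻¹ α⁻¹ γ⁻¹ (by rw [← h, mul_inv_rev])).left c) = q γ c • x.x β⁻¹}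
  zero_mem' α β γ h c := by
    have := BalTensor.contractRight_add (M := 𝒞.C β⁻¹) (0 : 𝒞.Dual α) 0
      ((𝒞.Δ β⁻¹ α⁻¹ γ⁻¹ (by rw [← h, mul_inv_rev])).left c)
    rw [add_zero, left_eq_add] at this
    exact this.trans (zero_smul A _).symm
  add_mem' {q q'} hq hq' α β γ h c := by
    rw [Pi.add_apply, BalTensor.contractRight_add, hq α β γ h, hq' α β γ h, Pi.add_apply,
      LinearMap.add_apply, add_smul]
  neg_mem' {q} hq α β γ h c := by
    have := BalTensor.contractRight_add (M := 𝒞.C β⁻¹) (q α) (-q α)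
      ((𝒞.Δ β⁻¹ α⁻¹ γ⁻¹ (by rw [← h, mul_inv_rev])).left c)
    have h0 := BalTensor.contractRight_add (M := 𝒞.C β⁻¹) (0 : 𝒞.Dual α) 0
      ((𝒞.Δ β⁻¹ α⁻¹ γ⁻¹ (by rw [← h, mul_inv_rev])).left c)
    rw [add_zero, left_eq_add] at h0
    rw [add_neg_cancel, h0, hq α β γ h] at this
    rw [Pi.neg_apply, Pi.neg_apply, LinearMap.neg_apply, neg_smul]
    exact (neg_eq_of_add_eq_zero_right this.symm).symm

/-- `f · q = (f # q_{γ⁻¹ α})_α` for `f ∈ R_γ` and `q ∈ Q`. -/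
noncomputable def dualMulQ (γ : G) (f : 𝒞.Dual γ) (q : x.Q) : x.Q :=
  ⟨fun α => 𝒞.hash γ (γ⁻¹ * α) α (mul_inv_cancel_left γ α) f (q.1 (γ⁻¹ * α)), by
    intro α β δ h c
    have e₁ : (γ⁻¹ * α)⁻¹ * γ⁻¹ = α⁻¹ := by group
    have e₂ : β⁻¹ * α⁻¹ = δ⁻¹ := by rw [← h, mul_inv_rev]
    have e₃ : β⁻¹ * (γ⁻¹ * α)⁻¹ = (γ⁻¹ * δ)⁻¹ := by rw [← h]; group
    have e₄ : (γ⁻¹ * δ)⁻¹ * γ⁻¹ = δ⁻¹ := by group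
    have H := 𝒞.coassoc β⁻¹ (γ⁻¹ * α)⁻¹ γ⁻¹ (γ⁻¹ * δ)⁻¹ α⁻¹ δ⁻¹ e₃ e₄ e₁ e₂ c
    have key := congrArg (BalTensor.contractRight (𝒞.C β⁻¹) (q.1 (γ⁻¹ * α)))
      (congrArg (BalTensor.map (LinearMap.id : 𝒞.C β⁻¹ →ₗ[Aᵐᵒᵖ] 𝒞.C β⁻¹)
        (N := BalTensor A (𝒞.C (γ⁻¹ * α)⁻¹) (𝒞.C γ⁻¹)) (N' := 𝒞.C (γ⁻¹ * α)⁻¹)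
        { toFun := BalTensor.contractRight (𝒞.C (γ⁻¹ * α)⁻¹) f
          map_add' := map_add _
          map_smul' := BalTensor.contractRight_smul f }) H)
    have hq := q.2 (γ⁻¹ * α) β (γ⁻¹ * δ) (by rw [← h]; group)
    rw [hash_apply, ← hq]
    generalize (𝒞.Δ β⁻¹ α⁻¹ δ⁻¹ e₂).left c = s at key ⊢
    generalize (𝒞.Δ (γ⁻¹ * δ)⁻¹ γ⁻¹ δ⁻¹ e₄).left c = t at key ⊢
    refine Eq.trans (Eq.trans ?_ key.symm) ?_
    · clear key H
      induction s using BalTensor.induction_on with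
      | zero => simp
      | tmul m n => rfl
      | add s t hs ht => simp only [map_add, hs, ht]
    · clear key H
      induction t using BalTensor.induction_on with
      | zero => simp
      | tmul m n =>
        rw [BalTensor.map_tmul, BalTensor.contractRight_tmul, BimodHom.map_op_smul,
          BimodHom.right_apply]
        generalize (𝒞.Δ β⁻¹ (γ⁻¹ * α)⁻¹ (γ⁻¹ * δ)⁻¹ e₃).left m = u
        induction u using BalTensor.induction_on with
        | zero => simp [BalTensor.tmul, TensorProduct.zero_tmul]
        | tmul m' n' => rfl
        | add x y hx hy =>
          rw [BalTensor.add_tmul, map_add, map_add, map_add, hx, hy, smul_add, map_add]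
      | add s t hs ht => simp only [map_add, hs, ht]⟩

/-- `q · b = (q_α · b_α)_α` for `q ∈ Q` and `b ∈ S`. -/
noncomputable def QMulS (q : x.Q) (b : x.S) : x.Q :=
  ⟨fun α => op (b.1 α) • q.1 α, by
    intro α β γ h c
    have hq := q.2 α β γ h c
    rw [LinearMap.smul_apply, op_smul_eq_mul, mul_smul, b.2 α β γ h, smul_comm, ← hq]
    generalize (𝒞.Δ β⁻¹ α⁻¹ γ⁻¹ _).left c = t
    clear hq
    induction t using BalTensor.induction_on with
    | zero => simp
    | tmul m n =>
      rw [BalTensor.contractRight_tmul, BalTensor.contractRight_tmul, LinearMap.smul_apply,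
        op_smul_eq_mul, MulOpposite.op_mul, mul_smul]
    | add s t hs ht => simp only [map_add, hs, ht, smul_add]⟩

/-- The family `(q_{σβ} (x_{(σβ)⁻¹} a))_β ∈ S` for `a ∈ A` and `q ∈ Q`. -/
def evalQ (σ : G) (a : A) (q : x.Q) : x.S :=
  ⟨fun β => q.1 (σ * β) (op a • x.x (σ * β)⁻¹), by
    intro α β γ h
    have hq := q.2 (σ * α) β (σ * γ) (by rw [← h, mul_assoc]) (op a • x.x (σ * γ)⁻¹)
    rw [← hq, BimodHom.map_op_smul, x.comul_x, BalTensor.op_smul_tmul,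
      BalTensor.contractRight_tmul]⟩

/-- The right action of `R` on `A{G}`: `μ_α(a) · f = μ_{αβ}(f(x_{β⁻¹} a))` for `f ∈ R_β`. -/
def pairingAR : GradedPairing (fun _ : G => A) 𝒞.Dual (fun _ : G => A) := fun _ β _ _ =>
  AddMonoidHom.mk' (fun a => AddMonoidHom.mk' (fun f => f (op a • x.x β⁻¹)) (fun _ _ => rfl))
    (fun a a' => by ext f; simp [add_smul])

/-- The multiplication of `G*S`: `(u_α b)(u_β c) = u_{αβ} b^β c`. -/
def pairingSS : GradedPairing (fun _ : G => x.S) (fun _ : G => x.S) (fun _ : G => x.S) :=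
  fun _ β _ _ =>
    AddMonoidHom.mk' (fun b => AddMonoidHom.mk' (fun c => x.shift β b * c) (fun _ _ => mul_add _ _ _))
      (fun b b' => by ext1 c; simp [add_mul])

/-- The left action of `G*S` on `A{G}`: `u_σ b · μ_α(a) = μ_{σα}(b_α a)`. -/
def pairingSA : GradedPairing (fun _ : G => x.S) (fun _ : G => A) (fun _ : G => A) :=
  fun _ α _ _ =>
    AddMonoidHom.mk' (fun b => AddMonoidHom.mk' (fun a => b.1 α * a) (fun _ _ => mul_add _ _ _))
      (fun b b' => by ext1 c; exact add_mul _ _ _)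

/-- The left action of `R` on `QG`: `f · ω_α(q) = ω_{βα}(f · q)` for `f ∈ R_β`. -/
noncomputable def pairingRQ : GradedPairing 𝒞.Dual (fun _ : G => x.Q) (fun _ : G => x.Q) :=
  fun β _ _ _ =>
    AddMonoidHom.mk' (fun f => AddMonoidHom.mk' (fun q => x.dualMulQ β f q)
      (fun q q' => Subtype.ext (funext fun α => map_add (𝒞.hash β _ α _ f) _ _)))
      (fun f f' => by
        ext1 q
        exact Subtype.ext (funext fun α => DFunLike.congr_fun (map_add (𝒞.hash β _ α _) f f') _))

/-- The right action of `G*S` on `QG`: `ω_α(q) · u_τ b = ω_{ατ}(q · b^{(ατ)⁻¹})`. -/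
noncomputable def pairingQS :
    GradedPairing (fun _ : G => x.Q) (fun _ : G => x.S) (fun _ : G => x.Q) :=
  fun _ _ δ _ =>
    AddMonoidHom.mk' (fun q => AddMonoidHom.mk' (fun b => x.QMulS q (x.shift δ⁻¹ b))
      (fun b b' => Subtype.ext (funext fun α => by
        exact (congrArg (· • q.1 α) (MulOpposite.op_add _ _)).trans (add_smul _ _ (q.1 α)))))
      (fun q q' => by
        ext1 b
        exact Subtype.ext (funext fun α => smul_add _ (q.1 α) (q'.1 α)))

/-- `μ_α(a) ⊗ ω_σ(q) ↦ u_{ασ} (q_{σβ}(x_{(σβ)⁻¹} a))_β`. -/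
def pairingAQ : GradedPairing (fun _ : G => A) (fun _ : G => x.Q) (fun _ : G => x.S) :=
  fun _ σ _ _ =>
    AddMonoidHom.mk' (fun a => AddMonoidHom.mk' (fun q => x.evalQ σ a q) (fun _ _ => rfl))
      (fun a a' => by
        ext1 q
        refine Subtype.ext (funext fun β => ?_)
        change q.1 (σ * β) _ = q.1 (σ * β) _ + q.1 (σ * β) _
        rw [MulOpposite.op_add, add_smul, map_add])

/-- `ω_σ(q) ⊗ μ_α(a) ↦ q_{σα} · a`. -/
def pairingQA : GradedPairing (fun _ : G => x.Q) (fun _ : G => A) 𝒞.Dual :=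
  fun _ _ γ _ =>
    AddMonoidHom.mk' (fun q => AddMonoidHom.mk' (fun a => op a • q.1 γ)
      (fun a a' => by rw [MulOpposite.op_add, add_smul]))
      (fun q q' => by ext1 a; exact smul_add _ (q.1 γ) (q'.1 γ))

/-- The twisted group ring `G*S = ⨁ u_α S`. -/
def GS (x : Grouplike 𝒞) : Type u := ⨁ _ : G, x.S

/-- The graded module `A{G} = ⨁ μ_α(A)`. -/
def AG (_x : Grouplike 𝒞) : Type u := ⨁ _ : G, A

/-- The graded module `QG = ⨁ ω_α(Q)`. -/
def QG (x : Grouplike 𝒞) : Type u := ⨁ _ : G, x.Q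

noncomputable instance : AddCommGroup x.GS := inferInstanceAs (AddCommGroup (⨁ _ : G, x.S))
noncomputable instance : AddCommGroup x.AG := inferInstanceAs (AddCommGroup (⨁ _ : G, A))
noncomputable instance : AddCommGroup x.QG := inferInstanceAs (AddCommGroup (⨁ _ : G, x.Q))

open scoped Classical in
/-- The element `u_α b` of `G*S`. -/
noncomputable def u (α : G) : x.S →+ x.GS := DirectSum.of (fun _ : G => x.S) α

open scoped Classical in
/-- The element `μ_α(a)` of `A{G}`. -/
noncomputable def μ (α : G) : A →+ x.AG := DirectSum.of (fun _ : G => A) α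

open scoped Classical in
/-- The element `ω_α(q)` of `QG`. -/
noncomputable def ω (α : G) : x.Q →+ x.QG := DirectSum.of (fun _ : G => x.Q) α

noncomputable instance : Ring x.GS where
  __ := (inferInstance : AddCommGroup x.GS)
  mul s t := gradedMul x.pairingSS s t
  one := x.u 1 1
  mul_assoc := gradedMul_assoc _ _ _ _ fun α β γ αβ βγ δ h₁ h₂ h₃ h₄ b c d =>
    Subtype.ext <| funext fun σ => by
      subst h₃
      change b.1 (β * (γ * σ)) * c.1 (γ * σ) * d.1 σ =
        b.1 ((β * γ) * σ) * (c.1 (γ * σ) * d.1 σ)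
      rw [mul_assoc, mul_assoc]
  one_mul := gradedMul_one_left _ _ fun α h b => Subtype.ext <| funext fun σ => one_mul (b.1 σ)
  mul_one := gradedMul_one_right _ _ fun α h b => Subtype.ext <| funext fun σ => by
    change b.1 (1 * σ) * 1 = b.1 σ
    rw [one_mul, mul_one]
  left_distrib s := (gradedMul x.pairingSS s).map_add
  right_distrib s t r := DFunLike.congr_fun (map_add (gradedMul x.pairingSS) s t) r
  zero_mul s := DFunLike.congr_fun (map_zero (gradedMul x.pairingSS)) s
  mul_zero s := map_zero (gradedMul x.pairingSS s)

noncomputable instance : Module 𝒞.LeftDualᵐᵒᵖ x.AG where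
  smul f p := gradedMul x.pairingAR p f.unop
  one_smul := gradedMul_one_right _ _ fun α h a => by
    change (𝒞.ε 1⁻¹ inv_one).left (op a • x.x 1⁻¹) = a
    rw [BimodHom.map_op_smul, x.counit_x, op_smul_eq_mul, one_mul]
  mul_smul f g p := (gradedMul_assoc _ _ _ _ (fun α β γ αβ βγ δ h₁ h₂ h₃ h₄ a f g => by
    change g (op (f (op a • x.x β⁻¹)) • x.x γ⁻¹) = 𝒞.hash β γ βγ h₃ f g (op a • x.x βγ⁻¹)
    rw [hash_apply, BimodHom.map_op_smul, x.comul_x]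
    rfl) p g.unop f.unop).symm
  smul_zero f := DFunLike.congr_fun (map_zero (gradedMul x.pairingAR)) f.unop
  smul_add f p q := DFunLike.congr_fun (map_add (gradedMul x.pairingAR) p q) f.unop
  add_smul f g p := map_add (gradedMul x.pairingAR p) f.unop g.unop
  zero_smul p := map_zero (gradedMul x.pairingAR p)

noncomputable instance : Module x.GS x.AG where
  smul s p := gradedMul x.pairingSA s p
  one_smul := gradedMul_one_left _ _ fun α h a => one_mul a
  mul_smul := gradedMul_assoc _ _ _ _ fun α β γ αβ βγ δ h₁ h₂ h₃ h₄ b c a => by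
    subst h₃
    exact mul_assoc (b.1 (β * γ)) (c.1 γ) a
  smul_zero s := map_zero (gradedMul x.pairingSA s)
  smul_add s := map_add (gradedMul x.pairingSA s)
  add_smul s t p := DFunLike.congr_fun (map_add (gradedMul x.pairingSA) s t) p
  zero_smul p := DFunLike.congr_fun (map_zero (gradedMul x.pairingSA)) p

instance : SMulCommClass x.GS 𝒞.LeftDualᵐᵒᵖ x.AG where
  smul_comm s f p := (gradedMul_assoc x.pairingSA x.pairingAR x.pairingAR x.pairingSA
    (fun α β γ αβ βγ δ h₁ h₂ h₃ h₄ b a f => by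
      subst h₃
      change f (op (b.1 β * a) • x.x γ⁻¹) = b.1 (β * γ) * f (op a • x.x γ⁻¹)
      rw [MulOpposite.op_mul, mul_smul, ← b.2 β γ _ rfl, ← smul_comm (b.1 (β * γ)) (op a),
        map_smul, smul_eq_mul])
    s p f.unop).symm

noncomputable instance : Module 𝒞.LeftDual x.QG where
  smul f q := gradedMul x.pairingRQ f q
  one_smul := gradedMul_one_left _ _ fun α h q => Subtype.ext <| funext fun σ => by
    have key : ∀ τ (hτ : 1 * τ = σ),
        𝒞.hash 1 τ σ hτ (𝒞.ε 1⁻¹ inv_one).left (q.1 τ) = q.1 σ := by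
      intro τ hτ
      obtain rfl : τ = σ := by rw [← hτ, one_mul]
      exact 𝒞.one_hash τ hτ (q.1 τ)
    exact key _ _
  mul_smul := gradedMul_assoc _ _ _ _ fun α β γ αβ βγ δ h₁ h₂ h₃ h₄ f g q =>
    Subtype.ext <| funext fun σ => by
      have key : ∀ τ τ' (hτ : αβ * τ = σ) (hτ' : β * τ' = α⁻¹ * σ),
          𝒞.hash αβ τ σ hτ (𝒞.hash α β αβ h₁ f g) (q.1 τ) =
          𝒞.hash α (α⁻¹ * σ) σ (mul_inv_cancel_left α σ) f
            (𝒞.hash β τ' (α⁻¹ * σ) hτ' g (q.1 τ')) := by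
        intro τ τ' hτ hτ'
        obtain rfl : τ = τ' := by
          rw [← h₁] at hτ
          apply mul_left_cancel (a := β)
          rw [hτ', ← hτ]; group
        exact 𝒞.hash_assoc α β τ αβ (α⁻¹ * σ) σ h₁ hτ hτ' _ f g (q.1 τ)
      exact key _ _ _ _
  smul_zero f := map_zero (gradedMul x.pairingRQ f)
  smul_add f := map_add (gradedMul x.pairingRQ f)
  add_smul f g q := DFunLike.congr_fun (map_add (gradedMul x.pairingRQ) f g) q
  zero_smul q := DFunLike.congr_fun (map_zero (gradedMul x.pairingRQ)) q

noncomputable instance : Module x.GSᵐᵒᵖ x.QG where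
  smul s q := gradedMul x.pairingQS q s.unop
  one_smul := gradedMul_one_right _ _ fun α h q => Subtype.ext <| funext fun σ =>
    one_smul Aᵐᵒᵖ (q.1 σ)
  mul_smul s t q := (gradedMul_assoc _ _ _ _ (fun α β γ αβ βγ δ h₁ h₂ h₃ h₄ q b c =>
    Subtype.ext <| funext fun σ => by
      subst h₁ h₂
      change op (c.1 ((α * β * γ)⁻¹ * σ)) • op (b.1 ((α * β)⁻¹ * σ)) • q.1 σ =
        op (b.1 (γ * ((α * β * γ)⁻¹ * σ)) * c.1 ((α * β * γ)⁻¹ * σ)) • q.1 σ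
      rw [MulOpposite.op_mul, mul_smul]
      congr 5
      group) q t.unop s.unop).symm
  smul_zero s := DFunLike.congr_fun (map_zero (gradedMul x.pairingQS)) s.unop
  smul_add s p q := DFunLike.congr_fun (map_add (gradedMul x.pairingQS) p q) s.unop
  add_smul s t q := map_add (gradedMul x.pairingQS q) s.unop t.unop
  zero_smul q := map_zero (gradedMul x.pairingQS q)

theorem hash_op_smul {α β γ : G} (h : α * β = γ) (f : 𝒞.Dual α) (g : 𝒞.Dual β) (a : A) :
    𝒞.hash α β γ h f (op a • g) = op a • 𝒞.hash α β γ h f g := rfl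

instance : SMulCommClass 𝒞.LeftDual x.GSᵐᵒᵖ x.QG where
  smul_comm f s q := (gradedMul_assoc x.pairingRQ x.pairingQS x.pairingQS x.pairingRQ
    (fun α β γ αβ βγ δ h₁ h₂ h₃ h₄ f q b => Subtype.ext <| funext fun σ => by
      subst h₃ h₄
      change op (b.1 ((α * (β * γ))⁻¹ * σ)) • 𝒞.hash α (α⁻¹ * σ) σ _ f (q.1 (α⁻¹ * σ)) =
        𝒞.hash α (α⁻¹ * σ) σ _ f (op (b.1 ((β * γ)⁻¹ * (α⁻¹ * σ))) • q.1 (α⁻¹ * σ))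
      rw [hash_op_smul, mul_inv_rev, mul_assoc]) f q s.unop).symm

theorem contractRight_op_smul {M N : Type*} [AddCommGroup M] [Module Aᵐᵒᵖ M]
    [AddCommGroup N] [Module A N] (a : A) (f : N →ₗ[A] A) (t : BalTensor A M N) :
    BalTensor.contractRight M (op a • f) t = op a • BalTensor.contractRight M f t := by
  induction t using BalTensor.induction_on with
  | zero => simp
  | tmul m n =>
    rw [BalTensor.contractRight_tmul, BalTensor.contractRight_tmul, LinearMap.smul_apply,
      op_smul_eq_mul, MulOpposite.op_mul, mul_smul]
  | add s t hs ht => simp only [map_add, hs, ht, smul_add]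

theorem Q_hash (q : x.Q) {α β γ : G} (h : α * β = γ) (a : A) (f : 𝒞.Dual β) :
    𝒞.hash α β γ h (op a • q.1 α) f = op (f (op a • x.x β⁻¹)) • q.1 γ := by
  ext c
  rw [hash_apply, contractRight_op_smul, q.2 α β γ h c, ← smul_comm, map_smul,
    LinearMap.smul_apply]
  rfl

theorem AQ_balanced (p : x.AG) (f : 𝒞.LeftDual) (q : x.QG) :
    gradedMul x.pairingAQ (gradedMul x.pairingAR p f) q =
      gradedMul x.pairingAQ p (gradedMul x.pairingRQ f q) :=
  gradedMul_assoc _ _ _ _ (fun α β γ αβ βγ δ h₁ h₂ h₃ h₄ a f q => Subtype.ext <| funext fun σ => by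
    subst h₃
    change q.1 (γ * σ) (op (f (op a • x.x β⁻¹)) • x.x (γ * σ)⁻¹) =
      𝒞.hash β (β⁻¹ * (β * γ * σ)) (β * γ * σ) _ f (q.1 _) (op a • x.x (β * γ * σ)⁻¹)
    rw [hash_apply, BimodHom.map_op_smul, x.comul_x, BalTensor.op_smul_tmul,
      BalTensor.contractRight_tmul, show β⁻¹ * (β * γ * σ) = γ * σ by group]) p f q

theorem SA_AQ (s : x.GS) (p : x.AG) (q : x.QG) :
    gradedMul x.pairingAQ (gradedMul x.pairingSA s p) q =
      gradedMul x.pairingSS s (gradedMul x.pairingAQ p q) :=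
  gradedMul_assoc _ _ _ _ (fun α β γ αβ βγ δ h₁ h₂ h₃ h₄ b a q => Subtype.ext <| funext fun σ => by
    subst h₃
    change q.1 (γ * σ) (op (b.1 β * a) • x.x (γ * σ)⁻¹) =
      b.1 (β * γ * σ) * q.1 (γ * σ) (op a • x.x (γ * σ)⁻¹)
    rw [MulOpposite.op_mul, mul_smul, ← b.2 β (γ * σ) _ rfl, ← smul_comm (b.1 _) (op a),
      map_smul, smul_eq_mul, mul_assoc β γ σ]) s p q

theorem AQ_QS (p : x.AG) (q : x.QG) (s : x.GS) :
    gradedMul x.pairingSS (gradedMul x.pairingAQ p q) s =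
      gradedMul x.pairingAQ p (gradedMul x.pairingQS q s) :=
  gradedMul_assoc _ _ _ _ (fun α β γ αβ βγ δ h₁ h₂ h₃ h₄ a q b => Subtype.ext <| funext fun σ => by
    subst h₃
    change q.1 (β * (γ * σ)) (op a • x.x (β * (γ * σ))⁻¹) * b.1 σ =
      q.1 (β * γ * σ) (op a • x.x (β * γ * σ)⁻¹) * b.1 ((β * γ)⁻¹ * (β * γ * σ))
    rw [inv_mul_cancel_left, mul_assoc β γ σ]) p q s

theorem QA_balanced (q : x.QG) (s : x.GS) (p : x.AG) :
    gradedMul x.pairingQA (gradedMul x.pairingQS q s) p =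
      gradedMul x.pairingQA q (gradedMul x.pairingSA s p) :=
  gradedMul_assoc _ _ _ _ (fun α β γ αβ βγ δ h₁ h₂ h₃ h₄ q b a => by
    subst h₁ h₂
    change op a • op (b.1 ((α * β)⁻¹ * (α * β * γ))) • q.1 (α * β * γ) =
      op (b.1 γ * a) • q.1 (α * β * γ)
    rw [inv_mul_cancel_left, MulOpposite.op_mul, mul_smul]) q s p

theorem RQ_QA (f : 𝒞.LeftDual) (q : x.QG) (p : x.AG) :
    gradedMul x.pairingQA (gradedMul x.pairingRQ f q) p =
      gradedMul 𝒞.hash f (gradedMul x.pairingQA q p) :=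
  gradedMul_assoc _ _ _ _ (fun α β γ αβ βγ δ h₁ h₂ h₃ h₄ f q a => by
    have key : ∀ τ (hτ : α * τ = δ),
        op a • 𝒞.hash α τ δ hτ f (q.1 τ) = 𝒞.hash α βγ δ h₄ f (op a • q.1 βγ) := by
      intro τ hτ
      obtain rfl : τ = βγ := mul_left_cancel (hτ.trans h₄.symm)
      rfl
    exact key _ _) f q p

theorem QA_AR (q : x.QG) (p : x.AG) (f : 𝒞.LeftDual) :
    gradedMul 𝒞.hash (gradedMul x.pairingQA q p) f =
      gradedMul x.pairingQA q (gradedMul x.pairingAR p f) :=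
  gradedMul_assoc _ _ _ _ (fun _ _ _ _ _ _ _ h₂ _ _ q a f => x.Q_hash q h₂ a f) q p f

theorem AQ_SA (p : x.AG) (q : x.QG) (p' : x.AG) :
    gradedMul x.pairingSA (gradedMul x.pairingAQ p q) p' =
      gradedMul x.pairingAR p (gradedMul x.pairingQA q p') :=
  gradedMul_assoc _ _ _ _ (fun _ _ _ _ _ _ _ _ h₃ _ _ _ _ => by
    subst h₃
    rfl) p q p'

theorem QA_RQ (q : x.QG) (p : x.AG) (q' : x.QG) :
    gradedMul x.pairingRQ (gradedMul x.pairingQA q p) q' =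
      gradedMul x.pairingQS q (gradedMul x.pairingAQ p q') :=
  gradedMul_assoc _ _ _ _ (fun α β γ αβ βγ δ h₁ h₂ h₃ h₄ q a q' => Subtype.ext <| funext fun σ => by
    have e : αβ⁻¹ * σ = γ * (δ⁻¹ * σ) := by rw [← h₂]; group
    have key : ∀ τ (hτ : αβ * τ = σ), τ = γ * (δ⁻¹ * σ) →
        𝒞.hash αβ τ σ hτ (op a • q.1 αβ) (q'.1 τ) =
          op (q'.1 (γ * (δ⁻¹ * σ)) (op a • x.x (γ * (δ⁻¹ * σ))⁻¹)) • q.1 σ := by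
      rintro τ hτ rfl
      exact x.Q_hash q hτ a _
    exact key _ _ e) q p q'

/-- The connecting map `ω : A{G} ⊗_R QG → G*S`. -/
noncomputable def connectω : BimodHom x.GS (BalTensor 𝒞.LeftDual x.AG x.QG) x.GS where
  toFun := BalTensor.lift (A := 𝒞.LeftDual) (M := x.AG) (N := x.QG) (P := x.GS)
    (gradedMul x.pairingAQ) x.AQ_balanced
  map_add' := map_add _
  map_smul' s t := by
    induction t using BalTensor.induction_on with
    | zero => rw [smul_zero, map_zero, smul_zero]
    | tmul p q => exact x.SA_AQ s p q
    | add t t' h h' => rw [smul_add, map_add, h, h', map_add, smul_add]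
  map_op_smul' s t := by
    induction t using BalTensor.induction_on with
    | zero =>
      exact (congrArg _ (smul_zero _)).trans ((map_zero _).trans
        ((congrArg _ (map_zero _)).trans (smul_zero _)).symm)
    | tmul p q => exact (x.AQ_QS p q s).symm
    | add t t' h h' =>
      refine (congrArg _ (smul_add _ _ _)).trans ((map_add _ _ _).trans ?_)
      exact (congrArg₂ (· + ·) h h').trans
        ((congrArg _ (map_add _ _ _)).trans (smul_add _ _ _)).symm

/-- The connecting map `ν : QG ⊗_{G*S} A{G} → R`. -/
noncomputable def connectν : BimodHom 𝒞.LeftDual (BalTensor x.GS x.QG x.AG) 𝒞.LeftDual where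
  toFun := BalTensor.lift (A := x.GS) (M := x.QG) (N := x.AG) (P := 𝒞.LeftDual)
    (gradedMul x.pairingQA) x.QA_balanced
  map_add' := map_add _
  map_smul' s t := by
    induction t using BalTensor.induction_on with
    | zero => rw [smul_zero, map_zero, smul_zero]
    | tmul p q => exact x.RQ_QA s p q
    | add t t' h h' => rw [smul_add, map_add, h, h', map_add, smul_add]
  map_op_smul' s t := by
    induction t using BalTensor.induction_on with
    | zero =>
      exact (congrArg _ (smul_zero _)).trans ((map_zero _).trans
        ((congrArg _ (map_zero _)).trans (smul_zero _)).symm)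
    | tmul p q => exact (x.QA_AR p q s).symm
    | add t t' h h' =>
      refine (congrArg _ (smul_add _ _ _)).trans ((map_add _ _ _).trans ?_)
      exact (congrArg₂ (· + ·) h h').trans
        ((congrArg _ (map_add _ _ _)).trans (smul_add _ _ _)).symm

/-- The graded Morita context `(G*S, R, A{G}, QG, ω, ν)`. -/
noncomputable def moritaContext : MoritaContext x.GS 𝒞.LeftDual x.AG x.QG where
  φ := x.connectω
  ψ := x.connectν
  φ_smul := x.AQ_SA
  ψ_smul := x.QA_RQ

theorem ω_formula (α σ : G) (a : A) (q : x.Q) :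
    x.moritaContext.φ.left (BalTensor.tmul _ (x.μ α a) (x.ω σ q)) = x.u (α * σ) (x.evalQ σ a q) :=
  gradedMul_of x.pairingAQ rfl a q

theorem ν_formula (σ α : G) (a : A) (q : x.Q) :
    x.moritaContext.ψ.left (BalTensor.tmul _ (x.ω σ q) (x.μ α a)) =
      LeftDual.of 𝒞 (σ * α) (op a • q.1 (σ * α)) :=
  gradedMul_of x.pairingQA rfl q a

end Grouplike

end GroupCoring

namespace BalTensor

variable {A M N P S : Type*} [Ring A] [Ring S] [AddCommGroup M] [Module Aᵐᵒᵖ M]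
  [AddCommGroup N] [Module A N] [AddCommGroup P]

theorem map_left_smul [Module S M] [SMulCommClass S Aᵐᵒᵖ M] [Module S P]
    (f : BalTensor A M N →+ P) (s : S)
    (h : ∀ m n, f (tmul A (s • m) n) = s • f (tmul A m n)) (t : BalTensor A M N) :
    f (s • t) = s • f t := by
  induction t using induction_on with
  | zero => rw [smul_zero, map_zero, smul_zero]
  | tmul m n => exact h m n
  | add x y hx hy => rw [smul_add, map_add, hx, hy, map_add, smul_add]

theorem map_right_smul [Module Sᵐᵒᵖ N] [SMulCommClass A Sᵐᵒᵖ N] [Module Sᵐᵒᵖ P]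
    (f : BalTensor A M N →+ P) (s : Sᵐᵒᵖ)
    (h : ∀ m n, f (tmul A m (s • n)) = s • f (tmul A m n)) (t : BalTensor A M N) :
    f (s • t) = s • f t := by
  induction t using induction_on with
  | zero => rw [smul_zero, map_zero, smul_zero]
  | tmul m n => exact h m n
  | add x y hx hy => rw [smul_add, map_add, hx, hy, map_add, smul_add]

end BalTensor

/-! ### The canonical morphism -/

/-- The right multiplication of a subring on the ambient ring. -/
instance subringOpModule {A : Type*} [Ring A] (B : Subring A) : Module (↥B)ᵐᵒᵖ A :=
  Module.compHom A (RingHom.op B.subtype)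

theorem subring_op_smul {A : Type*} [Ring A] {B : Subring A} (b : (↥B)ᵐᵒᵖ) (a : A) :
    b • a = a * b.unop := rfl

instance {A : Type*} [Ring A] (B : Subring A) : SMulCommClass A (↥B)ᵐᵒᵖ A where
  smul_comm a b c := (mul_assoc a c b.unop).symm

namespace GroupCoring

section Sweedler

variable {A : Type u} [Ring A] (B : Subring A)

theorem tmul_subring_smul_one {N : Type*} [AddCommGroup N] [Module (↥B)ᵐᵒᵖ N] (n : N) (b : B) :
    BalTensor.tmul B n (b • (1 : A)) = op (b : A) • BalTensor.tmul B n (1 : A) := by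
  rw [BalTensor.op_smul_tmul, op_smul_eq_mul, one_mul]
  exact congrArg _ (mul_one (b : A))

theorem one_subring_smul_tmul (b : B) (a : A) :
    BalTensor.tmul B (1 : A) (b • a) = (b : A) • BalTensor.tmul B (1 : A) a := by
  rw [BalTensor.left_smul_tmul, smul_eq_mul, mul_one, ← BalTensor.smul_tmul]
  exact congrArg (BalTensor.tmul B · a) (one_mul (b : A))

/-- The additive map `a ⊗ b ↦ (a ⊗ 1) ⊗ (1 ⊗ b)`. -/
noncomputable def sweedlerΔHom :
    BalTensor B A A →+ BalTensor A (BalTensor B A A) (BalTensor B A A) :=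
  BalTensor.lift
    (((BalTensor.mk A (BalTensor B A A) (BalTensor B A A)).comp
      ((BalTensor.mk B A A).flip (1 : A))).compl₂ (BalTensor.mk B A A (1 : A)))
    (fun a b a' => by
      change BalTensor.tmul A (BalTensor.tmul B (op b • a) (1 : A)) (BalTensor.tmul B (1 : A) a') =
        BalTensor.tmul A (BalTensor.tmul B a (1 : A)) (BalTensor.tmul B (1 : A) (b • a'))
      rw [BalTensor.smul_tmul, tmul_subring_smul_one, one_subring_smul_tmul, BalTensor.smul_tmul])

/-- The comultiplication `a ⊗ b ↦ (a ⊗ 1) ⊗ (1 ⊗ b)` of the Sweedler coring `A ⊗_B A`. -/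
noncomputable def sweedlerΔ :
    BimodHom A (BalTensor B A A) (BalTensor A (BalTensor B A A) (BalTensor B A A)) where
  toFun := sweedlerΔHom B
  map_add' := map_add (sweedlerΔHom B)
  map_smul' a := BalTensor.map_left_smul (sweedlerΔHom B) a (fun _ _ => rfl)
  map_op_smul' a := BalTensor.map_right_smul (sweedlerΔHom B) (op a) (fun _ _ => rfl)

theorem sweedlerΔ_tmul (a b : A) : (sweedlerΔ B).left (BalTensor.tmul B a b) =
    BalTensor.tmul A (BalTensor.tmul B a (1 : A)) (BalTensor.tmul B (1 : A) b) := rfl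

/-- The additive map `a ⊗ b ↦ a b`. -/
noncomputable def sweedlerεHom : BalTensor B A A →+ A :=
  BalTensor.lift AddMonoidHom.mul (fun a b a' => mul_assoc a (b : A) a')

/-- The counit `a ⊗ b ↦ a b` of the Sweedler coring `A ⊗_B A`. -/
noncomputable def sweedlerε : BimodHom A (BalTensor B A A) A where
  toFun := sweedlerεHom B
  map_add' := map_add (sweedlerεHom B)
  map_smul' a := BalTensor.map_left_smul (sweedlerεHom B) a (fun m n => mul_assoc a m n)
  map_op_smul' a := BalTensor.map_right_smul (sweedlerεHom B) (op a)
    (fun m n => (mul_assoc m n a).symm)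

/-- The cofree group coring `(A ⊗_B A)⟨G⟩` on the Sweedler coring: all its components are copies of
`A ⊗_B A`, with the comultiplication and the counit of the Sweedler coring. -/
noncomputable def sweedler (G : Type u) [Group G] : GroupCoring G A where
  C _ := BalTensor B A A
  Δ _ _ _ _ := sweedlerΔ B
  ε _ _ := sweedlerε B
  coassoc _ _ _ _ _ _ _ _ _ _ c := by
    induction c using BalTensor.induction_on with
    | zero => simp only [map_zero]
    | tmul m n => rfl
    | add s t hs ht => rw [map_add, map_add, map_add, hs, ht, map_add]
  counit_right _ _ _ _ c := by
    induction c using BalTensor.induction_on with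
    | zero => simp only [map_zero]
    | tmul m n =>
      change BalTensor.tmul B m ((1 : A) * (1 * n)) = BalTensor.tmul B m n
      rw [one_mul, one_mul]
    | add s t hs ht => rw [map_add, map_add, hs, ht]
  counit_left _ _ _ _ c := by
    induction c using BalTensor.induction_on with
    | zero => simp only [map_zero]
    | tmul m n =>
      change BalTensor.tmul B ((m * 1) * (1 : A)) n = BalTensor.tmul B m n
      rw [mul_one, mul_one]
    | add s t hs ht => rw [map_add, map_add, hs, ht]

end Sweedler

namespace Grouplike

variable {G A : Type u} [Group G] [Ring A] {𝒞 : GroupCoring G A} (x : Grouplike 𝒞)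
  {B : Subring A} (hB : B ≤ x.T)

/-- The additive map `A ⊗_B A → C_α`, `a ⊗ b ↦ a x_α b`. -/
noncomputable def canHom (α : G) : BalTensor B A A →+ 𝒞.C α :=
  BalTensor.lift
    (AddMonoidHom.mk' (fun a => AddMonoidHom.mk' (fun b => a • op b • x.x α)
        (fun b b' => by rw [MulOpposite.op_add, add_smul, smul_add]))
      (fun a a' => by ext b; exact add_smul _ _ _))
    (fun a b a' => by
      change (a * (b : A)) • op a' • x.x α = a • op ((b : A) * a') • x.x α
      rw [mul_smul, MulOpposite.op_mul, mul_smul (op a'), ← hB b.2 α, smul_comm (b : A) (op a')])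

/-- The map `A ⊗_B A → C_α`, `a ⊗ b ↦ a x_α b`, as a map of bimodules. -/
noncomputable def canComponent (α : G) : BimodHom A (BalTensor B A A) (𝒞.C α) where
  toFun := x.canHom hB α
  map_add' := map_add (x.canHom hB α)
  map_smul' a := BalTensor.map_left_smul (x.canHom hB α) a (fun m n => mul_smul a m _)
  map_op_smul' a := BalTensor.map_right_smul (x.canHom hB α) (op a) (fun m n => by
    change m • op (n * a) • x.x α = op a • m • op n • x.x α
    rw [MulOpposite.op_mul, mul_smul, smul_comm])

theorem canComponent_tmul (α : G) (a b : A) :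
    (x.canComponent hB α).left (BalTensor.tmul B a b) = a • op b • x.x α := rfl

/-- The morphism of group corings `can' : (A ⊗_B A)⟨G⟩ → 𝒞`, `can'_α(a ⊗ b) = a x_α b`. -/
noncomputable def can : Hom (sweedler B G) 𝒞 where
  f α := x.canComponent hB α
  comm_Δ α β γ h c := by
    induction c using BalTensor.induction_on with
    | zero => exact (congrArg _ (map_zero _)).trans ((map_zero _).trans
        ((congrArg _ (map_zero _)).trans (map_zero _)).symm)
    | tmul m n =>
      change BalTensor.tmul A (m • op (1 : A) • x.x α) ((1 : A) • op n • x.x β) =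
        (𝒞.Δ α β γ h).left (m • op n • x.x γ)
      rw [map_smul, BimodHom.map_op_smul, x.comul_x, MulOpposite.op_one, one_smul, one_smul]
      rfl
    | add s t hs ht =>
      exact (congrArg _ (map_add _ _ _)).trans ((map_add _ _ _).trans
        ((congrArg₂ (· + ·) hs ht).trans
          ((congrArg _ (map_add _ _ _)).trans (map_add _ _ _)).symm))
  comm_ε e he c := by
    induction c using BalTensor.induction_on with
    | zero => exact (congrArg _ (map_zero _)).trans ((map_zero _).trans (map_zero _).symm)
    | tmul m n =>
      change (𝒞.ε e he).left (m • op n • x.x e) = m * n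
      rw [map_smul, BimodHom.map_op_smul, x.counit_x, op_smul_eq_mul, one_mul, smul_eq_mul]
    | add s t hs ht =>
      exact (congrArg _ (map_add _ _ _)).trans ((map_add _ _ _).trans
        ((congrArg₂ (· + ·) hs ht).trans (map_add _ _ _).symm))

end Grouplike

/-! ### Comodules and the adjoint pair -/

/-- Right `G`-`𝒞`-comodules. -/
structure GComod {G A : Type u} [Group G] [Ring A] (𝒞 : GroupCoring G A) where
  M : G → Type u
  [addCommGroup : ∀ α, AddCommGroup (M α)]
  [rightModule : ∀ α, Module Aᵐᵒᵖ (M α)]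
  /-- the coaction -/
  ρ : ∀ (α β γ : G), α * β = γ → M γ →ₗ[Aᵐᵒᵖ] BalTensor A (M α) (𝒞.C β)
  coassoc : ∀ (α β γ αβ βγ δ : G) (h₁ : α * β = αβ) (h₂ : αβ * γ = δ) (h₃ : β * γ = βγ)
    (h₄ : α * βγ = δ) (m : M δ),
    BalTensor.assoc A (M α) (𝒞.C β) (𝒞.C γ)
      (BalTensor.map (ρ α β αβ h₁) LinearMap.id (ρ αβ γ δ h₂ m)) =
    BalTensor.map LinearMap.id (𝒞.Δ β γ βγ h₃).left (ρ α βγ δ h₄ m)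
  counit : ∀ (α e : G) (he : e = 1) (h : α * e = α) (m : M α),
    BalTensor.contractRight (M α) (𝒞.ε e he).left (ρ α e α h m) = m

attribute [instance] GComod.addCommGroup GComod.rightModule

namespace GComod

open CategoryTheory

variable {G A : Type u} [Group G] [Ring A] {𝒞 : GroupCoring G A}

/-- Morphisms of right `G`-`𝒞`-comodules. -/
@[ext]
structure Hom (M N : GComod 𝒞) where
  f : ∀ α, M.M α →ₗ[Aᵐᵒᵖ] N.M α
  comm : ∀ (α β γ : G) (h : α * β = γ) (m : M.M γ),
    BalTensor.map (f α) LinearMap.id (M.ρ α β γ h m) = N.ρ α β γ h (f γ m)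

/-- The category of right `G`-`𝒞`-comodules. -/
instance : Category (GComod 𝒞) where
  Hom := Hom
  id M := ⟨fun _ => LinearMap.id, fun α β γ h m => by
    generalize M.ρ α β γ h m = t
    refine Eq.trans ?_ (congrArg _ rfl : _ = LinearMap.id (R := ℤ) t)
    induction t using BalTensor.induction_on with
    | zero => simp
    | tmul m n => rfl
    | add s t hs ht => rw [map_add, map_add, hs, ht]⟩
  comp {M N P} f g := ⟨fun α => (g.f α).comp (f.f α), fun α β γ h m => by
    rw [LinearMap.comp_apply, ← g.comm, ← f.comm]
    generalize M.ρ α β γ h m = t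
    induction t using BalTensor.induction_on with
    | zero => simp
    | tmul m n => rfl
    | add s t hs ht => rw [map_add, map_add, map_add, hs, ht]⟩

@[ext] theorem hom_ext {M N : GComod 𝒞} {f g : M ⟶ N} (h : ∀ α m, f.f α m = g.f α m) : f = g :=
  Hom.ext (funext fun α => LinearMap.ext (h α))

@[simp] theorem id_f (M : GComod 𝒞) (α : G) (m : M.M α) : Hom.f (𝟙 M) α m = m := rfl

@[simp] theorem comp_f {M N P : GComod 𝒞} (f : M ⟶ N) (g : N ⟶ P) (α : G) (m : M.M α) :
    (f ≫ g).f α m = g.f α (f.f α m) := rfl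

end GComod

namespace Grouplike

open CategoryTheory

variable {G A : Type u} [Group G] [Ring A] {𝒞 : GroupCoring G A} (x : Grouplike 𝒞)
  {B : Subring A} (hB : B ≤ x.T)

/-- The additive map `n ⊗ a ↦ (n ⊗ 1) ⊗ x_β a`. -/
noncomputable def inducedCoactionHom (N : Type u) [AddCommGroup N] [Module (↥B)ᵐᵒᵖ N] (β : G) :
    BalTensor B N A →+ BalTensor A (BalTensor B N A) (𝒞.C β) :=
  BalTensor.lift
    (((BalTensor.mk A (BalTensor B N A) (𝒞.C β)).comp
      ((BalTensor.mk B N A).flip (1 : A))).compl₂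
        (AddMonoidHom.mk' (fun a : A => op a • x.x β)
          (fun a a' => by rw [MulOpposite.op_add, add_smul])))
    (fun n b a => by
      change BalTensor.tmul A (BalTensor.tmul B (op b • n) (1 : A)) (op a • x.x β) =
        BalTensor.tmul A (BalTensor.tmul B n (1 : A)) (op ((b : A) * a) • x.x β)
      rw [BalTensor.smul_tmul, tmul_subring_smul_one, BalTensor.smul_tmul, MulOpposite.op_mul,
        mul_smul, ← hB b.2 β, smul_comm (b : A) (op a)])

/-- The coaction `n ⊗ a ↦ (n ⊗ 1) ⊗ x_β a` on `N ⊗_B A`. -/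
noncomputable def inducedCoaction (N : Type u) [AddCommGroup N] [Module (↥B)ᵐᵒᵖ N] (β : G) :
    BalTensor B N A →ₗ[Aᵐᵒᵖ] BalTensor A (BalTensor B N A) (𝒞.C β) where
  toFun := x.inducedCoactionHom hB N β
  map_add' := map_add (x.inducedCoactionHom hB N β)
  map_smul' a := BalTensor.map_right_smul (x.inducedCoactionHom hB N β) a (fun m n => by
    change BalTensor.tmul A (BalTensor.tmul B m (1 : A)) (op (n * a.unop) • x.x β) =
      BalTensor.tmul A (BalTensor.tmul B m (1 : A)) (a • op n • x.x β)
    rw [MulOpposite.op_mul, mul_smul, op_unop])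

/-- The comodule `F₇(N) = (μ_α(N ⊗_B A))_α`. -/
noncomputable def F7obj (N : Type u) [AddCommGroup N] [Module (↥B)ᵐᵒᵖ N] : GComod 𝒞 where
  M _ := BalTensor B N A
  ρ _ β _ _ := x.inducedCoaction hB N β
  coassoc α β γ αβ βγ δ h₁ h₂ h₃ h₄ m := by
    induction m using BalTensor.induction_on with
    | zero => simp only [map_zero]
    | tmul n a =>
      change BalTensor.tmul A (BalTensor.tmul B n (1 : A))
        (BalTensor.tmul A (op (1 : A) • x.x β) (op a • x.x γ)) =
        BalTensor.tmul A (BalTensor.tmul B n (1 : A)) ((𝒞.Δ β γ βγ h₃).left (op a • x.x βγ))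
      rw [BimodHom.map_op_smul, x.comul_x, MulOpposite.op_one, one_smul,
        BalTensor.op_smul_tmul]
    | add s t hs ht => simp only [map_add, hs, ht]
  counit α e he h m := by
    induction m using BalTensor.induction_on with
    | zero => simp only [map_zero]
    | tmul n a =>
      change op ((𝒞.ε e he).left (op a • x.x e)) • BalTensor.tmul B n (1 : A) =
        BalTensor.tmul B n a
      rw [BimodHom.map_op_smul, x.counit_x, op_smul_eq_mul, one_mul, BalTensor.op_smul_tmul,
        op_smul_eq_mul, one_mul]
    | add s t hs ht => simp only [map_add, hs, ht]

/-- The right `A`-linear map `g ⊗_B A : N ⊗_B A → N' ⊗_B A`. -/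
noncomputable def rightMap {N N' : Type u} [AddCommGroup N] [Module (↥B)ᵐᵒᵖ N]
    [AddCommGroup N'] [Module (↥B)ᵐᵒᵖ N'] (g : N →ₗ[(↥B)ᵐᵒᵖ] N') :
    BalTensor B N A →ₗ[Aᵐᵒᵖ] BalTensor B N' A where
  toFun := BalTensor.map g (LinearMap.id : A →ₗ[B] A)
  map_add' := map_add _
  map_smul' a := BalTensor.map_right_smul _ a (fun _ _ => rfl)

/-- The functor `F₇ : ℳ_B ⥤ ℳ^{G,𝒞}`. -/
noncomputable def F7 : ModuleCat.{u} (↥B)ᵐᵒᵖ ⥤ GComod 𝒞 where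
  obj N := x.F7obj hB N
  map {N N'} g :=
    { f := fun _ => rightMap g.hom
      comm := fun _ β _ _ m => DFunLike.congr_fun (BalTensor.hom_ext
        (f := (BalTensor.map (rightMap g.hom) (LinearMap.id : 𝒞.C β →ₗ[A] 𝒞.C β)).comp
          (x.inducedCoactionHom hB N β))
        (g := (x.inducedCoactionHom hB N' β).comp
          (BalTensor.map g.hom (LinearMap.id : A →ₗ[B] A))) fun _ _ => rfl) m }
  map_id N := GComod.hom_ext fun _ m => DFunLike.congr_fun (BalTensor.hom_ext
    (f := BalTensor.map (ModuleCat.Hom.hom (𝟙 N)) (LinearMap.id : A →ₗ[B] A))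
    (g := AddMonoidHom.id (BalTensor B N A)) fun _ _ => rfl) m
  map_comp {N _ _} f g := GComod.hom_ext fun _ m => DFunLike.congr_fun (BalTensor.hom_ext
    (f := BalTensor.map (ModuleCat.Hom.hom (f ≫ g)) (LinearMap.id : A →ₗ[B] A))
    (g := (BalTensor.map g.hom (LinearMap.id : A →ₗ[B] A)).comp
      (BalTensor.map f.hom (LinearMap.id : A →ₗ[B] A))) fun _ _ => rfl) m

/-- The coinvariants `M^{co 𝒞} = {(m_α) ∈ ∏ M_α | ρ_{α,β}(m_{αβ}) = m_α ⊗ x_β}`. -/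
def coinvariants (M : GComod 𝒞) : AddSubgroup (∀ α, M.M α) where
  carrier := {m | ∀ (α β γ : G) (h : α * β = γ), M.ρ α β γ h (m γ) =
    BalTensor.tmul A (m α) (x.x β)}
  zero_mem' α β γ h := by
    rw [Pi.zero_apply, map_zero]
    exact (DFunLike.congr_fun (map_zero (BalTensor.mk A (M.M α) (𝒞.C β))) (x.x β)).symm
  add_mem' hm hn α β γ h := by
    rw [Pi.add_apply, map_add, hm α β γ h, hn α β γ h, Pi.add_apply, BalTensor.add_tmul]
  neg_mem' {m} hm α β γ h := by
    rw [Pi.neg_apply, map_neg, hm α β γ h]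
    exact (DFunLike.congr_fun (map_neg (BalTensor.mk A (M.M α) (𝒞.C β)) (m α)) (x.x β)).symm

/-- The coinvariants, regarded as a right `B`-module. -/
def Coinv (_hB : B ≤ x.T) (M : GComod 𝒞) : Type u := x.coinvariants M

instance (M : GComod 𝒞) : AddCommGroup (x.Coinv hB M) :=
  inferInstanceAs (AddCommGroup (x.coinvariants M))

instance (M : GComod 𝒞) : Module (↥B)ᵐᵒᵖ (x.Coinv hB M) where
  smul b m := ⟨fun α => op (b.unop : A) • m.1 α, fun α β γ h => by
    rw [map_smul, m.2 α β γ h, BalTensor.op_smul_tmul, ← hB b.unop.2 β, ← BalTensor.smul_tmul]⟩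
  one_smul m := Subtype.ext (funext fun α => one_smul Aᵐᵒᵖ (m.1 α))
  mul_smul b c m := Subtype.ext (funext fun α => mul_smul (op (b.unop : A)) (op (c.unop : A)) _)
  smul_zero b := Subtype.ext (funext fun α => smul_zero (op (b.unop : A)))
  smul_add b m n := Subtype.ext (funext fun α => smul_add (op (b.unop : A)) (m.1 α) (n.1 α))
  add_smul b c m := Subtype.ext (funext fun α => add_smul (op (b.unop : A)) (op (c.unop : A)) _)
  zero_smul m := Subtype.ext (funext fun α => zero_smul Aᵐᵒᵖ (m.1 α))

/-- The restriction of `∏ f_α` to the coinvariants. -/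
def coinvMap {M N : GComod 𝒞} (f : M ⟶ N) : x.Coinv hB M →ₗ[(↥B)ᵐᵒᵖ] x.Coinv hB N where
  toFun m := ⟨fun α => f.f α (m.1 α), fun α β γ h => by rw [← f.comm, m.2 α β γ h]; rfl⟩
  map_add' m n := Subtype.ext (funext fun α => map_add (f.f α) (m.1 α) (n.1 α))
  map_smul' b m := Subtype.ext (funext fun α => map_smul (f.f α) (op (b.unop : A)) (m.1 α))

/-- The functor `G₇ = (-)^{co 𝒞} : ℳ^{G,𝒞} ⥤ ℳ_B`. -/
def G7 : GComod 𝒞 ⥤ ModuleCat.{u} (↥B)ᵐᵒᵖ where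
  obj M := ModuleCat.of (↥B)ᵐᵒᵖ (x.Coinv hB M)
  map f := ModuleCat.ofHom (x.coinvMap hB f)
  map_id _ := rfl
  map_comp _ _ := rfl

/-- The unit `N → (N ⊗_B A)^{co 𝒞}`, `n ↦ (n ⊗ 1)_α`. -/
noncomputable def unitHom (N : Type u) [AddCommGroup N] [Module (↥B)ᵐᵒᵖ N] :
    N →ₗ[(↥B)ᵐᵒᵖ] x.Coinv hB (x.F7obj hB N) where
  toFun n := ⟨fun _ => BalTensor.tmul B n (1 : A), fun α β γ h => by
    change BalTensor.tmul A (BalTensor.tmul B n (1 : A)) (op (1 : A) • x.x β) =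
      BalTensor.tmul A (BalTensor.tmul B n (1 : A)) (x.x β)
    rw [MulOpposite.op_one, one_smul]⟩
  map_add' n n' := Subtype.ext (funext fun _ => BalTensor.add_tmul n n' (1 : A))
  map_smul' b n := Subtype.ext (funext fun _ =>
    (BalTensor.smul_tmul n b.unop (1 : A)).trans (tmul_subring_smul_one B n b.unop))

/-- The additive map `M^{co 𝒞} ⊗_B A → M_α`, `(m_β)_β ⊗ a ↦ m_α a`. -/
noncomputable def counitAddHom (M : GComod 𝒞) (α : G) :
    BalTensor B (x.Coinv hB M) A →+ M.M α :=
  BalTensor.lift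
    (AddMonoidHom.mk' (fun m : x.Coinv hB M => AddMonoidHom.mk' (fun a : A => op a • m.1 α)
        (fun a a' => by rw [MulOpposite.op_add, add_smul]))
      (fun m m' => by ext a; exact smul_add _ (m.1 α) (m'.1 α)))
    (fun m b a => by
      change op a • op (b : A) • m.1 α = op ((b : A) * a) • m.1 α
      rw [MulOpposite.op_mul, mul_smul])

theorem counitAddHom_naturality {M N : GComod 𝒞} (f : M ⟶ N) (α : G) :
    (x.counitAddHom hB N α).comp (BalTensor.map (x.coinvMap hB f) (LinearMap.id : A →ₗ[B] A)) =
      (f.f α).toAddMonoidHom.comp (x.counitAddHom hB M α) :=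
  BalTensor.hom_ext fun m a => (map_smul (f.f α) (op a) (m.1 α)).symm

/-- The counit `M^{co 𝒞} ⊗_B A → M_α`, `(m_β)_β ⊗ a ↦ m_α a`, as a right `A`-linear map. -/
noncomputable def counitHom (M : GComod 𝒞) (α : G) :
    BalTensor B (x.Coinv hB M) A →ₗ[Aᵐᵒᵖ] M.M α where
  toFun := x.counitAddHom hB M α
  map_add' := map_add (x.counitAddHom hB M α)
  map_smul' a := BalTensor.map_right_smul (x.counitAddHom hB M α) a (fun m n => by
    change op (n * a.unop) • m.1 α = a • op n • m.1 α
    rw [MulOpposite.op_mul, mul_smul, op_unop])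

/-- The adjunction `(F₇, G₇)`, with unit `n ↦ (n ⊗ 1)_α` and counit `(m_β)_β ⊗ a ↦ m_α a`. -/
noncomputable def adjunction : x.F7 hB ⊣ x.G7 hB := Adjunction.mkOfUnitCounit
  { unit :=
      { app := fun N => ModuleCat.ofHom (x.unitHom hB N)
        naturality := fun _ _ _ => rfl }
    counit :=
      { app := fun M =>
          { f := fun α => x.counitHom hB M α
            comm := fun α β γ h t => DFunLike.congr_fun
              (BalTensor.hom_ext (A := B) (M := x.Coinv hB M) (N := A)
                (f := (BalTensor.map (x.counitHom hB M α) LinearMap.id).comp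
                  (x.inducedCoactionHom hB (x.Coinv hB M) β))
                (g := (M.ρ α β γ h).toAddMonoidHom.comp (x.counitAddHom hB M γ))
                fun m a => by
                  change BalTensor.tmul A (op (1 : A) • m.1 α) (op a • x.x β) =
                    M.ρ α β γ h (op a • m.1 γ)
                  rw [map_smul, m.2 α β γ h, MulOpposite.op_one, one_smul,
                    BalTensor.op_smul_tmul]) t }
        naturality := fun M N f => GComod.hom_ext fun α t =>
          DFunLike.congr_fun (x.counitAddHom_naturality hB f α) t }
    left_triangle := by
      ext N : 2
      refine GComod.hom_ext fun α t => DFunLike.congr_fun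
        (BalTensor.hom_ext (A := B) (M := N) (N := A)
          (f := (x.counitAddHom hB (x.F7obj hB N) α).comp
            (BalTensor.map (x.unitHom hB N) (LinearMap.id : A →ₗ[B] A)))
          (g := AddMonoidHom.id _) fun n a => ?_) t
      change op a • BalTensor.tmul B n (1 : A) = BalTensor.tmul B n a
      rw [BalTensor.op_smul_tmul, op_smul_eq_mul, one_mul]
    right_triangle := by
      ext M m
      exact Subtype.ext (funext fun α => one_smul Aᵐᵒᵖ (m.1 α)) }

end Grouplike

end GroupCoring

/-!
The four conditions are compared through one elementary statement: every component of the canonical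
morphism `can'` is bijective, and `A` has a finite dual basis `a = ∑ h_i(a) a_i` and a relation
`∑ h'_j(a'_j) = 1` with left `B`-linear maps `h_i, h'_j : A → B`.

* Faithful flatness. A progenerator is faithfully flat, since `N ⊗_B A` embeds into a power of `N`
  by the forms `h_i`. Conversely, if `A` is faithfully flat over `B` and `A ⊗_B A` (isomorphic to
  `C_e` by `can'`) has a finite dual basis over `A`, that dual basis defines an element of
  `End_B(A) ⊗_B A` over the identity of `A`. By descent, `Hom_B(A, B)` is the kernel of
  `e ↦ (a ↦ e(a) ⊗ 1 - 1 ⊗ e(a))`, so flatness puts the element into `Hom_B(A, B) ⊗_B A`, and this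
  is a dual basis of `A` over `B` (`LeftFaithfullyFlat.exists_isDualBasis_of_sweedler`). The trace
  ideal `I` of `A` satisfies `I A = A`, so `B / I ⊗_B A = 0` and `I = B`.
* The dual of `can'`. All modules involved are finitely generated projective, so a map is bijective
  if and only if its dual is (`bijective_of_dual_bijective`).
* The Morita context. If `can'` is bijective, a form `h : A → B` gives the element
  `a x_β b ↦ a h(b)` of `Q`; the two relations above then say that `1` lies in the images of the
  connecting maps, which suffices for strictness (`MoritaContext.isStrict_of_one`). Conversely, an
  expression `ε = ∑ q_i(-) a_i` with `q_i ∈ Q` gives the inverse `c ↦ ∑ q_i(c) ⊗ a_i` of `can'`, and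
  the maps `a ↦ q_i(x a)`, which have values in `T` because `S = T`, form a dual basis together with
  the `a_i` (`GroupCoring.Grouplike.isDualBasis_and_can_bijective`).
* Comodules. If `can'` is bijective, `m ↦ ∑ m_(0) h_i(m_(1)) ⊗ a_i` inverts the counit, where `h_i`
  acts on `C_β` as above, and the unit is inverted in the same way by the `h'_j`. Conversely, the
  dual graded ring `R` is a comodule whose coinvariants lie in `Q`
  (`GroupCoring.Grouplike.mem_Q_of_mem_coinvariants`), so surjectivity of the counit at `R` is an
  expression `ε = ∑ q_i(-) a_i`; the unit at `B` gives `S = T`, and injectivity of the unit at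
  `B / I` gives `I = B` for the trace ideal `I`.
-/

/-! ### Dual bases and progenerators -/

/-- A finite dual basis of a left module `P`: elements `a i` and linear forms `h i` such that
`p = ∑ h i (p) • a i` for all `p`. -/
def IsDualBasis {R P ι : Type*} [Ring R] [AddCommGroup P] [Module R P] [Fintype ι]
    (a : ι → P) (h : ι → P →ₗ[R] R) : Prop :=
  ∀ p, ∑ i, h i p • a i = p

section Progenerator

variable {R P : Type*} [Ring R] [AddCommGroup P] [Module R P]

theorem exists_isDualBasis [Module.Finite R P] [Module.Projective R P] :
    ∃ (n : ℕ) (a : Fin n → P) (h : Fin n → P →ₗ[R] R), IsDualBasis a h := by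
  obtain ⟨n, f, g, -, -, hfg⟩ := Module.Finite.exists_comp_eq_id_of_projective R P
  refine ⟨n, fun i => f (Pi.single i 1), fun i => (LinearMap.proj i).comp g, fun p => ?_⟩
  conv_rhs => rw [← LinearMap.id_apply (R := R) p, ← hfg, LinearMap.comp_apply,
    pi_eq_sum_univ' (g p)]
  simp only [map_sum, map_smul, LinearMap.comp_apply, LinearMap.proj_apply]

namespace IsDualBasis

variable {ι : Type*} [Fintype ι] {a : ι → P} {h : ι → P →ₗ[R] R}

theorem finite (H : IsDualBasis a h) : Module.Finite R P := by
  classical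
  refine Module.Finite.of_surjective (Fintype.linearCombination R a) fun p =>
    ⟨fun i => h i p, ?_⟩
  rw [Fintype.linearCombination_apply]
  exact H p

theorem projective (H : IsDualBasis a h) : Module.Projective R P := by
  classical
  refine Module.Projective.of_split (LinearMap.pi h) (Fintype.linearCombination R a) ?_
  ext p
  exact H p

/-- Linear forms separate the points of `P`. -/
theorem ext (H : IsDualBasis a h) {p q : P} (hpq : ∀ f : P →ₗ[R] R, f p = f q) : p = q := by
  rw [← H p, ← H q]
  exact Finset.sum_congr rfl fun i _ => by rw [hpq]

theorem comp_linearEquiv (H : IsDualBasis a h) {P' : Type*} [AddCommGroup P'] [Module R P']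
    (e : P' ≃ₗ[R] P) :
    IsDualBasis (fun i => e.symm (a i)) (fun i => (h i).comp e.toLinearMap) := fun p => by
  have := congrArg e.symm (H (e p))
  rwa [map_sum, e.symm_apply_apply, Finset.sum_congr rfl fun i _ => map_smul e.symm _ _] at this

/-- An element of `M ⊗_R P` is recovered from its contractions with the linear forms on `P`. -/
theorem sum_contractRight (H : IsDualBasis a h) {M : Type*} [AddCommGroup M] [Module Rᵐᵒᵖ M]
    (t : BalTensor R M P) :
    ∑ i, BalTensor.tmul R (BalTensor.contractRight M (h i) t) (a i) = t := by
  induction t using BalTensor.induction_on with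
  | zero =>
    refine Finset.sum_eq_zero fun i _ => ?_
    rw [map_zero]
    exact DFunLike.congr_fun (map_zero (BalTensor.mk R M P)) (a i)
  | tmul m n =>
    simp only [BalTensor.contractRight_tmul, BalTensor.smul_tmul]
    conv_rhs => rw [← H n]
    exact (map_sum (BalTensor.mk R M P m) _ _).symm
  | add s t hs ht =>
    simp only [map_add, BalTensor.add_tmul, Finset.sum_add_distrib, hs, ht]

/-- Contractions with linear forms separate the points of `M ⊗_R P`. -/
theorem tensor_ext (H : IsDualBasis a h) {M : Type*} [AddCommGroup M] [Module Rᵐᵒᵖ M]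
    {s t : BalTensor R M P}
    (hst : ∀ i, BalTensor.contractRight M (h i) s = BalTensor.contractRight M (h i) t) :
    s = t := by
  rw [← H.sum_contractRight s, ← H.sum_contractRight t]
  exact Finset.sum_congr rfl fun i _ => by rw [hst]

end IsDualBasis

theorem LeftProgenerator.exists_isDualBasis (H : LeftProgenerator R P) :
    ∃ (n : ℕ) (a : Fin n → P) (h : Fin n → P →ₗ[R] R), IsDualBasis a h :=
  have := H.1
  have := H.2.1
  _root_.exists_isDualBasis

theorem LeftProgenerator.exists_sum_eq_one (H : LeftProgenerator R P) :
    ∃ (n : ℕ) (a : Fin n → P) (h : Fin n → P →ₗ[R] R), ∑ i, h i (a i) = 1 := by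
  obtain ⟨-, -, n, f, hf⟩ := H
  obtain ⟨v, hv⟩ := hf 1
  refine ⟨n, v, fun i => f.comp (LinearMap.single R (fun _ => P) i), ?_⟩
  rw [← hv]
  conv_rhs => rw [← Finset.univ_sum_single v, map_sum]
  rfl

/-- A module with a finite dual basis whose trace ideal contains `1` is a progenerator. -/
theorem leftProgenerator_of_isDualBasis {ι κ : Type*} [Fintype ι] [Fintype κ]
    {a : ι → P} {h : ι → P →ₗ[R] R} (H : IsDualBasis a h) (a' : κ → P) (h' : κ → P →ₗ[R] R)
    (H' : ∑ j, h' j (a' j) = 1) : LeftProgenerator R P := by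
  refine ⟨H.finite, H.projective, Fintype.card κ,
    ∑ j, (h' j).comp (LinearMap.proj (Fintype.equivFin κ j)), fun r => ?_⟩
  refine ⟨fun k => r • a' ((Fintype.equivFin κ).symm k), ?_⟩
  simp only [LinearMap.sum_apply, LinearMap.comp_apply, LinearMap.proj_apply,
    Equiv.symm_apply_apply, map_smul]
  rw [← Finset.smul_sum, H', smul_eq_mul, mul_one]

namespace BalTensor

variable {M M' N N' : Type*} [AddCommGroup M] [Module Rᵐᵒᵖ M] [AddCommGroup M'] [Module Rᵐᵒᵖ M']
  [AddCommGroup N] [Module R N] [AddCommGroup N'] [Module R N']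

@[simp] theorem zero_tmul (n : N) : tmul R (0 : M) n = 0 :=
  DFunLike.congr_fun (map_zero (mk R M N)) n

theorem sum_tmul {ι : Type*} (s : Finset ι) (m : ι → M) (n : N) :
    tmul R (∑ i ∈ s, m i) n = ∑ i ∈ s, tmul R (m i) n :=
  map_sum ((mk R M N).flip n) m s

theorem tmul_sum {ι : Type*} (s : Finset ι) (m : M) (n : ι → N) :
    tmul R m (∑ i ∈ s, n i) = ∑ i ∈ s, tmul R m (n i) :=
  map_sum (mk R M N m) n s

theorem contractRight_map (f : M →ₗ[Rᵐᵒᵖ] M') (g : N →ₗ[R] N') (φ : N' →ₗ[R] R)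
    (t : BalTensor R M N) :
    contractRight M' φ (map f g t) = f (contractRight M (φ.comp g) t) :=
  DFunLike.congr_fun (hom_ext (f := (contractRight M' φ).comp (map f g))
    (g := f.toAddMonoidHom.comp (contractRight M (φ.comp g))) fun m n =>
      (map_smul f (op (φ (g n))) m).symm) t

theorem map_map {M'' N'' : Type*} [AddCommGroup M''] [Module Rᵐᵒᵖ M''] [AddCommGroup N'']
    [Module R N''] (f : M →ₗ[Rᵐᵒᵖ] M') (g : N →ₗ[R] N') (f' : M' →ₗ[Rᵐᵒᵖ] M'')
    (g' : N' →ₗ[R] N'') (t : BalTensor R M N) :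
    map f' g' (map f g t) = map (f'.comp f) (g'.comp g) t :=
  DFunLike.congr_fun (hom_ext (f := (map f' g').comp (map f g))
    (g := map (f'.comp f) (g'.comp g)) fun _ _ => rfl) t

/-- Right multiplication by a scalar of a bimodule, as a left linear map. -/
def opSMulₗ (N : Type*) [AddCommGroup N] [Module R N] [Module Rᵐᵒᵖ N] [SMulCommClass R Rᵐᵒᵖ N]
    (r : R) : N →ₗ[R] N where
  toFun n := op r • n
  map_add' := smul_add _
  map_smul' s n := (smul_comm s (op r) n).symm

/-- `contractRight` as a left linear map, for a bimodule as the first factor. -/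
noncomputable def contractRightₗ (M : Type*) [AddCommGroup M] [Module R M] [Module Rᵐᵒᵖ M]
    [SMulCommClass R Rᵐᵒᵖ M] (f : N →ₗ[R] R) : BalTensor R M N →ₗ[R] M where
  toFun := contractRight M f
  map_add' := map_add _
  map_smul' := contractRight_smul f

/-- Contracting the last factor of `(g ⊗ N)(s) ∈ M' ⊗ L ⊗ N` commutes with applying `g`. This turns
coassociativity into an identity between contractions. -/
theorem map_contractRight_assoc {L : Type*} [AddCommGroup L] [Module R L] [Module Rᵐᵒᵖ L]
    [SMulCommClass R Rᵐᵒᵖ L] (f : N →ₗ[R] R) (g : M →ₗ[Rᵐᵒᵖ] BalTensor R M' L)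
    (s : BalTensor R M N) :
    map LinearMap.id (contractRightₗ L f) (assoc R M' L N (map g LinearMap.id s)) =
      g (contractRight M f s) := by
  induction s using induction_on with
  | zero => simp only [map_zero]
  | tmul m n =>
    rw [map_tmul, contractRight_tmul, map_smul, LinearMap.id_apply]
    induction g m using induction_on with
    | zero => rw [smul_zero, zero_tmul, map_zero, map_zero]
    | tmul m' l => rfl
    | add u v hu hv => rw [add_tmul, map_add, map_add, hu, hv, smul_add]
  | add s t hs ht => simp only [map_add, hs, ht]

theorem contractRight_contractRight {L : Type*} [AddCommGroup L] [Module R L] [Module Rᵐᵒᵖ L]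
    [SMulCommClass R Rᵐᵒᵖ L] (f : N →ₗ[R] R) (g : L →ₗ[R] R) (t : BalTensor R M (BalTensor R L N)) :
    contractRight M (g.comp (contractRightₗ L f)) t =
      contractRight M g (map LinearMap.id (contractRightₗ L f) t) := by
  rw [contractRight_map, LinearMap.id_apply]

/-- Every element is a finite sum of pure tensors. -/
theorem exists_sum_tmul (t : BalTensor R M N) :
    ∃ (ι : Type) (_ : Fintype ι) (m : ι → M) (n : ι → N), t = ∑ i, tmul R (m i) (n i) := by
  induction t using induction_on with
  | zero => exact ⟨Empty, inferInstance, Empty.elim, Empty.elim, by simp⟩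
  | tmul m n => exact ⟨Unit, inferInstance, fun _ => m, fun _ => n, by simp⟩
  | add s t hs ht =>
    obtain ⟨ι, _, m, n, rfl⟩ := hs
    obtain ⟨κ, _, m', n', rfl⟩ := ht
    exact ⟨ι ⊕ κ, inferInstance, Sum.elim m m', Sum.elim n n', by simp⟩

end BalTensor

/-- The tensor product of two dual bases. -/
theorem IsDualBasis.balTensor {N : Type*} [AddCommGroup N] [Module R N] [Module Rᵐᵒᵖ N]
    [SMulCommClass R Rᵐᵒᵖ N] {ι κ : Type*} [Fintype ι] [Fintype κ] {b : κ → N} {g : κ → N →ₗ[R] R}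
    (H' : IsDualBasis b g) {a : ι → P} {h : ι → P →ₗ[R] R} (H : IsDualBasis a h) :
    IsDualBasis (fun k : ι × κ => BalTensor.tmul R (b k.2) (a k.1))
      (fun k => (g k.2).comp (BalTensor.contractRightₗ N (h k.1))) := fun t => by
  rw [Fintype.sum_prod_type]
  conv_rhs => rw [← H.sum_contractRight t]
  refine Finset.sum_congr rfl fun i _ => ?_
  conv_rhs => rw [← H' (BalTensor.contractRight N (h i) t), BalTensor.sum_tmul]
  rfl

end Progenerator

/-! ### Faithful flatness -/

section FaithfullyFlat

/-- Tensoring with `P` on the right is injective because `M ⊗_R P` embeds into a power of `M` by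
the forms of a dual basis, and reflects zero because the trace ideal of `P` contains `1`. -/
theorem LeftProgenerator.leftFaithfullyFlat {R P : Type u} [Ring R] [AddCommGroup P] [Module R P]
    (H : LeftProgenerator R P) : LeftFaithfullyFlat R P := by
  constructor
  · intro N N' _ _ _ _ f hf
    obtain ⟨n, a, h, hah⟩ := H.exists_isDualBasis
    intro s t hst
    refine hah.tensor_ext fun i => hf ?_
    have := congrArg (BalTensor.contractRight N' (h i)) hst
    rwa [BalTensor.contractRight_map, BalTensor.contractRight_map] at this
  · intro N _ _ _
    obtain ⟨n, a, h, hah⟩ := H.exists_sum_eq_one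
    refine subsingleton_of_forall_eq 0 fun m => ?_
    have h1 (i) : op (h i (a i)) • m = 0 := by
      rw [← BalTensor.contractRight_tmul, Subsingleton.elim (BalTensor.tmul R m (a i)) 0, map_zero]
    rw [← one_smul Rᵐᵒᵖ m, ← MulOpposite.op_one, ← hah, Finset.op_sum, Finset.sum_smul]
    exact Finset.sum_eq_zero fun i _ => h1 i

variable {R P : Type u} [Ring R] [AddCommGroup P] [Module R P]

/-- Tensoring with a flat module preserves kernels. -/
theorem LeftFaithfullyFlat.exists_map_ker_subtype_eq (H : LeftFaithfullyFlat R P) {N N' : Type u}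
    [AddCommGroup N] [AddCommGroup N'] [Module Rᵐᵒᵖ N] [Module Rᵐᵒᵖ N'] (f : N →ₗ[Rᵐᵒᵖ] N')
    (t : BalTensor R N P) (ht : BalTensor.map f (LinearMap.id : P →ₗ[R] P) t = 0) :
    ∃ s : BalTensor R (LinearMap.ker f) P,
      BalTensor.map (LinearMap.ker f).subtype (LinearMap.id : P →ₗ[R] P) s = t := by
  set K := LinearMap.ker f with hK
  -- the image of `t` in `(N / K) ⊗ P` vanishes, because `N / K` embeds into `N'`
  have h0 : BalTensor.map K.mkQ (LinearMap.id : P →ₗ[R] P) t = 0 := by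
    have hinj : Function.Injective (K.liftQ f le_rfl) :=
      LinearMap.ker_eq_bot.1 (Submodule.ker_liftQ_eq_bot _ _ _ le_rfl)
    refine H.1 _ _ (K.liftQ f le_rfl) hinj ?_
    rw [BalTensor.map_map, map_zero, ← ht, Submodule.liftQ_mkQ, LinearMap.id_comp]
  -- `(N / K) ⊗ P` maps to the cokernel of `K ⊗ P → N ⊗ P`
  set I := (BalTensor.map K.subtype (LinearMap.id : P →ₗ[R] P)).range with hI
  let φ : N →+ P →+ BalTensor R N P ⧸ I :=
    (AddMonoidHom.compHom (QuotientAddGroup.mk' I)).comp (BalTensor.mk R N P)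
  have hφ : K.toAddSubgroup ≤ φ.ker := fun n hn => by
    ext p
    exact (QuotientAddGroup.eq_zero_iff _).2 ⟨BalTensor.tmul R (⟨n, hn⟩ : K) p, rfl⟩
  let ψ : N ⧸ K →+ P →+ BalTensor R N P ⧸ I := QuotientAddGroup.lift K.toAddSubgroup φ hφ
  have hψ (n : N) (p : P) : ψ (K.mkQ n) p = QuotientAddGroup.mk' I (BalTensor.tmul R n p) := rfl
  let Ψ : BalTensor R (N ⧸ K) P →+ BalTensor R N P ⧸ I := BalTensor.lift ψ fun n r p => by
    obtain ⟨n, rfl⟩ := K.mkQ_surjective n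
    rw [← map_smul, hψ, hψ, BalTensor.smul_tmul]
  have h1 : Ψ (BalTensor.map K.mkQ (LinearMap.id : P →ₗ[R] P) t) = QuotientAddGroup.mk' I t :=
    DFunLike.congr_fun (BalTensor.hom_ext
      (f := Ψ.comp (BalTensor.map K.mkQ (LinearMap.id : P →ₗ[R] P)))
      (g := QuotientAddGroup.mk' I) fun n p => rfl) t
  rw [h0, map_zero] at h1
  exact (QuotientAddGroup.eq_zero_iff t).1 h1.symm

end FaithfullyFlat

/-! ### Descent along a subring -/

section Subring

variable {A : Type u} [Ring A] {B : Subring A}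

/-- For a `B`-faithfully flat ring `A`, a right `B`-module `N` embeds into `N ⊗_B A`. -/
theorem LeftFaithfullyFlat.tmul_one_injective (H : LeftFaithfullyFlat B A) {N : Type u}
    [AddCommGroup N] [Module (↥B)ᵐᵒᵖ N] {n : N} (hn : BalTensor.tmul B n (1 : A) = 0) :
    n = 0 := by
  let K : Submodule (↥B)ᵐᵒᵖ N := Submodule.span (↥B)ᵐᵒᵖ {n}
  have hK : ∀ k ∈ K, BalTensor.tmul B k (1 : A) = 0 := fun k hk => by
    obtain ⟨b, rfl⟩ := Submodule.mem_span_singleton.1 hk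
    have h := BalTensor.smul_tmul n b.unop (1 : A)
    rw [op_unop, GroupCoring.tmul_subring_smul_one, hn, smul_zero] at h
    exact h
  have hsub : Subsingleton (BalTensor B K A) := by
    refine subsingleton_of_forall_eq 0 fun t => ?_
    refine H.1 _ _ K.subtype K.injective_subtype ?_
    rw [map_zero]
    refine DFunLike.congr_fun (BalTensor.hom_ext (g := 0) fun k a => ?_) t
    change BalTensor.tmul B (k : N) a = 0
    have h : op a • BalTensor.tmul B (k : N) (1 : A) = BalTensor.tmul B (k : N) (1 * a) := rfl
    rw [hK k k.2, smul_zero, one_mul] at h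
    exact h.symm
  have := H.2 K hsub
  exact congrArg Subtype.val
    (Subsingleton.elim (⟨n, Submodule.mem_span_singleton_self n⟩ : K) 0)

/-- Faithfully flat descent of elements: `a ⊗ 1 = 1 ⊗ a` in `A ⊗_B A` only for `a ∈ B`. -/
theorem LeftFaithfullyFlat.mem_of_tmul_one_eq (H : LeftFaithfullyFlat B A) {a : A}
    (ha : BalTensor.tmul B a (1 : A) = BalTensor.tmul B (1 : A) a) : a ∈ B := by
  let K : Submodule (↥B)ᵐᵒᵖ A := Submodule.span (↥B)ᵐᵒᵖ {1}
  have h0 : K.mkQ (1 : A) = 0 :=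
    (Submodule.Quotient.mk_eq_zero K).2 (Submodule.mem_span_singleton_self 1)
  have h1 : K.mkQ a = 0 := H.tmul_one_injective (by
    have := congrArg (BalTensor.map K.mkQ (LinearMap.id : A →ₗ[B] A)) ha
    rw [BalTensor.map_tmul, BalTensor.map_tmul, h0, BalTensor.zero_tmul] at this
    exact this)
  obtain ⟨b, rfl⟩ := Submodule.mem_span_singleton.1 ((Submodule.Quotient.mk_eq_zero K).1 h1)
  rw [subring_op_smul, one_mul]
  exact b.unop.2

/-- The linear form `a ↦ F(1 ⊗ a)` attached to a linear form `F` on `A ⊗_B A`. -/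
noncomputable def sweedlerEnd (F : BalTensor B A A →ₗ[A] A) : A →ₗ[B] A where
  toFun a := F (BalTensor.tmul B 1 a)
  map_add' a b := by rw [BalTensor.tmul_add, map_add]
  map_smul' b a := by
    rw [GroupCoring.one_subring_smul_tmul, map_smul]
    rfl

theorem sweedlerEnd_apply (F : BalTensor B A A →ₗ[A] A) (a : A) :
    sweedlerEnd F a = F (BalTensor.tmul B 1 a) := rfl

/-- The linear form `a ⊗ b ↦ a f(b)` on `A ⊗_B A`. -/
noncomputable def sweedlerForm (f : A →ₗ[B] A) : BalTensor B A A →ₗ[A] A where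
  toFun := BalTensor.lift (AddMonoidHom.mul.compl₂ f.toAddMonoidHom) (fun a b c => by
    change a * (b : A) * f c = a * f (b • c)
    rw [map_smul, mul_assoc]
    rfl)
  map_add' := map_add _
  map_smul' a := BalTensor.map_left_smul _ a fun m n => mul_assoc a m (f n)

/-- The inclusion of `B` into `A`, as a map of left `B`-modules. -/
def subringIncl (B : Subring A) : B →ₗ[B] A where
  toFun b := b
  map_add' _ _ := rfl
  map_smul' _ _ := rfl

theorem IsDualBasis.sweedler {ι : Type*} [Fintype ι] {a : ι → A} {h : ι → A →ₗ[B] B}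
    (H : IsDualBasis a h) :
    IsDualBasis (fun i => BalTensor.tmul B (1 : A) (a i))
      (fun i => sweedlerForm ((subringIncl B).comp (h i))) := fun t => by
  induction t using BalTensor.induction_on with
  | zero => simp
  | tmul u v =>
    have e (i) : sweedlerForm ((subringIncl B).comp (h i)) (BalTensor.tmul B u v) •
        BalTensor.tmul B (1 : A) (a i) = BalTensor.tmul B u (h i v • a i) := by
      rw [← BalTensor.smul_tmul, BalTensor.left_smul_tmul, smul_eq_mul, mul_one]
      rfl
    simp only [e]
    rw [← BalTensor.tmul_sum, H v]
  | add s t hs ht => simp only [map_add, add_smul, Finset.sum_add_distrib, hs, ht]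

section

variable {W : Type*} [AddCommGroup W] [Module Aᵐᵒᵖ W] [Module (↥B)ᵐᵒᵖ W]
  (hW : ∀ (b : B) (w : W), op b • w = op (b : A) • w)

/-- The contraction `W ⊗_B A → W`, `w ⊗ a ↦ w F(1 ⊗ a)`, for a right `A`-module `W` and a left
linear form `F` on `A ⊗_B A`. -/
noncomputable def sweedlerContract (F : BalTensor B A A →ₗ[A] A) : BalTensor B W A →+ W :=
  BalTensor.lift (AddMonoidHom.mk' (fun w => AddMonoidHom.mk' (fun a => op (sweedlerEnd F a) • w)
      (fun a b => by rw [map_add, MulOpposite.op_add, add_smul]))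
    (fun w w' => by ext a; exact smul_add _ w w'))
    (fun w b a => by
      change op (sweedlerEnd F a) • op b • w = op (sweedlerEnd F (b • a)) • w
      rw [hW, ← mul_smul, map_smul]
      rfl)

theorem sweedlerContract_tmul (F : BalTensor B A A →ₗ[A] A) (w : W) (a : A) :
    sweedlerContract hW F (BalTensor.tmul B w a) = op (sweedlerEnd F a) • w := rfl

/-- If `A ⊗_B A` has a dual basis as a left `A`-module, the contractions separate the points of
`W ⊗_B A`, since `W ⊗_B A = W ⊗_A (A ⊗_B A)`. -/
theorem eq_zero_of_sweedlerContract_eq_zero {ι : Type*} [Fintype ι] {t : ι → BalTensor B A A}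
    {F : ι → BalTensor B A A →ₗ[A] A} (H : IsDualBasis t F) (z : BalTensor B W A)
    (hz : ∀ i, sweedlerContract hW (F i) z = 0) : z = 0 := by
  -- `J w : A ⊗_B A → W ⊗_B A` is `a ⊗ b ↦ w a ⊗ b`
  let J : W →+ BalTensor B A A →+ BalTensor B W A :=
    AddMonoidHom.mk' (fun w => BalTensor.map (M := A) (M' := W)
        { toFun := fun a => op a • w
          map_add' := fun a b => by rw [MulOpposite.op_add, add_smul]
          map_smul' := fun b a => by
            change op (a * (b.unop : A)) • w = b • op a • w
            rw [MulOpposite.op_mul, mul_smul, ← hW, op_unop] } LinearMap.id)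
      (fun w w' => BalTensor.hom_ext fun a b => by
        change BalTensor.tmul B (op a • (w + w')) b =
          BalTensor.tmul B (op a • w) b + BalTensor.tmul B (op a • w') b
        rw [smul_add, BalTensor.add_tmul])
  have hJ (w : W) (a b : A) : J w (BalTensor.tmul B a b) = BalTensor.tmul B (op a • w) b := rfl
  have hJs (w : W) (c : A) (p : BalTensor B A A) : J w (c • p) = J (op c • w) p :=
    DFunLike.congr_fun (BalTensor.hom_ext
      (f := (J w).comp (DistribSMul.toAddMonoidHom (BalTensor B A A) c)) (g := J (op c • w))
      fun a b => by
        change J w (BalTensor.tmul B (c * a) b) = J (op c • w) (BalTensor.tmul B a b)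
        rw [hJ, hJ, MulOpposite.op_mul, mul_smul]) p
  have key (z) : z = ∑ i, J (sweedlerContract hW (F i) z) (t i) := by
    induction z using BalTensor.induction_on with
    | zero => simp
    | tmul w a =>
      have h1 : BalTensor.tmul B w a = J w (BalTensor.tmul B 1 a) := by
        rw [hJ, MulOpposite.op_one, one_smul]
      simp only [sweedlerContract_tmul, sweedlerEnd_apply, ← hJs, ← map_sum]
      rw [H, h1]
    | add s s' hs hs' =>
      simp only [map_add, AddMonoidHom.add_apply, Finset.sum_add_distrib]
      rw [← hs, ← hs']
  rw [key z]
  exact Finset.sum_eq_zero fun i _ => by rw [hz, map_zero, AddMonoidHom.zero_apply]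

end

instance : SMulCommClass B (↥B)ᵐᵒᵖ A where
  smul_comm a b c := (mul_assoc (a : A) c b.unop).symm

/-- The map `e ↦ (a ↦ e(a) ⊗ 1 - 1 ⊗ e(a))` on `B`-linear endomorphisms of `A`. By descent, its
kernel consists of the endomorphisms with values in `B`. -/
noncomputable def descentDefect (B : Subring A) :
    (A →ₗ[B] A) →ₗ[(↥B)ᵐᵒᵖ] (A → BalTensor B A A) where
  toFun e a := BalTensor.tmul B (e a) 1 - BalTensor.tmul B 1 (e a)
  map_add' e e' := by
    ext a
    simp only [LinearMap.add_apply, BalTensor.add_tmul, BalTensor.tmul_add, Pi.add_apply]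
    abel
  map_smul' b e := by
    ext a
    simp only [LinearMap.smul_apply, Pi.smul_apply, smul_sub, RingHom.id_apply]
    congr 1
    obtain ⟨b, rfl⟩ := MulOpposite.op_surjective b
    rw [BalTensor.smul_tmul, GroupCoring.tmul_subring_smul_one]
    rfl

/-- If `A ⊗_B A` is finitely generated projective as a left `A`-module and `A` is faithfully flat
over `B`, then the identity of `A` is a sum `∑ h_i(-) a_i` with `h_i : A → B`: the dual basis of
`A ⊗_B A` yields an element of `End_B(A) ⊗_B A` lying over the identity, and flatness places it in
`Hom_B(A, B) ⊗_B A`. -/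
theorem LeftFaithfullyFlat.exists_isDualBasis_of_sweedler (H : LeftFaithfullyFlat B A)
    {κ : Type*} [Fintype κ] {t : κ → BalTensor B A A} {F : κ → BalTensor B A A →ₗ[A] A}
    (ht : IsDualBasis t F) :
    ∃ (ι : Type) (_ : Fintype ι) (a : ι → A) (h : ι → A →ₗ[B] B), IsDualBasis a h := by
  -- `ev a : End_B(A) ⊗_B A → A ⊗_B A` is `e ⊗ b ↦ e(a) ⊗ b`
  let ev (a : A) : BalTensor B (A →ₗ[B] A) A →+ BalTensor B A A :=
    BalTensor.map { toFun := fun e => e a, map_add' := fun _ _ => rfl, map_smul' := fun _ _ => rfl }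
      LinearMap.id
  -- `L f : A ⊗_B A → End_B(A) ⊗_B A` is `u ⊗ v ↦ f(-) u ⊗ v`
  let L (f : A →ₗ[B] A) : BalTensor B A A →+ BalTensor B (A →ₗ[B] A) A :=
    BalTensor.map
      { toFun := fun u =>
          { toFun := fun a => f a * u
            map_add' := fun a a' => by rw [map_add, add_mul]
            map_smul' := fun b a => by
              rw [map_smul]
              exact mul_assoc (b : A) (f a) u }
        map_add' := fun u u' => LinearMap.ext fun a => mul_add (f a) u u'
        map_smul' := fun b u => LinearMap.ext fun a => (mul_assoc (f a) u b.unop).symm }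
      LinearMap.id
  have hevL (a : A) (f : A →ₗ[B] A) (p : BalTensor B A A) : ev a (L f p) = f a • p :=
    DFunLike.congr_fun (BalTensor.hom_ext (f := (ev a).comp (L f))
      (g := DistribSMul.toAddMonoidHom (BalTensor B A A) (f a)) fun u v => rfl) p
  let z : BalTensor B (A →ₗ[B] A) A := ∑ i, L (sweedlerEnd (F i)) (t i)
  have hz (a : A) : ev a z = BalTensor.tmul B 1 a := by
    simp only [z, map_sum, hevL]
    exact ht _
  have hW (b : B) (w : A → BalTensor B A A) : op b • w = op (b : A) • w := by
    ext a
    change op b • w a = op (b : A) • w a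
    induction w a using BalTensor.induction_on with
    | zero => rw [smul_zero, smul_zero]
    | tmul u v => rfl
    | add s s' hs hs' => rw [smul_add, smul_add, hs, hs']
  have hker : BalTensor.map (descentDefect B) (LinearMap.id : A →ₗ[B] A) z = 0 := by
    refine eq_zero_of_sweedlerContract_eq_zero hW ht _ fun i => ?_
    -- `Θ` is `u ⊗ v ↦ (u ⊗ 1) c - (1 ⊗ u) c` with `c = F i (1 ⊗ v)`
    let Θ : BalTensor B A A →+ BalTensor B A A :=
      (BalTensor.map LinearMap.id (sweedlerEnd (F i))) -
        (BalTensor.mk B A A 1).comp (sweedlerForm (sweedlerEnd (F i))).toAddMonoidHom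
    have hΘ (u v : A) : Θ (BalTensor.tmul B u v) =
      BalTensor.tmul B u (sweedlerEnd (F i) v) - BalTensor.tmul B 1 (u * sweedlerEnd (F i) v) := rfl
    ext a
    refine Eq.trans (b := Θ (ev a z)) ?_ ?_
    · refine DFunLike.congr_fun (BalTensor.hom_ext
        (f := (Pi.evalAddMonoidHom (fun _ : A => BalTensor B A A) a).comp
          ((sweedlerContract hW (F i)).comp (BalTensor.map (descentDefect B) LinearMap.id)))
        (g := Θ.comp (ev a)) fun e v => ?_) z
      change op (sweedlerEnd (F i) v) • (BalTensor.tmul B (e a) (1 : A) - BalTensor.tmul B 1 (e a)) =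
        Θ (BalTensor.tmul B (e a) v)
      rw [hΘ, smul_sub, BalTensor.op_smul_tmul, BalTensor.op_smul_tmul, op_smul_eq_mul,
        op_smul_eq_mul, one_mul]
    · rw [hz, hΘ, one_mul, sub_self]
      rfl
  obtain ⟨s, hs⟩ := H.exists_map_ker_subtype_eq _ z hker
  obtain ⟨ι, _, e, a, rfl⟩ := BalTensor.exists_sum_tmul s
  have he (i) (c : A) : (e i).1 c ∈ B :=
    H.mem_of_tmul_one_eq (sub_eq_zero.1 (congrFun (LinearMap.mem_ker.1 (e i).2) c))
  refine ⟨ι, inferInstance, a, fun i =>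
    { toFun := fun c => ⟨(e i).1 c, he i c⟩
      map_add' := fun c c' => Subtype.ext (map_add (e i).1 c c')
      map_smul' := fun b c => Subtype.ext (map_smul (e i).1 b c) }, fun c => ?_⟩
  have h1 := congrArg (GroupCoring.sweedlerεHom B) (hz c)
  rw [← hs, map_sum, map_sum, map_sum] at h1
  exact h1.trans (one_mul c)

/-- If `1 ∈ I A` for a right ideal `I` of `B`, then `B / I ⊗_B A = 0`. -/
theorem subsingleton_quotient_tensor (I : Submodule (↥B)ᵐᵒᵖ B) {ι : Type*} [Fintype ι] (b : ι → B)
    (hb : ∀ i, b i ∈ I) (a : ι → A) (h1 : ∑ i, (b i : A) * a i = 1) :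
    Subsingleton (BalTensor B (B ⧸ I) A) := by
  have h0 (c : A) : BalTensor.tmul B (I.mkQ 1) c = 0 := by
    rw [← one_mul c, ← h1, Finset.sum_mul, BalTensor.tmul_sum]
    refine Finset.sum_eq_zero fun i _ => ?_
    have e : (b i : A) * a i * c = b i • (a i * c) := mul_assoc _ _ _
    rw [e, ← BalTensor.smul_tmul, ← map_smul, op_smul_eq_mul, one_mul,
      show I.mkQ (b i) = 0 from (Submodule.Quotient.mk_eq_zero I).2 (hb i), BalTensor.zero_tmul]
  refine subsingleton_of_forall_eq 0 fun t => ?_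
  refine DFunLike.congr_fun (BalTensor.hom_ext (f := AddMonoidHom.id _) (g := 0) fun n c => ?_) t
  obtain ⟨d, rfl⟩ := I.mkQ_surjective n
  change BalTensor.tmul B (I.mkQ d) c = 0
  rw [← one_mul d, ← op_smul_eq_mul, map_smul, BalTensor.smul_tmul, h0]

/-- If `- ⊗_B A` reflects zero and `A` has a dual basis over `B`, the trace ideal of `A` is `B`. -/
theorem IsDualBasis.exists_sum_eq_one
    (H : ∀ (N : Type u) [AddCommGroup N] [Module (↥B)ᵐᵒᵖ N],
      Subsingleton (BalTensor B N A) → Subsingleton N) {ι : Type*} [Fintype ι]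
    {a : ι → A} {h : ι → A →ₗ[B] B} (hah : IsDualBasis a h) :
    ∃ (κ : Type) (_ : Fintype κ) (a' : κ → A) (h' : κ → A →ₗ[B] B), ∑ j, h' j (a' j) = 1 := by
  let I : Submodule (↥B)ᵐᵒᵖ B :=
    Submodule.span (↥B)ᵐᵒᵖ (Set.range fun p : (A →ₗ[B] B) × A => p.1 p.2)
  have hI := H _ (subsingleton_quotient_tensor I (fun i => h i 1)
    (fun i => Submodule.subset_span ⟨(h i, 1), rfl⟩) a (hah 1))
  have h1 : (1 : B) ∈ I := (Submodule.Quotient.mk_eq_zero I).1 (Subsingleton.elim _ _)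
  generalize (1 : B) = c at h1 ⊢
  induction h1 using Submodule.span_induction with
  | mem c hc =>
    obtain ⟨p, rfl⟩ := hc
    exact ⟨Unit, inferInstance, fun _ => p.2, fun _ => p.1, by simp⟩
  | zero => exact ⟨Empty, inferInstance, Empty.elim, Empty.elim, by simp⟩
  | add c d _ _ hc hd =>
    obtain ⟨κ, _, a₁, h₁, rfl⟩ := hc
    obtain ⟨κ', _, a₂, h₂, rfl⟩ := hd
    exact ⟨κ ⊕ κ', inferInstance, Sum.elim a₁ a₂, Sum.elim h₁ h₂, by simp⟩
  | smul b c _ hc =>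
    obtain ⟨κ, _, a₁, h₁, rfl⟩ := hc
    exact ⟨κ, inferInstance, a₁, fun i => b • h₁ i, by
      simp only [LinearMap.smul_apply, Finset.smul_sum]⟩

/-- Faithful flatness together with finite generation and projectivity of `A ⊗_B A` over `A` makes
`A` a progenerator over `B`. -/
theorem LeftFaithfullyFlat.leftProgenerator (H : LeftFaithfullyFlat B A)
    {κ : Type*} [Fintype κ] {t : κ → BalTensor B A A} {F : κ → BalTensor B A A →ₗ[A] A}
    (ht : IsDualBasis t F) : LeftProgenerator B A := by
  obtain ⟨ι, _, a, h, hah⟩ := H.exists_isDualBasis_of_sweedler ht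
  obtain ⟨κ', _, a', h', h1⟩ := hah.exists_sum_eq_one H.2
  exact leftProgenerator_of_isDualBasis hah a' h' h1

end Subring

/-! ### Bijectivity of the canonical morphism and of its dual -/

/-- A map between modules with finite dual bases is bijective if its dual is. -/
theorem bijective_of_dual_bijective {R P P' ι κ : Type*} [Ring R] [AddCommGroup P] [Module R P]
    [AddCommGroup P'] [Module R P'] [Fintype ι] [Fintype κ] {a : ι → P} {h : ι → P →ₗ[R] R}
    (H : IsDualBasis a h) {a' : κ → P'} {h' : κ → P' →ₗ[R] R} (H' : IsDualBasis a' h')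
    (f : P →ₗ[R] P') (hf : Function.Bijective fun g : P' →ₗ[R] R => g.comp f) :
    Function.Bijective f := by
  constructor
  · intro p q hpq
    refine H.ext fun φ => ?_
    obtain ⟨g, rfl⟩ := hf.2 φ
    exact congrArg g hpq
  · intro p'
    choose g hg using fun i => hf.2 (h i)
    refine ⟨∑ i, g i p' • a i, H'.ext fun φ => ?_⟩
    have key : ∑ i, op (φ (f (a i))) • g i = φ := hf.1 <| LinearMap.ext fun p => by
      simp only [LinearMap.comp_apply, LinearMap.sum_apply, LinearMap.smul_apply, op_smul_eq_mul]
      have e (i) : g i (f p) = h i p := LinearMap.congr_fun (hg i) p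
      conv_rhs => rw [← H p]
      simp only [e, map_sum, map_smul, smul_eq_mul]
    conv_rhs => rw [← key]
    simp only [map_sum, map_smul, smul_eq_mul, LinearMap.sum_apply, LinearMap.smul_apply,
      op_smul_eq_mul]

namespace GroupCoring

variable {G A : Type u} [Group G] [Ring A] {𝒞 𝒟 : GroupCoring G A}

theorem Hom.isIso_iff (f : Hom 𝒞 𝒟) : f.IsIso ↔ ∀ α, Function.Bijective (f.f α).left := by
  constructor
  · rintro ⟨g, h₁, h₂⟩ α
    exact ⟨Function.LeftInverse.injective (h₁ α), Function.RightInverse.surjective (h₂ α)⟩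
  · intro hf
    let e (α : G) : 𝒞.C α ≃ₗ[A] 𝒟.C α := LinearEquiv.ofBijective (f.f α).left (hf α)
    have he (α : G) (c : 𝒞.C α) : (e α).symm ((f.f α).left c) = c := (e α).symm_apply_apply c
    have he' (α : G) (d : 𝒟.C α) : (f.f α).left ((e α).symm d) = d := (e α).apply_symm_apply d
    let g (α : G) : BimodHom A (𝒟.C α) (𝒞.C α) :=
      { (e α).symm.toLinearMap with
        map_op_smul' := fun a d => (hf α).1 <| by
          change (f.f α).left ((e α).symm (op a • d)) = (f.f α).left (op a • (e α).symm d)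
          rw [he', BimodHom.map_op_smul, he'] }
    refine ⟨⟨g, fun α β γ h d => ?_, fun c hc d => ?_⟩, he, he'⟩
    · obtain ⟨c, rfl⟩ := (hf γ).2 d
      have h₁ : (g γ).left ((f.f γ).left c) = c := he γ c
      rw [h₁, ← f.comm_Δ, BalTensor.map_map]
      have h₂ : (g α).right.comp (f.f α).right = LinearMap.id := LinearMap.ext (he α)
      have h₃ : (g β).left.comp (f.f β).left = LinearMap.id := LinearMap.ext (he β)
      rw [h₂, h₃]
      exact DFunLike.congr_fun (BalTensor.hom_ext (f := BalTensor.map LinearMap.id LinearMap.id)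
        (g := AddMonoidHom.id _) fun _ _ => rfl) _
    · rw [← f.comm_ε c hc]
      exact congrArg _ (he' c d)

theorem Hom.leftDual_bijective_iff (f : Hom 𝒞 𝒟) :
    Function.Bijective f.leftDual ↔ ∀ α, Function.Bijective (f.dualComponent α) := by
  have h₁ := DirectSum.map_injective f.dualComponent
  have h₂ := DirectSum.map_surjective f.dualComponent
  exact (and_congr h₁ h₂).trans forall_and.symm

namespace Grouplike

variable {𝒞 : GroupCoring G A} (x : Grouplike 𝒞) {B : Subring A} (hB : B ≤ x.T)

/-- For a homogeneous progenerator group coring, the canonical morphism is an isomorphism and `A`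
is faithfully flat over `B` exactly if the dual of the canonical morphism is an isomorphism and `A`
is a progenerator over `B`. -/
theorem can_isIso_and_faithfullyFlat_iff (h𝒞 : 𝒞.IsLeftHomogeneousProgenerator) :
    (x.can hB).IsIso ∧ LeftFaithfullyFlat B A ↔
      Function.Bijective (x.can hB).leftDual ∧ LeftProgenerator B A := by
  rw [Hom.isIso_iff, Hom.leftDual_bijective_iff]
  constructor
  · rintro ⟨hcan, hA⟩
    constructor
    · intro α
      let e := LinearEquiv.ofBijective _ (hcan α⁻¹)
      constructor
      · intro g g' hg
        refine LinearMap.ext fun c => ?_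
        obtain ⟨d, rfl⟩ := (hcan α⁻¹).2 c
        exact LinearMap.congr_fun hg d
      · intro g
        exact ⟨g.comp e.symm.toLinearMap, LinearMap.ext fun d =>
          congrArg g (e.symm_apply_apply d)⟩
    · obtain ⟨n, c, φ, hc⟩ := (h𝒞 1).exists_isDualBasis
      exact hA.leftProgenerator (hc.comp_linearEquiv
        (LinearEquiv.ofBijective (x.canComponent hB 1).left (hcan 1)))
  · rintro ⟨hdual, hA⟩
    refine ⟨fun α => ?_, hA.leftFaithfullyFlat⟩
    obtain ⟨n, a, h, hah⟩ := hA.exists_isDualBasis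
    obtain ⟨m, c, φ, hc⟩ := (h𝒞 α).exists_isDualBasis
    refine bijective_of_dual_bijective hah.sweedler hc _ ?_
    obtain ⟨β, rfl⟩ : ∃ β, α = β⁻¹ := ⟨α⁻¹, (inv_inv α).symm⟩
    exact hdual β

end Grouplike

end GroupCoring

/-! ### Strictness of the Morita context -/

theorem AddSubmonoid.exists_sum_of_mem_closure {M : Type*} [AddCommMonoid M] {s : Set M} {m : M}
    (hm : m ∈ AddSubmonoid.closure s) :
    ∃ (ι : Type) (_ : Fintype ι) (f : ι → M), (∀ i, f i ∈ s) ∧ ∑ i, f i = m := by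
  induction hm using AddSubmonoid.closure_induction with
  | mem m hm => exact ⟨Unit, inferInstance, fun _ => m, fun _ => hm, by simp⟩
  | zero => exact ⟨Empty, inferInstance, Empty.elim, fun i => i.elim, by simp⟩
  | add m m' _ _ h h' =>
    obtain ⟨ι, _, f, hf, rfl⟩ := h
    obtain ⟨κ, _, g, hg, rfl⟩ := h'
    exact ⟨ι ⊕ κ, inferInstance, Sum.elim f g, fun i => by cases i <;> simp [hf, hg], by simp⟩

/-- The components of a product of two elements of graded groups are sums of products of homogeneous
elements. -/
theorem gradedMul_apply_mem_closure {G : Type*} [Group G] {X Y Z : G → Type*}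
    [∀ α, AddCommGroup (X α)] [∀ α, AddCommGroup (Y α)] [∀ α, AddCommGroup (Z α)]
    (m : GradedPairing X Y Z) (x : ⨁ α, X α) (y : ⨁ α, Y α) (γ : G) :
    gradedMul m x y γ ∈ AddSubmonoid.closure {z | ∃ α β h x y, z = m α β γ h x y} := by
  classical
  induction x using DirectSum.induction_on with
  | zero => simp
  | add x x' hx hx' =>
    rw [map_add, AddMonoidHom.add_apply, DirectSum.add_apply]
    exact add_mem hx hx'
  | of α x =>
    induction y using DirectSum.induction_on with
    | zero => simp
    | add y y' hy hy' =>
      rw [map_add, DirectSum.add_apply]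
      exact add_mem hy hy'
    | of β y =>
      by_cases h : α * β = γ
      · rw [gradedMul_of m h]
        refine AddSubmonoid.subset_closure ⟨α, β, h, x, y, ?_⟩
        rw [DirectSum.of_eq_same]
      · rw [gradedMul_of m rfl, DirectSum.of_eq_of_ne _ _ _ (Ne.symm h)]
        exact zero_mem _

namespace MoritaContext

variable {S R P Q : Type*} [Ring S] [Ring R]
  [AddCommGroup P] [Module S P] [Module Rᵐᵒᵖ P] [SMulCommClass S Rᵐᵒᵖ P]
  [AddCommGroup Q] [Module R Q] [Module Sᵐᵒᵖ Q] [SMulCommClass R Sᵐᵒᵖ Q]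
  (𝕄 : MoritaContext S R P Q)

/-- Both actions of `S` on `P ⊗_R Q` through the connecting map agree, so that a preimage of `1` forces
the connecting map to be injective. -/
theorem φ_op_smul (t t' : BalTensor R P Q) : op (𝕄.φ.left t') • t = 𝕄.φ.left t • t' := by
  induction t using BalTensor.induction_on with
  | zero => rw [smul_zero, map_zero, zero_smul]
  | add s t hs ht => rw [smul_add, hs, ht, map_add, add_smul]
  | tmul p q =>
    induction t' using BalTensor.induction_on with
    | zero => rw [smul_zero, map_zero, MulOpposite.op_zero, zero_smul]
    | add s t hs ht => rw [smul_add, ← hs, ← ht, map_add, MulOpposite.op_add, add_smul]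
    | tmul p' q' =>
      rw [BalTensor.op_smul_tmul, BalTensor.left_smul_tmul, ← 𝕄.ψ_smul, 𝕄.φ_smul,
        BalTensor.smul_tmul]

theorem ψ_op_smul (t t' : BalTensor S Q P) : op (𝕄.ψ.left t') • t = 𝕄.ψ.left t • t' := by
  induction t using BalTensor.induction_on with
  | zero => rw [smul_zero, map_zero, zero_smul]
  | add s t hs ht => rw [smul_add, hs, ht, map_add, add_smul]
  | tmul p q =>
    induction t' using BalTensor.induction_on with
    | zero => rw [smul_zero, map_zero, MulOpposite.op_zero, zero_smul]
    | add s t hs ht => rw [smul_add, ← hs, ← ht, map_add, MulOpposite.op_add, add_smul]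
    | tmul p' q' =>
      rw [BalTensor.op_smul_tmul, BalTensor.left_smul_tmul, ← 𝕄.φ_smul, 𝕄.ψ_smul,
        BalTensor.smul_tmul]

/-- A Morita context is strict as soon as the units are in the images of the connecting maps. -/
theorem isStrict_of_one {t : BalTensor R P Q} (ht : 𝕄.φ.left t = 1) {s : BalTensor S Q P}
    (hs : 𝕄.ψ.left s = 1) : 𝕄.IsStrict := by
  refine ⟨⟨(injective_iff_map_eq_zero _).2 fun t' ht' => ?_,
    fun r => ⟨r • t, by rw [map_smul, ht, smul_eq_mul, mul_one]⟩⟩,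
    ⟨(injective_iff_map_eq_zero _).2 fun s' hs' => ?_,
    fun r => ⟨r • s, by rw [map_smul, hs, smul_eq_mul, mul_one]⟩⟩⟩
  · rw [← one_smul Sᵐᵒᵖ t', ← MulOpposite.op_one, ← ht, 𝕄.φ_op_smul, ht', zero_smul]
  · rw [← one_smul Rᵐᵒᵖ s', ← MulOpposite.op_one, ← hs, 𝕄.ψ_op_smul, hs', zero_smul]

end MoritaContext

theorem BalTensor.contractRight_sum {A M N ι : Type*} [Ring A] [AddCommGroup M] [Module Aᵐᵒᵖ M]
    [AddCommGroup N] [Module A N] [Fintype ι] (f : ι → N →ₗ[A] A) (t : BalTensor A M N) :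
    contractRight M (∑ i, f i) t = ∑ i, contractRight M (f i) t :=
  map_sum (AddMonoidHom.mk' (fun f => contractRight M f t) fun f g => contractRight_add f g t)
    f Finset.univ

namespace GroupCoring.Grouplike

variable {G A : Type u} [Group G] [Ring A] {𝒞 : GroupCoring G A} (x : Grouplike 𝒞)
  {B : Subring A} (hB : B ≤ x.T)

section CanForm

variable {hB} (hcan : ∀ α, Function.Bijective (x.canComponent hB α).left)

/-- The linear form `a x_β b ↦ a h(b)` on `C_β`, for `h : A → B` and an invertible canonical
morphism. -/
noncomputable def canForm (β : G) (h : A →ₗ[B] B) : 𝒞.C β →ₗ[A] A :=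
  (sweedlerForm ((subringIncl B).comp h)).comp
    (LinearEquiv.ofBijective (x.canComponent hB β).left (hcan β)).symm.toLinearMap

theorem canForm_apply (β : G) (h : A →ₗ[B] B) (a b : A) :
    x.canForm hcan β h (a • op b • x.x β) = a * h b := by
  rw [← x.canComponent_tmul hB]
  exact congrArg (sweedlerForm ((subringIncl B).comp h))
    ((LinearEquiv.ofBijective (x.canComponent hB β).left (hcan β)).symm_apply_apply
      (BalTensor.tmul B a b))

theorem canForm_x (β : G) (h : A →ₗ[B] B) (b : A) :
    x.canForm hcan β h (op b • x.x β) = h b := by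
  rw [← one_smul A (op b • x.x β), canForm_apply, one_mul]

include hcan in
theorem can_induction {β : G} {p : 𝒞.C β → Prop} (h0 : p 0)
    (h1 : ∀ a b : A, p (a • op b • x.x β)) (hadd : ∀ c d, p c → p d → p (c + d)) (c : 𝒞.C β) :
    p c := by
  obtain ⟨t, rfl⟩ := (hcan β).2 c
  have (t : BalTensor B A A) : p ((x.canComponent hB β).left t) := by
    induction t using BalTensor.induction_on with
    | zero => rwa [map_zero]
    | tmul a b => exact h1 a b
    | add s t hs ht =>
      rw [map_add]
      exact hadd _ _ hs ht
  exact this t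

/-- `c_{(1,β)} g_h(c_{(2,δ)}) = g_h(c) x_β` for the forms `g_h(a x b) = a h(b)`: this is the defining
condition of `Q`. -/
theorem contractRight_canForm (h : A →ₗ[B] B) (β δ γ : G) (e : β * δ = γ) (c : 𝒞.C γ) :
    BalTensor.contractRight (𝒞.C β) (x.canForm hcan δ h) ((𝒞.Δ β δ γ e).left c) =
      x.canForm hcan γ h c • x.x β := by
  induction c using x.can_induction hcan with
  | h0 => rw [map_zero, map_zero, map_zero, zero_smul]
  | h1 a b =>
    rw [map_smul, BimodHom.map_op_smul, x.comul_x, BalTensor.contractRight_smul,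
      BalTensor.op_smul_tmul, BalTensor.contractRight_tmul, canForm_x, canForm_apply, mul_smul,
      hB (h b).2 β]
  | hadd c d hc hd => rw [map_add, map_add, map_add, hc, hd, add_smul]

/-- The element of `Q` defined by `a x_{β⁻¹} b ↦ a h(b)`. -/
noncomputable def canQ (h : A →ₗ[B] B) : x.Q :=
  ⟨fun β => x.canForm hcan β⁻¹ h, fun _ _ _ _ => x.contractRight_canForm hcan h _ _ _ _⟩

/-- The counit as the sum of the forms `a x b ↦ a h_i(b) a_i` of a dual basis. -/
theorem sum_canForm_eq_counit {ι : Type*} [Fintype ι] {a : ι → A} {h : ι → A →ₗ[B] B}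
    (H : IsDualBasis a h) (e : G) (he : e = 1) :
    ∑ i, op (a i) • x.canForm hcan e (h i) = (𝒞.ε e he).left := by
  refine LinearMap.ext fun c => ?_
  induction c using x.can_induction hcan with
  | h0 => rw [map_zero, map_zero]
  | h1 b b' =>
    rw [map_smul, map_smul (𝒞.ε e he).left, BimodHom.map_op_smul, x.counit_x, op_smul_eq_mul,
      one_mul,
      LinearMap.sum_apply]
    simp only [LinearMap.smul_apply, canForm_x, op_smul_eq_mul]
    exact congrArg (b • ·) (H b')
  | hadd c d hc hd => rw [map_add, map_add, hc, hd]

include hcan in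
theorem i_bijective (hBT : B = x.T) : Function.Bijective x.i := by
  subst hBT
  constructor
  · intro a b hab
    exact Subtype.ext (congrFun (congrArg Subtype.val hab) 1)
  · intro b
    -- `b_γ ⊗ 1 = 1 ⊗ b_α` in `A ⊗_B A`, and multiplication gives `b_γ = b_α`
    have key (α γ : G) : b.1 γ = b.1 α := by
      have h := b.2 α (α⁻¹ * γ) γ (mul_inv_cancel_left α γ)
      have h' : BalTensor.tmul x.T (b.1 γ) (1 : A) = BalTensor.tmul x.T (1 : A) (b.1 α) :=
        (hcan (α⁻¹ * γ)⁻¹).1 (by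
          rw [canComponent_tmul, canComponent_tmul, MulOpposite.op_one, one_smul, one_smul, h])
      have h'' := congrArg (sweedlerεHom x.T) h'
      exact (mul_one _).symm.trans (h''.trans (one_mul _))
    refine ⟨⟨b.1 1, fun α => ?_⟩, Subtype.ext (funext fun γ => key γ 1)⟩
    obtain ⟨β, rfl⟩ : ∃ β, α = β⁻¹ := ⟨α⁻¹, (inv_inv α).symm⟩
    have h := b.2 1 β β (one_mul β)
    rwa [key 1 β] at h

include hcan in
theorem isStrict_of_can_bijective (hA : LeftProgenerator B A) : x.moritaContext.IsStrict := by
  obtain ⟨n, a, h, hah⟩ := hA.exists_isDualBasis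
  obtain ⟨m, a', h', hah'⟩ := hA.exists_sum_eq_one
  refine x.moritaContext.isStrict_of_one
    (t := ∑ j, BalTensor.tmul _ (x.μ 1 (a' j)) (x.ω 1 (x.canQ hcan (h' j))))
    (s := ∑ i, BalTensor.tmul _ (x.ω 1 (x.canQ hcan (h i))) (x.μ 1 (a i))) ?_ ?_
  · have e (a : A) (q : x.Q) : x.moritaContext.φ.left (BalTensor.tmul _ (x.μ 1 a) (x.ω 1 q)) =
        x.u 1 (x.evalQ 1 a q) := gradedMul_of x.pairingAQ (mul_one 1) a q
    rw [map_sum]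
    simp only [e, ← map_sum]
    refine congrArg (x.u 1) (Subtype.ext (funext fun β => ?_))
    have e' (j) : (x.evalQ 1 (a' j) (x.canQ hcan (h' j))).1 β = h' j (a' j) :=
      x.canForm_x hcan _ _ _
    rw [AddSubmonoidClass.coe_finsetSum, Finset.sum_apply]
    simp only [e']
    exact (AddSubmonoidClass.coe_finsetSum _ _).symm.trans (congrArg Subtype.val hah')
  · have e (a : A) (q : x.Q) : x.moritaContext.ψ.left (BalTensor.tmul _ (x.ω 1 q) (x.μ 1 a)) =
        LeftDual.of 𝒞 1 (op a • q.1 1) := gradedMul_of x.pairingQA (mul_one 1) q a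
    rw [map_sum]
    simp only [e, ← map_sum]
    exact congrArg (LeftDual.of 𝒞 1) (x.sum_canForm_eq_counit hcan hah _ inv_one)

end CanForm

/-- The component of degree `e` of a preimage of `1 ∈ R` under `ν`. -/
theorem exists_sum_eq_counit_of_surjective (hν : Function.Surjective x.moritaContext.ψ.left) :
    ∃ (ι : Type) (_ : Fintype ι) (q : ι → x.Q) (a : ι → A),
      ∑ i, op (a i) • (q i).1 1 = (𝒞.ε 1⁻¹ inv_one).left := by
  obtain ⟨z, hz⟩ := hν 1
  have key : (show ⨁ α, 𝒞.Dual α from x.moritaContext.ψ.left z) 1 ∈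
      AddSubmonoid.closure {f | ∃ (q : x.Q) (a : A), f = op a • q.1 1} := by
    clear hz
    induction z using BalTensor.induction_on with
    | zero =>
      rw [map_zero]
      exact zero_mem _
    | add s t hs ht =>
      rw [map_add]
      exact add_mem hs ht
    | tmul q p =>
      refine AddSubmonoid.closure_mono ?_ (gradedMul_apply_mem_closure x.pairingQA q p 1)
      rintro _ ⟨α, β, h, q, a, rfl⟩
      exact ⟨q, a, rfl⟩
  obtain ⟨ι, _, f, hf, hsum⟩ := AddSubmonoid.exists_sum_of_mem_closure key
  choose q a hqa using hf
  refine ⟨ι, inferInstance, q, a, ?_⟩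
  simp only [← hqa, hsum, hz]
  classical exact DirectSum.of_eq_same _ _

/-- The component of degree `e` of a preimage of `1 ∈ G*S` under `ω`. -/
theorem exists_sum_evalQ_eq_one_of_surjective (hω : Function.Surjective x.moritaContext.φ.left) :
    ∃ (ι : Type) (_ : Fintype ι) (σ : ι → G) (q : ι → x.Q) (a : ι → A),
      ∑ i, x.evalQ (σ i) (a i) (q i) = 1 := by
  obtain ⟨z, hz⟩ := hω 1
  have key : (show ⨁ _ : G, x.S from x.moritaContext.φ.left z) 1 ∈
      AddSubmonoid.closure {f | ∃ (σ : G) (q : x.Q) (a : A), f = x.evalQ σ a q} := by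
    clear hz
    induction z using BalTensor.induction_on with
    | zero =>
      rw [map_zero]
      exact zero_mem _
    | add s t hs ht =>
      rw [map_add]
      exact add_mem hs ht
    | tmul p q =>
      refine AddSubmonoid.closure_mono ?_ (gradedMul_apply_mem_closure x.pairingAQ p q 1)
      rintro _ ⟨α, σ, h, a, q, rfl⟩
      exact ⟨σ, q, a, rfl⟩
  obtain ⟨ι, _, f, hf, hsum⟩ := AddSubmonoid.exists_sum_of_mem_closure key
  choose σ q a hqa using hf
  refine ⟨ι, inferInstance, σ, q, a, ?_⟩
  simp only [← hqa, hsum, hz]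
  classical exact DirectSum.of_eq_same _ _

/-- If `i : T → S` is onto, `q ∈ Q` defines a map `A → T`, `a ↦ q_β(x_{β⁻¹} a)`, independent of
`β`. -/
theorem exists_form_of_Q (hBT : B = x.T) (hi : Function.Surjective x.i) (q : x.Q) :
    ∃ h : A →ₗ[B] B, ∀ β a, q.1 β (op a • x.x β⁻¹) = h a := by
  subst hBT
  have key (a : A) : ∃ t : x.T, ∀ β, q.1 β (op a • x.x β⁻¹) = t := by
    obtain ⟨t, ht⟩ := hi (x.evalQ 1 a q)
    refine ⟨t, fun β => ?_⟩
    have h : (t : A) = q.1 (1 * β) (op a • x.x (1 * β)⁻¹) := congrFun (congrArg Subtype.val ht) β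
    rw [h, one_mul]
  choose t ht using key
  refine ⟨{ toFun := t, map_add' := fun a b => Subtype.ext ?_,
            map_smul' := fun b a => Subtype.ext ?_ }, fun β a => ht a β⟩
  · rw [← ht _ 1, MulOpposite.op_add, add_smul, map_add, ht, ht]
    rfl
  · rw [← ht _ 1]
    change q.1 1 (op ((b : A) * a) • x.x 1⁻¹) = (b : A) * t a
    rw [MulOpposite.op_mul, mul_smul, ← b.2, ← smul_comm, map_smul, ht, smul_eq_mul]

/-- An expression `ε = ∑ q_i(-) a_i` on `C_e` gives the inverse `c ↦ ∑ q_{i,β}(c) ⊗ a_i` of the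
canonical map on `C_{β⁻¹}`, and a dual basis of `A` over `B`. -/
theorem isDualBasis_and_can_bijective {ι : Type*} [Fintype ι] {q : ι → x.Q} {a : ι → A}
    (hq : ∑ i, op (a i) • (q i).1 1 = (𝒞.ε 1⁻¹ inv_one).left) {h : ι → A →ₗ[B] B}
    (hh : ∀ i β b, (q i).1 β (op b • x.x β⁻¹) = h i b) :
    IsDualBasis a h ∧ ∀ α, Function.Bijective (x.canComponent hB α).left := by
  have hdual : IsDualBasis a h := fun b => by
    have e := LinearMap.congr_fun hq (op b • x.x 1⁻¹)
    rw [BimodHom.map_op_smul, x.counit_x, op_smul_eq_mul, one_mul, LinearMap.sum_apply] at e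
    refine (Finset.sum_congr rfl fun i _ => ?_).trans e
    rw [LinearMap.smul_apply, hh]
    rfl
  refine ⟨hdual, fun α => ?_⟩
  obtain ⟨β, rfl⟩ : ∃ β, α = β⁻¹ := ⟨α⁻¹, (inv_inv α).symm⟩
  let e : 𝒞.C β⁻¹ →+ BalTensor B A A :=
    ∑ i, ((BalTensor.mk B A A).flip (a i)).comp ((q i).1 β).toAddMonoidHom
  have he (c) : e c = ∑ i, BalTensor.tmul B ((q i).1 β c) (a i) := by
    simp only [e, AddMonoidHom.finsetSum_apply]
    rfl
  have hleft : e.comp (x.canComponent hB β⁻¹).left.toAddMonoidHom = AddMonoidHom.id _ :=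
    BalTensor.hom_ext fun b c => by
      change e (b • op c • x.x β⁻¹) = BalTensor.tmul B b c
      have h1 (i) : BalTensor.tmul B ((q i).1 β (b • op c • x.x β⁻¹)) (a i) =
          BalTensor.tmul B b (h i c • a i) := by
        rw [map_smul, hh, ← BalTensor.smul_tmul]
        rfl
      simp only [he, h1]
      rw [← BalTensor.tmul_sum, hdual c]
  refine ⟨Function.LeftInverse.injective (DFunLike.congr_fun hleft), fun c => ⟨e c, ?_⟩⟩
  rw [he, map_sum]
  have hc := 𝒞.counit_right β⁻¹ 1⁻¹ inv_one (by simp) c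
  rw [← hq, BalTensor.contractRight_sum] at hc
  refine (Finset.sum_congr rfl fun i _ => ?_).trans hc
  rw [canComponent_tmul, contractRight_op_smul, (q i).2 1 β β (one_mul β), smul_comm]

end GroupCoring.Grouplike

/-! ### The equivalence between modules and comodules -/

namespace GroupCoring

open CategoryTheory

variable {G A : Type u} [Group G] [Ring A] {𝒞 : GroupCoring G A}

theorem GComod.isIso_of_bijective {M N : GComod 𝒞} (f : M ⟶ N)
    (hf : ∀ α, Function.Bijective (f.f α)) : IsIso f := by
  let e (α : G) : M.M α ≃ₗ[Aᵐᵒᵖ] N.M α := LinearEquiv.ofBijective (f.f α) (hf α)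
  let g : N ⟶ M :=
    { f := fun α => (e α).symm.toLinearMap
      comm := fun α β γ h n => by
        obtain ⟨m, rfl⟩ := (hf γ).2 n
        have h₁ : (e γ).symm (f.f γ m) = m := (e γ).symm_apply_apply m
        have h₂ : (e α).symm.toLinearMap.comp (f.f α) = LinearMap.id :=
          LinearMap.ext (e α).symm_apply_apply
        rw [LinearEquiv.coe_coe, h₁, ← f.comm, BalTensor.map_map, h₂]
        exact DFunLike.congr_fun (BalTensor.hom_ext (f := BalTensor.map LinearMap.id LinearMap.id)
          (g := AddMonoidHom.id _) fun _ _ => rfl) _ }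
  exact ⟨g, GComod.hom_ext fun α m => (e α).symm_apply_apply m,
    GComod.hom_ext fun α n => (e α).apply_symm_apply n⟩

theorem GComod.bijective_of_isIso {M N : GComod 𝒞} (f : M ⟶ N) [IsIso f] (α : G) :
    Function.Bijective (f.f α) := by
  refine Function.bijective_iff_has_inverse.2 ⟨(inv f).f α, fun m => ?_, fun n => ?_⟩
  · rw [← GComod.comp_f, IsIso.hom_inv_id, GComod.id_f]
  · rw [← GComod.comp_f, IsIso.inv_hom_id, GComod.id_f]

namespace Grouplike

variable (x : Grouplike 𝒞) {B : Subring A} (hB : B ≤ x.T)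

theorem isIso_unit_iff : IsIso (x.adjunction hB).unit ↔
    ∀ (N : Type u) [AddCommGroup N] [Module (↥B)ᵐᵒᵖ N], Function.Bijective (x.unitHom hB N) := by
  rw [NatTrans.isIso_iff_isIso_app]
  constructor
  · intro h N _ _
    exact (ConcreteCategory.isIso_iff_bijective
      ((x.adjunction hB).unit.app (ModuleCat.of (↥B)ᵐᵒᵖ N))).1 (h _)
  · intro h N
    exact (ConcreteCategory.isIso_iff_bijective _).2 (h N)

theorem isIso_counit_iff : IsIso (x.adjunction hB).counit ↔
    ∀ (M : GComod 𝒞) (α : G), Function.Bijective (x.counitHom hB M α) := by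
  rw [NatTrans.isIso_iff_isIso_app]
  constructor
  · intro h M α
    have := h M
    exact GComod.bijective_of_isIso ((x.adjunction hB).counit.app M) α
  · intro h M
    exact GComod.isIso_of_bijective _ (h M)

variable {hB} (hcan : ∀ α, Function.Bijective (x.canComponent hB α).left)

include hcan in
/-- A coinvariant family `t` of `N ⊗_B A` satisfies `t_α h(a) = ∑ n h(b a) ⊗ 1` if
`t_γ = ∑ n ⊗ b`, whence the unit is onto when the trace ideal of `A` is `B`. -/
theorem unitHom_bijective (hA : LeftProgenerator B A) (N : Type u) [AddCommGroup N]
    [Module (↥B)ᵐᵒᵖ N] : Function.Bijective (x.unitHom hB N) := by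
  obtain ⟨m, a, h, hah⟩ := hA.exists_sum_eq_one
  let r : BalTensor B N A →+ N :=
    ∑ j, (BalTensor.contractRight N (h j)).comp (DistribSMul.toAddMonoidHom _ (op (a j)))
  have hr (t) : r t = ∑ j, BalTensor.contractRight N (h j) (op (a j) • t) := by
    simp only [r, AddMonoidHom.finsetSum_apply]
    rfl
  constructor
  · refine Function.LeftInverse.injective (g := fun t => r (t.1 1)) fun n => ?_
    change r (BalTensor.tmul B n 1) = n
    simp only [hr, BalTensor.op_smul_tmul, op_smul_eq_mul, one_mul, BalTensor.contractRight_tmul]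
    rw [← Finset.sum_smul, ← Finset.op_sum, hah, MulOpposite.op_one, one_smul]
  · rintro ⟨t : G → BalTensor B N A, ht⟩
    refine ⟨r (t 1), Subtype.ext (funext fun α => ?_)⟩
    change BalTensor.tmul B (r (t 1)) 1 = t α
    have key (j) : BalTensor.tmul B (BalTensor.contractRight N (h j) (op (a j) • t 1)) (1 : A) =
        op ((h j (a j) : B) : A) • t α := by
      let φ : 𝒞.C α⁻¹ →ₗ[A] A :=
        (x.canForm hcan α⁻¹ (h j)).comp (BalTensor.opSMulₗ (𝒞.C α⁻¹) (a j))
      have h₁ : BalTensor.contractRight (BalTensor B N A) φ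
          (x.inducedCoactionHom hB N α⁻¹ (t 1)) =
          BalTensor.contractRight (BalTensor B N A) φ (BalTensor.tmul A (t α) (x.x α⁻¹)) :=
        congrArg _ (ht α α⁻¹ 1 (mul_inv_cancel α))
      rw [BalTensor.contractRight_tmul] at h₁
      have h₂ : φ (x.x α⁻¹) = h j (a j) := x.canForm_x hcan _ _ _
      rw [← h₂]
      refine Eq.trans ?_ h₁
      refine DFunLike.congr_fun (BalTensor.hom_ext
        (f := ((BalTensor.mk B N A).flip 1).comp ((BalTensor.contractRight N (h j)).comp
          (DistribSMul.toAddMonoidHom _ (op (a j)))))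
        (g := (BalTensor.contractRight _ φ).comp (x.inducedCoactionHom hB N α⁻¹))
        fun n b => ?_) (t 1)
      change BalTensor.tmul B (op (h j (b * a j)) • n) (1 : A) =
        BalTensor.tmul B n (1 * x.canForm hcan α⁻¹ (h j) (op (a j) • op b • x.x α⁻¹))
      rw [← mul_smul, ← MulOpposite.op_mul, canForm_x, BalTensor.smul_tmul, one_mul]
      exact congrArg (BalTensor.tmul B n) (mul_one _)
    rw [hr, BalTensor.sum_tmul]
    simp only [key]
    rw [← Finset.sum_smul, ← Finset.op_sum, ← AddSubmonoidClass.coe_finsetSum, hah]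
    exact one_smul _ _

/-- The coinvariant family `(m_{(0)} h(m_{(1)}))_δ` attached to `m ∈ M_α` and `h : A → B`, where
`h` acts on `C_{δ⁻¹α}` as `a x b ↦ a h(b)`. -/
noncomputable def coinvOfForm (M : GComod 𝒞) (α : G) (h : A →ₗ[B] B) : M.M α →+ x.Coinv hB M :=
  AddMonoidHom.mk' (fun m => ⟨fun δ => BalTensor.contractRight (M.M δ)
      (x.canForm hcan (δ⁻¹ * α) h) (M.ρ δ (δ⁻¹ * α) α (mul_inv_cancel_left δ α) m),
    fun δ β γ e => by
      have H := M.coassoc δ β (γ⁻¹ * α) γ (δ⁻¹ * α) α e (mul_inv_cancel_left γ α)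
        (by rw [← e]; group) (mul_inv_cancel_left δ α) m
      dsimp only
      rw [← BalTensor.map_contractRight_assoc, H, BalTensor.map_map]
      generalize M.ρ δ (δ⁻¹ * α) α _ m = t
      induction t using BalTensor.induction_on with
      | zero => simp only [map_zero, BalTensor.zero_tmul]
      | tmul m' c =>
        rw [BalTensor.contractRight_tmul, BalTensor.smul_tmul, ← x.contractRight_canForm hcan]
        rfl
      | add s t hs ht => rw [map_add, hs, ht, map_add, BalTensor.add_tmul]⟩)
    (fun m m' => Subtype.ext (funext fun δ => by
      change BalTensor.contractRight _ _ (M.ρ _ _ _ _ (m + m')) = _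
      rw [map_add, map_add]
      rfl))

theorem coinvOfForm_coinv (M : GComod 𝒞) (α : G) (h : A →ₗ[B] B) (m : x.Coinv hB M) (a : A) :
    x.coinvOfForm hcan M α h (op a • m.1 α) = op (h a) • m := by
  refine Subtype.ext (funext fun δ => ?_)
  change BalTensor.contractRight _ _ (M.ρ _ _ _ _ (op a • m.1 α)) = op ((h a : B) : A) • m.1 δ
  rw [map_smul, m.2, BalTensor.op_smul_tmul, BalTensor.contractRight_tmul, canForm_x]

include hcan in
/-- The inverse of the counit is `m ↦ ∑ m_{(0)} h_k(m_{(1)}) ⊗ a_k` for a dual basis of `A`. -/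
theorem counitHom_bijective (hA : LeftProgenerator B A) (M : GComod 𝒞) (α : G) :
    Function.Bijective (x.counitHom hB M α) := by
  obtain ⟨n, a, h, hah⟩ := hA.exists_isDualBasis
  let r : M.M α →+ BalTensor B (x.Coinv hB M) A :=
    ∑ k, ((BalTensor.mk B _ A).flip (a k)).comp (x.coinvOfForm hcan M α (h k))
  have hr (m) : r m = ∑ k, BalTensor.tmul B (x.coinvOfForm hcan M α (h k) m) (a k) := by
    simp only [r, AddMonoidHom.finsetSum_apply]
    rfl
  constructor
  · refine Function.LeftInverse.injective (g := r) fun t => ?_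
    refine DFunLike.congr_fun (BalTensor.hom_ext (f := r.comp (x.counitAddHom hB M α))
      (g := AddMonoidHom.id _) fun m b => ?_) t
    change r (op b • m.1 α) = BalTensor.tmul B m b
    simp only [hr, coinvOfForm_coinv, BalTensor.smul_tmul]
    rw [← BalTensor.tmul_sum, hah]
  · intro m
    refine ⟨r m, ?_⟩
    rw [hr, map_sum]
    have e (k) : x.counitHom hB M α (BalTensor.tmul B (x.coinvOfForm hcan M α (h k) m) (a k)) =
        BalTensor.contractRight (M.M α) (op (a k) • x.canForm hcan (α⁻¹ * α) (h k))
          (M.ρ α (α⁻¹ * α) α (mul_inv_cancel_left α α) m) := by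
      rw [contractRight_op_smul]
      rfl
    simp only [e]
    rw [← BalTensor.contractRight_sum, x.sum_canForm_eq_counit hcan hah _ (inv_mul_cancel α)]
    exact M.counit _ _ _ _ _

end Grouplike

end GroupCoring

/-! ### The left dual as a comodule -/

namespace GroupCoring

variable {G A : Type u} [Group G] [Ring A] {𝒞 : GroupCoring G A}

/-- The product `(f # g)(c) = g(c_{(1,β)} f(c_{(2,δ)}))` of linear forms on `C_δ` and `C_β`. It is
`hash` without inverses in the degrees, so that it applies to forms on `C_β` for arbitrary `β`. -/
noncomputable def formMul {β δ γ : G} (e : β * δ = γ) (f : 𝒞.C δ →ₗ[A] A) (g : 𝒞.C β →ₗ[A] A) :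
    𝒞.C γ →ₗ[A] A :=
  g.comp ((BalTensor.contractRightₗ (𝒞.C β) f).comp (𝒞.Δ β δ γ e).left)

theorem formMul_apply {β δ γ : G} (e : β * δ = γ) (f : 𝒞.C δ →ₗ[A] A) (g : 𝒞.C β →ₗ[A] A)
    (c : 𝒞.C γ) : formMul e f g c =
      g (BalTensor.contractRight (𝒞.C β) f ((𝒞.Δ β δ γ e).left c)) := rfl

theorem add_formMul {β δ γ : G} (e : β * δ = γ) (f f' : 𝒞.C δ →ₗ[A] A) (g : 𝒞.C β →ₗ[A] A) :
    formMul e (f + f') g = formMul e f g + formMul e f' g := LinearMap.ext fun c => by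
  rw [formMul_apply, BalTensor.contractRight_add, map_add]
  rfl

theorem op_smul_formMul {β δ γ : G} (e : β * δ = γ) (a : A) (f : 𝒞.C δ →ₗ[A] A)
    (g : 𝒞.C β →ₗ[A] A) :
    formMul e (op a • f) g = formMul e f (g.comp (BalTensor.opSMulₗ (𝒞.C β) a)) :=
  LinearMap.ext fun c => by
    rw [formMul_apply, Grouplike.contractRight_op_smul]
    rfl

/-- Expansion of `g` along a dual basis in `f # g`. -/
theorem sum_op_smul_formMul {β δ γ : G} (e : β * δ = γ) {ι : Type*} [Fintype ι] {b : ι → 𝒞.C β}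
    {φ : ι → 𝒞.C β →ₗ[A] A} (H : IsDualBasis b φ) (f : 𝒞.C δ →ₗ[A] A) (g : 𝒞.C β →ₗ[A] A) :
    ∑ i, op (g (b i)) • formMul e f (φ i) = formMul e f g := LinearMap.ext fun c => by
  rw [formMul_apply]
  conv_rhs => rw [← H (BalTensor.contractRight (𝒞.C β) f ((𝒞.Δ β δ γ e).left c)), map_sum]
  simp only [map_smul, LinearMap.sum_apply, LinearMap.smul_apply, formMul_apply, op_smul_eq_mul,
    smul_eq_mul]

theorem formMul_assoc {α β γ αβ βγ δ : G} (h₁ : α * β = αβ) (h₂ : αβ * γ = δ) (h₃ : β * γ = βγ)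
    (h₄ : α * βγ = δ) (f : 𝒞.C γ →ₗ[A] A) (g : 𝒞.C β →ₗ[A] A) (k : 𝒞.C α →ₗ[A] A) :
    formMul h₄ (formMul h₃ f g) k = formMul h₂ f (formMul h₁ g k) := LinearMap.ext fun c => by
  have H := 𝒞.coassoc α β γ αβ βγ δ h₁ h₂ h₃ h₄ c
  rw [formMul_apply, formMul_apply, formMul_apply]
  refine congrArg k ?_
  have key := congrArg (fun t => BalTensor.contractRight (𝒞.C α) g
    (BalTensor.map LinearMap.id (BalTensor.contractRightₗ (𝒞.C β) f) t)) H
  rw [BalTensor.map_contractRight_assoc, BalTensor.contractRight_map, LinearMap.id_apply,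
    BalTensor.contractRight_map, LinearMap.id_apply] at key
  exact key.symm

theorem formMul_counit {δ e : G} (he : e = 1) (h : e * δ = δ) (f : 𝒞.C δ →ₗ[A] A) :
    formMul h f (𝒞.ε e he).left = f := LinearMap.ext fun c => by
  rw [formMul_apply]
  conv_rhs => rw [← 𝒞.counit_left δ e he h c]
  generalize (𝒞.Δ e δ δ h).left c = t
  induction t using BalTensor.induction_on with
  | zero => simp only [map_zero]
  | tmul m n =>
    rw [BalTensor.contractRight_tmul, BalTensor.contractLeft_tmul, BimodHom.map_op_smul,
      BimodHom.right_apply, map_smul]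
    rfl
  | add s t hs ht => simp only [map_add, hs, ht]

variable {κ : G → Type*} [∀ β, Fintype (κ β)] {b : ∀ β, κ β → 𝒞.C β}
  {φ : ∀ β, κ β → 𝒞.C β →ₗ[A] A} (H : ∀ β, IsDualBasis (b β) (φ β))

/-- The coaction `f ↦ ∑ (f # φ_i) ⊗ b_i` on linear forms, for a dual basis `(b_i, φ_i)` of `C_β`. -/
noncomputable def formCoactionHom {κ : Type*} [Fintype κ] {α β γ : G} (e : β * γ = α)
    (b : κ → 𝒞.C β) (φ : κ → 𝒞.C β →ₗ[A] A) :
    (𝒞.C γ →ₗ[A] A) →+ BalTensor A (𝒞.C α →ₗ[A] A) (𝒞.C β) :=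
  AddMonoidHom.mk' (fun f => ∑ i, BalTensor.tmul A (formMul e f (φ i)) (b i)) (fun f f' => by
    simp only [add_formMul, BalTensor.add_tmul, Finset.sum_add_distrib])

theorem contractRight_formCoactionHom {κ : Type*} [Fintype κ] {α β γ : G} (e : β * γ = α)
    {b : κ → 𝒞.C β} {φ : κ → 𝒞.C β →ₗ[A] A} (H : IsDualBasis b φ) (f : 𝒞.C γ →ₗ[A] A)
    (g : 𝒞.C β →ₗ[A] A) :
    BalTensor.contractRight _ g (formCoactionHom e b φ f) = formMul e f g := by
  rw [← sum_op_smul_formMul e H]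
  exact map_sum _ _ _

/-- The coaction as a right linear map; linearity is checked by contracting with linear forms. -/
noncomputable def formCoaction {κ : Type*} [Fintype κ] {α β γ : G} (e : β * γ = α)
    {b : κ → 𝒞.C β} {φ : κ → 𝒞.C β →ₗ[A] A} (H : IsDualBasis b φ) :
    (𝒞.C γ →ₗ[A] A) →ₗ[Aᵐᵒᵖ] BalTensor A (𝒞.C α →ₗ[A] A) (𝒞.C β) where
  toFun := formCoactionHom e b φ
  map_add' := map_add _
  map_smul' a f := H.tensor_ext fun i => by
    obtain ⟨a, rfl⟩ := MulOpposite.op_surjective a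
    have h (t : BalTensor A (𝒞.C α →ₗ[A] A) (𝒞.C β)) :
        BalTensor.contractRight _ (φ i) (op a • t) =
          BalTensor.contractRight _ ((φ i).comp (BalTensor.opSMulₗ (𝒞.C β) a)) t :=
      (BalTensor.contractRight_map LinearMap.id (BalTensor.opSMulₗ (𝒞.C β) a) (φ i) t)
    rw [contractRight_formCoactionHom e H, op_smul_formMul, RingHom.id_apply, h,
      contractRight_formCoactionHom e H]

/-- The left dual graded ring `(R_α)_α` as a right comodule. Since the `C_β` are finitely generated
projective, right multiplication by linear forms on `C_β` is a coaction. -/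
noncomputable def dualComod : GComod 𝒞 where
  M := 𝒞.Dual
  ρ α β γ h := formCoaction (by rw [← h]; group : β * γ⁻¹ = α⁻¹) (H β)
  coassoc α β γ αβ βγ δ h₁ h₂ h₃ h₄ f := by
    refine ((H β).balTensor (H γ)).tensor_ext fun i => ?_
    have e₁ : β * αβ⁻¹ = α⁻¹ := by rw [← h₁]; group
    have e₂ : γ * δ⁻¹ = αβ⁻¹ := by rw [← h₂]; group
    have e₄ : βγ * δ⁻¹ = α⁻¹ := by rw [← h₄]; group
    rw [BalTensor.contractRight_contractRight, BalTensor.map_contractRight_assoc]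
    refine (congrArg _ (congrArg _ (contractRight_formCoactionHom e₂ (H γ) f _))).trans ?_
    refine (contractRight_formCoactionHom e₁ (H β) _ _).trans ?_
    rw [BalTensor.contractRight_map, LinearMap.id_apply, formMul_assoc h₃ e₄ e₂ e₁]
    exact (contractRight_formCoactionHom e₄ (H βγ) f _).symm
  counit α e he h f :=
    (contractRight_formCoactionHom (by rw [he, one_mul]) (H e) f _).trans (formMul_counit he _ f)

namespace Grouplike

variable (x : Grouplike 𝒞) {B : Subring A} (hB : B ≤ x.T)

/-- Coinvariants of the left dual are elements of `Q`. -/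
theorem mem_Q_of_mem_coinvariants {q : ∀ α, 𝒞.Dual α}
    (hq : q ∈ x.coinvariants (dualComod H)) : q ∈ x.Q := fun α β γ h c => by
  refine (H β⁻¹).ext fun g => ?_
  have e : β⁻¹ * α⁻¹ = γ⁻¹ := by rw [← h, mul_inv_rev]
  have h₁ : BalTensor.contractRight _ g (formCoactionHom e (b β⁻¹) (φ β⁻¹) (q α)) =
      op (g (x.x β⁻¹)) • q γ :=
    congrArg (BalTensor.contractRight (𝒞.Dual γ) g)
      (hq γ β⁻¹ α (by rw [← h, mul_inv_cancel_right]))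
  rw [contractRight_formCoactionHom e (H _)] at h₁
  rw [map_smul]
  exact LinearMap.congr_fun h₁ c

include H in
/-- The value `ε` of the counit at the comodule `R` is of the form `∑ q_i(-) a_i`. -/
theorem exists_sum_eq_counit_of_counit
    (h : ∀ (M : GComod 𝒞) (α : G), Function.Bijective (x.counitHom hB M α)) :
    ∃ (ι : Type) (_ : Fintype ι) (q : ι → x.Q) (a : ι → A),
      ∑ i, op (a i) • (q i).1 1 = (𝒞.ε 1⁻¹ inv_one).left := by
  obtain ⟨t, ht⟩ := (h (dualComod H) 1).2 (𝒞.ε 1⁻¹ inv_one).left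
  obtain ⟨ι, _, q, a, rfl⟩ := BalTensor.exists_sum_tmul t
  refine ⟨ι, inferInstance, fun i => ⟨(q i).1, x.mem_Q_of_mem_coinvariants H (q i).2⟩, a, ?_⟩
  rw [map_sum] at ht
  exact ht

/-- The unit at `B` is the map `i`, since `B ⊗_B A = A` has the coinvariants `S`. -/
theorem i_surjective_of_unit (h : Function.Surjective (x.unitHom hB B)) (hBT : B = x.T) :
    Function.Surjective x.i := by
  intro s
  have hs : (fun γ => BalTensor.tmul B (1 : B) (s.1 γ)) ∈ x.coinvariants (x.F7obj hB B) := by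
    intro α β γ e
    change BalTensor.tmul A (BalTensor.tmul B (1 : B) (1 : A)) (op (s.1 γ) • x.x β) =
      BalTensor.tmul A (BalTensor.tmul B (1 : B) (s.1 α)) (x.x β)
    have h₁ : s.1 α • x.x β = op (s.1 γ) • x.x β := by
      obtain ⟨β, rfl⟩ : ∃ β', β = β'⁻¹ := ⟨β⁻¹, (inv_inv β).symm⟩
      exact s.2 γ β α (by rw [← e, inv_mul_cancel_right])
    rw [← h₁, ← BalTensor.smul_tmul, BalTensor.op_smul_tmul, op_smul_eq_mul, one_mul]
  obtain ⟨b, hb⟩ := h ⟨_, hs⟩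
  refine ⟨⟨b, hBT ▸ b.2⟩, Subtype.ext (funext fun γ => ?_)⟩
  have h₂ : BalTensor.tmul B b (1 : A) = BalTensor.tmul B (1 : B) (s.1 γ) :=
    congrFun (congrArg Subtype.val hb) γ
  let ψ : BalTensor B B A →+ A := BalTensor.contractLeft A LinearMap.id
  have h₃ : b • (1 : A) = (1 : B) • s.1 γ := congrArg ψ h₂
  rw [one_smul] at h₃
  exact (mul_one (b : A)).symm.trans h₃

end Grouplike

end GroupCoring

/-! ### Comparison of the conditions -/

namespace GroupCoring.Grouplike

variable {G A : Type u} [Group G] [Ring A] {𝒞 : GroupCoring G A} (x : Grouplike 𝒞)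
  {B : Subring A} (hB : B ≤ x.T)

theorem eq_T_of_faithfullyFlat (hcan : ∀ α, Function.Bijective (x.canComponent hB α).left)
    (hA : LeftFaithfullyFlat B A) : B = x.T := by
  refine le_antisymm hB fun a ha => hA.mem_of_tmul_one_eq ((hcan 1).1 ?_)
  rw [canComponent_tmul, canComponent_tmul, MulOpposite.op_one, one_smul, one_smul, ha]

/-- A strict Morita context with `S = T = B` makes the canonical morphism invertible and `A` a
progenerator. -/
theorem of_isStrict (hBT : B = x.T) (hi : Function.Surjective x.i)
    (hs : x.moritaContext.IsStrict) :
    (∀ α, Function.Bijective (x.canComponent hB α).left) ∧ LeftProgenerator B A := by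
  obtain ⟨ι, _, q, a, hq⟩ := x.exists_sum_eq_counit_of_surjective hs.2.2
  choose h hh using fun i => x.exists_form_of_Q hBT hi (q i)
  obtain ⟨hah, hcan⟩ := x.isDualBasis_and_can_bijective hB hq hh
  obtain ⟨κ, _, σ, q', a', hq'⟩ := x.exists_sum_evalQ_eq_one_of_surjective hs.1.2
  choose h' hh' using fun j => x.exists_form_of_Q hBT hi (q' j)
  refine ⟨hcan, leftProgenerator_of_isDualBasis hah a' h' (Subtype.ext ?_)⟩
  have e := congrFun (congrArg Subtype.val hq') 1
  rw [AddSubmonoidClass.coe_finsetSum, Finset.sum_apply] at e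
  rw [AddSubmonoidClass.coe_finsetSum]
  exact (Finset.sum_congr rfl fun j _ => (hh' j (σ j * 1) (a' j)).symm).trans e

/-- If the adjunction is an equivalence, the counit at the comodule `R` provides the dual basis, and
the unit shows that `- ⊗_B A` reflects zero. -/
theorem of_isIso_adjunction (h𝒞 : 𝒞.IsLeftHomogeneousProgenerator) (hBT : B = x.T)
    (hunit : ∀ (N : Type u) [AddCommGroup N] [Module (↥B)ᵐᵒᵖ N],
      Function.Bijective (x.unitHom hB N))
    (hcounit : ∀ (M : GComod 𝒞) (α : G), Function.Bijective (x.counitHom hB M α)) :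
    (∀ α, Function.Bijective (x.canComponent hB α).left) ∧ LeftProgenerator B A := by
  choose n b φ H using fun β => (h𝒞 β).exists_isDualBasis
  obtain ⟨ι, _, q, a, hq⟩ := x.exists_sum_eq_counit_of_counit H hB hcounit
  have hi := x.i_surjective_of_unit hB (hunit B).2 hBT
  choose h hh using fun i => x.exists_form_of_Q hBT hi (q i)
  obtain ⟨hah, hcan⟩ := x.isDualBasis_and_can_bijective hB hq hh
  obtain ⟨κ, _, a', h', h1⟩ := hah.exists_sum_eq_one fun N _ _ hN => by
    have : Subsingleton (x.Coinv hB (x.F7obj hB N)) :=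
      ⟨fun s t => Subtype.ext (funext fun α => hN.elim (s.1 α) (t.1 α))⟩
    exact (hunit N).1.subsingleton
  exact ⟨hcan, leftProgenerator_of_isDualBasis hah a' h' h1⟩

end GroupCoring.Grouplike

theorem mainTheorem2 {G A : Type u} [Group G] [Ring A] (𝒞 : GroupCoring G A)
    (x : 𝒞.Grouplike) (h𝒞 : 𝒞.IsLeftHomogeneousProgenerator)
    (B : Subring A) (hB : B ≤ x.T) :
    List.TFAE [
      (x.can hB).IsIso ∧ LeftFaithfullyFlat B A,
      Function.Bijective (x.can hB).leftDual ∧ LeftProgenerator B A,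
      B = x.T ∧ Function.Bijective x.i ∧ x.moritaContext.IsStrict,
      B = x.T ∧ CategoryTheory.IsIso (x.adjunction hB).unit ∧
        CategoryTheory.IsIso (x.adjunction hB).counit] := by
  have h12 := x.can_isIso_and_faithfullyFlat_iff hB h𝒞
  -- faithful flatness may be replaced by the progenerator condition once all `can'_α` are bijective
  have hub : (x.can hB).IsIso ∧ LeftFaithfullyFlat B A ↔
      (∀ α, Function.Bijective (x.canComponent hB α).left) ∧ LeftProgenerator B A := by
    refine ⟨fun h => ⟨(GroupCoring.Hom.isIso_iff _).1 h.1, (h12.1 h).2⟩, fun h => ?_⟩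
    exact ⟨(GroupCoring.Hom.isIso_iff (x.can hB)).2 h.1, h.2.leftFaithfullyFlat⟩
  rw [x.isIso_unit_iff hB, x.isIso_counit_iff hB]
  tfae_have 1 ↔ 2 := h12
  tfae_have 1 → 3 := fun h => by
    obtain ⟨hcan, hA⟩ := hub.1 h
    have hBT := x.eq_T_of_faithfullyFlat hB hcan h.2
    exact ⟨hBT, x.i_bijective hcan hBT, x.isStrict_of_can_bijective hcan hA⟩
  tfae_have 3 → 1 := fun ⟨hBT, hi, hs⟩ => hub.2 (x.of_isStrict hB hBT hi.2 hs)
  tfae_have 1 → 4 := fun h => by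
    obtain ⟨hcan, hA⟩ := hub.1 h
    exact ⟨x.eq_T_of_faithfullyFlat hB hcan h.2, fun N _ _ => x.unitHom_bijective hcan hA N,
      fun M α => x.counitHom_bijective hcan hA M α⟩
  tfae_have 4 → 1 := fun ⟨hBT, hunit, hcounit⟩ =>
    hub.2 (x.of_isIso_adjunction hB h𝒞 hBT hunit hcounit)
  tfae_finish
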